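/- Let $L_1,L_2,\nu>0$, $\Delta T\in\mathbb{R}$ and $\ell=L_2/L_1$. On the cylinder $[0,L_1]\times\mathbb{R}/L_2\mathbb{Z}$ consider complex-valued functions, let $X=H^1_0$ be the closure, in the $H^1$ norm, of the smooth functions with compact support in $(0,L_1)\times\mathbb{R}/L_2\mathbb{Z}$, and let $Z=\{f\in H^3 : f=0 \text{ for } x_1\in\{0,L_1\}\}$. For $f\in L^2$ let $A_2f=\partial_{x_2}(\nabla^2)^{-1}f$, where $W=(\nabla^2)^{-1}f$ is the solution of $\nabla^2W=f$ with $W=0$ for $x_1\in\{0,L_1\}$. Let $\mathbf{L}$ be the unbounded operator in $X\times X$ given by $$\mathbf{L}u=\begin{pmatrix}\Delta T\,\partial_{x_2}u_1+\frac1{L_1}A_2(u_1+u_2)+\nu\nabla^2u_1\\ -\frac1{L_1}A_2(u_1+u_2)+\nu\nabla^2u_2\end{pmatrix}$$ on the domain of those $u=(u_1,u_2)\in Z\times Z$ for which $\mathbf{L}u\in X\times X$. Let $\sigma(\mathbf{L})$ be its spectrum, that is, the set of $\lambda\in\mathbb{C}$ for which $\lambda-\mathbf{L}$ does not map the domain bijectively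 onto $X\times X$ with bounded inverse, and let $\sigma_-(\mathbf{L})=\{\lambda\in\sigma(\mathbf{L}):\operatorname{Re}\lambda<0\}$. For $k=(k_1,k_2)\in\mathbb{N}_*\times\mathbb{Z}$, where $\mathbb{N}_*=\{1,2,\dots\}$, put $$D_k=\frac{k_2^2\,\Delta T}{\ell^2L_1}\left(\frac{4}{k_1^2+4(k_2/\ell)^2}-\pi^2\frac{\Delta T}{L_1}\right),\qquad \lambda_k^\pm=\mathrm{i}\pi\frac{k_2\Delta T}{\ell L_1}-\pi^2\frac{\nu}{L_1^2}\left(k_1^2+\frac{4k_2^2}{\ell^2}\right)\pm\sqrt{D_k},$$ with the principal square root ($\sqrt{D_k}=\mathrm{i}\sqrt{|D_k|}$ if $D_k<0$). Then: 1. $\sigma(\mathbf{L})=\{\lambda_k^+,\lambda_k^- : k\in\mathbb{N}_*\times\mathbb{Z}\}$, and every element of $\sigma(\mathbf{L})$ is an eigenvalue of $\mathbf{L}$. 2. $\lambda_k^-\in\sigma_-(\mathbf{L})$ for all $k\in\mathbb{N}_*\times\mathbb{Z}$. 3. If $D_k\le0$, then $\lambda_k^+\in\sigma_-(\mathbf{L})$.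 4. $\operatorname{Re}\lambda^+_{(k_1,k_2)}<\operatorname{Re}\lambda^+_{(1,k_2)}$ for all $k_1\in\mathbb{N}_*$ with $k_1\ne1$ and all $k_2\in\mathbb{Z}$. -/

import Mathlib

open MeasureTheory Set Filter Topology
open scoped ContDiff

namespace TwoFluid

/-- The fundamental domain `(0, L₁) × (0, L₂)` of the cylinder `[0, L₁] × ℝ / L₂ℤ`. -/
def cell (L₁ L₂ : ℝ) : Set (ℝ × ℝ) := Ioo 0 L₁ ×ˢ Ioo 0 L₂

/-- Lebesgue measure on the cylinder. -/
noncomputable def cyl (L₁ L₂ : ℝ) : Measure (ℝ × ℝ) := volume.restrict (cell L₁ L₂)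

/-- Complex-valued square integrable functions on the cylinder. -/
noncomputable abbrev LTwo (L₁ L₂ : ℝ) := Lp ℂ 2 (cyl L₁ L₂)

/-- Test functions on the open cylinder `(0, L₁) × ℝ / L₂ℤ`: smooth functions on the plane that are
`L₂`-periodic in the second variable and whose support in the first variable stays in a compact
subinterval of `(0, L₁)`. -/
structure IsTest (L₁ L₂ : ℝ) (φ : ℝ × ℝ → ℂ) : Prop where
  smooth : ContDiff ℝ ∞ φ
  periodic : ∀ x y, φ (x, y + L₂) = φ (x, y)
  support : ∃ a b, 0 < a ∧ b < L₁ ∧ ∀ x y, φ (x, y) ≠ 0 → x ∈ Icc a b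

/-- The partial derivative of `φ` in the direction `e`. -/
noncomputable def pd (e : ℝ × ℝ) (φ : ℝ × ℝ → ℂ) : ℝ × ℝ → ℂ := fun p => fderiv ℝ φ p e

/-- `g` is the weak derivative of `f` in the direction `e` on the cylinder. -/
def HasWeakDeriv {L₁ L₂ : ℝ} (e : ℝ × ℝ) (f g : LTwo L₁ L₂) : Prop :=
  ∀ φ, IsTest L₁ L₂ φ →
    ∫ p, f p * pd e φ p ∂(cyl L₁ L₂) = -∫ p, g p * φ p ∂(cyl L₁ L₂)

/-- `f` belongs to the Sobolev space `H^m` of the cylinder. -/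
def MemH {L₁ L₂ : ℝ} : ℕ → LTwo L₁ L₂ → Prop
  | 0, _ => True
  | m + 1, f => ∃ g h : LTwo L₁ L₂,
      HasWeakDeriv (1, 0) f g ∧ HasWeakDeriv (0, 1) f h ∧ MemH m g ∧ MemH m h

/-- Triples `(f, f₁, f₂)` of square integrable functions, with the Hilbert norm
`(‖f‖² + ‖f₁‖² + ‖f₂‖²)^(1/2)`. -/
noncomputable abbrev Jet (L₁ L₂ : ℝ) := PiLp 2 (fun _ : Fin 3 => LTwo L₁ L₂)

/-- The triples `(φ, ∂₁φ, ∂₂φ)` for a test function `φ`. -/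
def testJets (L₁ L₂ : ℝ) : Set (Jet L₁ L₂) :=
  {v | ∃ φ, IsTest L₁ L₂ φ ∧ v 0 =ᵐ[cyl L₁ L₂] φ ∧ v 1 =ᵐ[cyl L₁ L₂] pd (1, 0) φ ∧
    v 2 =ᵐ[cyl L₁ L₂] pd (0, 1) φ}

/-- The space `X = H¹₀` of the cylinder, the closure of the test functions in the `H¹` norm.
An element is stored as `(f, ∂₁f, ∂₂f)`, so that the norm of the ambient space is the `H¹` norm. -/
noncomputable def HOneZero (L₁ L₂ : ℝ) : Submodule ℂ (Jet L₁ L₂) :=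
  (Submodule.span ℂ (testJets L₁ L₂)).topologicalClosure

/-- The phase space `X × X`. -/
noncomputable abbrev Phase (L₁ L₂ : ℝ) := HOneZero L₁ L₂ × HOneZero L₁ L₂

/-- `v = (f, ∂₁f, ∂₂f)` satisfies `∇²f = g` weakly on the cylinder. -/
def HasWeakLaplacian {L₁ L₂ : ℝ} (v : HOneZero L₁ L₂) (g : LTwo L₁ L₂) : Prop :=
  ∀ φ, IsTest L₁ L₂ φ →
    ∫ p, (v.1 1 p * pd (1, 0) φ p + v.1 2 p * pd (0, 1) φ p) ∂(cyl L₁ L₂) =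
      -∫ p, g p * φ p ∂(cyl L₁ L₂)

/-- `A₂ f = a`, where `A₂ = ∂₂ (∇²)⁻¹` and `(∇²)⁻¹` solves the Poisson equation with homogeneous
Dirichlet conditions on the boundary circles. -/
def IsATwo {L₁ L₂ : ℝ} (f a : LTwo L₁ L₂) : Prop :=
  ∃ W : HOneZero L₁ L₂, HasWeakLaplacian W f ∧ W.1 2 = a

/-- The space `Z` of functions in `H³` that vanish on the boundary circles. -/
def MemZ {L₁ L₂ : ℝ} (v : HOneZero L₁ L₂) : Prop := MemH 3 (v.1 0)

/-- `u ∈ Z × Z`, `F ∈ X × X` and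
`F₁ = ΔT ∂₂u₁ + A₂(u₁ + u₂)/L₁ + ν ∇²u₁`, `F₂ = -A₂(u₁ + u₂)/L₁ + ν ∇²u₂`. -/
def LinRel {L₁ L₂ : ℝ} (ν ΔT : ℝ) (u F : Phase L₁ L₂) : Prop :=
  MemZ u.1 ∧ MemZ u.2 ∧ ∃ a g₁ g₂ : LTwo L₁ L₂,
    IsATwo (u.1.1 0 + u.2.1 0) a ∧ HasWeakLaplacian u.1 g₁ ∧ HasWeakLaplacian u.2 g₂ ∧
    F.1.1 0 = (ΔT : ℂ) • u.1.1 2 + ((1 / L₁ : ℝ) : ℂ) • a + (ν : ℂ) • g₁ ∧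
    F.2.1 0 = -(((1 / L₁ : ℝ) : ℂ) • a) + (ν : ℂ) • g₂

section facts

variable {L₁ L₂ : ℝ}

instance : IsFiniteMeasure (cyl L₁ L₂) := by
  refine ⟨?_⟩
  rw [cyl, Measure.restrict_apply_univ]
  exact lt_of_le_of_lt (measure_mono (prod_mono Ioo_subset_Icc_self Ioo_subset_Icc_self))
    (isCompact_Icc.prod isCompact_Icc).measure_lt_top

theorem memLp_of_continuous {φ : ℝ × ℝ → ℂ} (h : Continuous φ) : MemLp φ 2 (cyl L₁ L₂) := by
  obtain ⟨C, hC⟩ := ((isCompact_Icc (a := (0 : ℝ)) (b := L₁)).prod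
    (isCompact_Icc (a := (0 : ℝ)) (b := L₂))).exists_bound_of_continuousOn h.continuousOn
  refine MemLp.of_bound h.aestronglyMeasurable C ?_
  refine (ae_restrict_iff' (measurableSet_Ioo.prod measurableSet_Ioo)).2 (ae_of_all _ ?_)
  intro p hp
  exact hC p ⟨Ioo_subset_Icc_self hp.1, Ioo_subset_Icc_self hp.2⟩

theorem integrable_mul_of_continuous (f : LTwo L₁ L₂) {φ : ℝ × ℝ → ℂ} (h : Continuous φ) :
    Integrable (fun p => f p * φ p) (cyl L₁ L₂) :=
  (Lp.memLp f).integrable_mul (memLp_of_continuous h)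

theorem IsTest.continuous_pd {φ : ℝ × ℝ → ℂ} (h : IsTest L₁ L₂ φ) (e : ℝ × ℝ) :
    Continuous (pd e φ) :=
  (h.smooth.continuous_fderiv (by simp)).clm_apply continuous_const

theorem integral_add_mul (f g : LTwo L₁ L₂) {φ : ℝ × ℝ → ℂ} (h : Continuous φ) :
    ∫ p, (f + g) p * φ p ∂(cyl L₁ L₂) =
      ∫ p, f p * φ p ∂(cyl L₁ L₂) + ∫ p, g p * φ p ∂(cyl L₁ L₂) := by
  rw [← integral_add (integrable_mul_of_continuous f h) (integrable_mul_of_continuous g h)]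
  refine integral_congr_ae ?_
  filter_upwards [Lp.coeFn_add f g] with p hp
  rw [hp, Pi.add_apply, add_mul]

theorem integral_smul_mul (c : ℂ) (f : LTwo L₁ L₂) (φ : ℝ × ℝ → ℂ) :
    ∫ p, (c • f) p * φ p ∂(cyl L₁ L₂) = c * ∫ p, f p * φ p ∂(cyl L₁ L₂) := by
  rw [← integral_const_mul]
  refine integral_congr_ae ?_
  filter_upwards [Lp.coeFn_smul c f] with p hp
  rw [hp, Pi.smul_apply, smul_eq_mul, mul_assoc]

theorem HasWeakDeriv.add {e : ℝ × ℝ} {f g f' g' : LTwo L₁ L₂} (h : HasWeakDeriv e f g)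
    (h' : HasWeakDeriv e f' g') : HasWeakDeriv e (f + f') (g + g') := by
  intro φ hφ
  rw [integral_add_mul _ _ (hφ.continuous_pd e), integral_add_mul _ _ hφ.smooth.continuous,
    h φ hφ, h' φ hφ, neg_add]

theorem HasWeakDeriv.smul {e : ℝ × ℝ} {f g : LTwo L₁ L₂} (c : ℂ) (h : HasWeakDeriv e f g) :
    HasWeakDeriv e (c • f) (c • g) := by
  intro φ hφ
  rw [integral_smul_mul, integral_smul_mul, h φ hφ, mul_neg]

theorem MemH.add {m : ℕ} {f g : LTwo L₁ L₂} (hf : MemH m f) (hg : MemH m g) :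
    MemH m (f + g) := by
  induction m generalizing f g with
  | zero => trivial
  | succ m ih =>
    obtain ⟨a, b, ha, hb, ha', hb'⟩ := hf
    obtain ⟨c, d, hc, hd, hc', hd'⟩ := hg
    exact ⟨a + c, b + d, ha.add hc, hb.add hd, ih ha' hc', ih hb' hd'⟩

theorem MemH.smul {m : ℕ} {f : LTwo L₁ L₂} (c : ℂ) (hf : MemH m f) : MemH m (c • f) := by
  induction m generalizing f with
  | zero => trivial
  | succ m ih =>
    obtain ⟨a, b, ha, hb, ha', hb'⟩ := hf
    exact ⟨c • a, c • b, ha.smul c, hb.smul c, ih ha', ih hb'⟩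

theorem weakLaplacian_iff (v : HOneZero L₁ L₂) (g : LTwo L₁ L₂) :
    HasWeakLaplacian v g ↔ ∀ φ, IsTest L₁ L₂ φ →
      ∫ p, v.1 1 p * pd (1, 0) φ p ∂(cyl L₁ L₂) + ∫ p, v.1 2 p * pd (0, 1) φ p ∂(cyl L₁ L₂) =
        -∫ p, g p * φ p ∂(cyl L₁ L₂) := by
  refine forall₂_congr fun φ hφ => ?_
  rw [integral_add (integrable_mul_of_continuous _ (hφ.continuous_pd _))
    (integrable_mul_of_continuous _ (hφ.continuous_pd _))]

theorem HasWeakLaplacian.add {v w : HOneZero L₁ L₂} {g h : LTwo L₁ L₂}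
    (hv : HasWeakLaplacian v g) (hw : HasWeakLaplacian w h) :
    HasWeakLaplacian (v + w) (g + h) := by
  rw [weakLaplacian_iff] at *
  intro φ hφ
  have e1 : (v + w).1 1 = v.1 1 + w.1 1 := rfl
  have e2 : (v + w).1 2 = v.1 2 + w.1 2 := rfl
  rw [e1, e2, integral_add_mul _ _ (hφ.continuous_pd _), integral_add_mul _ _ (hφ.continuous_pd _),
    integral_add_mul _ _ hφ.smooth.continuous, neg_add, ← hv φ hφ, ← hw φ hφ]
  ring

theorem HasWeakLaplacian.smul {v : HOneZero L₁ L₂} {g : LTwo L₁ L₂} (c : ℂ)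
    (hv : HasWeakLaplacian v g) : HasWeakLaplacian (c • v) (c • g) := by
  rw [weakLaplacian_iff] at *
  intro φ hφ
  have e1 : (c • v).1 1 = c • v.1 1 := rfl
  have e2 : (c • v).1 2 = c • v.1 2 := rfl
  rw [e1, e2, integral_smul_mul, integral_smul_mul, integral_smul_mul, ← mul_add, hv φ hφ, mul_neg]

theorem LinRel.add {ν ΔT : ℝ} {u F u' F' : Phase L₁ L₂} (h : LinRel ν ΔT u F)
    (h' : LinRel ν ΔT u' F') : LinRel ν ΔT (u + u') (F + F') := by
  obtain ⟨h1, h2, a, g, k, ⟨W, hW, rfl⟩, hg, hk, e1, e2⟩ := h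
  obtain ⟨h1', h2', a', g', k', ⟨W', hW', rfl⟩, hg', hk', e1', e2'⟩ := h'
  refine ⟨h1.add h1', h2.add h2', _, g + g', k + k', ⟨W + W', ?_, rfl⟩, hg.add hg', hk.add hk',
    ?_, ?_⟩
  · have := hW.add hW'
    rwa [add_add_add_comm] at this
  · change F.1.1 0 + F'.1.1 0 = (ΔT : ℂ) • (u.1.1 2 + u'.1.1 2) +
      ((1 / L₁ : ℝ) : ℂ) • (W.1 2 + W'.1 2) + _
    rw [e1, e1']
    module
  · change F.2.1 0 + F'.2.1 0 = -(((1 / L₁ : ℝ) : ℂ) • (W.1 2 + W'.1 2)) + _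
    rw [e2, e2']
    module

theorem LinRel.smul {ν ΔT : ℝ} {u F : Phase L₁ L₂} (c : ℂ) (h : LinRel ν ΔT u F) :
    LinRel ν ΔT (c • u) (c • F) := by
  obtain ⟨h1, h2, a, g, k, ⟨W, hW, rfl⟩, hg, hk, e1, e2⟩ := h
  refine ⟨h1.smul c, h2.smul c, _, c • g, c • k, ⟨c • W, ?_, rfl⟩, hg.smul c, hk.smul c, ?_, ?_⟩
  · have := hW.smul c
    rwa [smul_add] at this
  · change c • F.1.1 0 = (ΔT : ℂ) • (c • u.1.1 2) + ((1 / L₁ : ℝ) : ℂ) • (c • W.1 2) + _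
    rw [e1]
    module
  · change c • F.2.1 0 = -(((1 / L₁ : ℝ) : ℂ) • (c • W.1 2)) + _
    rw [e2]
    module

theorem LinRel.zero (ν ΔT : ℝ) : LinRel ν ΔT (0 : Phase L₁ L₂) 0 := by
  have hH : ∀ m, MemH m (0 : LTwo L₁ L₂) := by
    intro m
    induction m with
    | zero => trivial
    | succ m ih =>
      have h0 : ∀ e, HasWeakDeriv e (0 : LTwo L₁ L₂) 0 := by
        intro e φ hφ
        have h1 := integral_smul_mul 0 (0 : LTwo L₁ L₂) (pd e φ)
        have h2 := integral_smul_mul 0 (0 : LTwo L₁ L₂) φ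
        rw [zero_smul, zero_mul] at h1 h2
        rw [h1, h2, neg_zero]
      exact ⟨0, 0, h0 _, h0 _, ih, ih⟩
  have hL : HasWeakLaplacian (0 : HOneZero L₁ L₂) 0 := by
    rw [weakLaplacian_iff]
    intro φ hφ
    have h1 := integral_smul_mul 0 (0 : LTwo L₁ L₂) (pd (1, 0) φ)
    have h2 := integral_smul_mul 0 (0 : LTwo L₁ L₂) (pd (0, 1) φ)
    have h3 := integral_smul_mul 0 (0 : LTwo L₁ L₂) φ
    rw [zero_smul, zero_mul] at h1 h2 h3
    change ∫ p, (0 : LTwo L₁ L₂) p * pd (1, 0) φ p ∂(cyl L₁ L₂) +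
      ∫ p, (0 : LTwo L₁ L₂) p * pd (0, 1) φ p ∂(cyl L₁ L₂) = _
    rw [h1, h2, h3]
    simp
  refine ⟨hH 3, hH 3, 0, 0, 0, ⟨0, ?_, rfl⟩, hL, hL, ?_, ?_⟩
  · change HasWeakLaplacian (0 : HOneZero L₁ L₂) (0 + 0)
    rwa [add_zero]
  · have e : ∀ j, ((0 : Phase L₁ L₂).1.1 j : LTwo L₁ L₂) = 0 := fun _ => rfl
    rw [e, e]
    simp
  · have e : ∀ j, ((0 : Phase L₁ L₂).2.1 j : LTwo L₁ L₂) = 0 := fun _ => rfl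
    rw [e]
    simp

theorem integral_mul_eq_inner (f : LTwo L₁ L₂) {φ : ℝ × ℝ → ℂ} (h : Continuous φ) :
    ∫ p, f p * φ p ∂(cyl L₁ L₂) = inner ℂ
      ((memLp_of_continuous (L₁ := L₁) (L₂ := L₂)
        (Complex.continuous_conj.comp h)).toLp _ : LTwo L₁ L₂) f := by
  rw [L2.inner_def]
  refine integral_congr_ae ?_
  filter_upwards [(memLp_of_continuous (L₁ := L₁) (L₂ := L₂)
    (Complex.continuous_conj.comp h)).coeFn_toLp] with p hp
  rw [hp]
  simp

theorem continuous_integral_mul {φ : ℝ × ℝ → ℂ} (h : Continuous φ) :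
    Continuous fun f : LTwo L₁ L₂ => ∫ p, f p * φ p ∂(cyl L₁ L₂) := by
  simp_rw [fun f : LTwo L₁ L₂ => integral_mul_eq_inner f h]
  fun_prop

theorem IsTest.mul {φ ψ : ℝ × ℝ → ℂ} (hφ : IsTest L₁ L₂ φ) (hψ : IsTest L₁ L₂ ψ) :
    IsTest L₁ L₂ (fun p => φ p * ψ p) := by
  refine ⟨hφ.smooth.mul hψ.smooth, fun x y => ?_, ?_⟩
  · rw [hφ.periodic, hψ.periodic]
  · obtain ⟨a, b, ha, hb, h⟩ := hφ.support
    exact ⟨a, b, ha, hb, fun x y hxy => h x y (left_ne_zero_of_mul hxy)⟩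

theorem IsTest.conj {φ : ℝ × ℝ → ℂ} (hφ : IsTest L₁ L₂ φ) :
    IsTest L₁ L₂ (fun p => (starRingEnd ℂ) (φ p)) := by
  refine ⟨(Complex.conjCLE.contDiff).comp hφ.smooth, fun x y => ?_, ?_⟩
  · rw [hφ.periodic]
  · obtain ⟨a, b, ha, hb, h⟩ := hφ.support
    exact ⟨a, b, ha, hb, fun x y hxy => h x y (by simpa using hxy)⟩

theorem IsTest.pd_conj {φ : ℝ × ℝ → ℂ} (hφ : IsTest L₁ L₂ φ) (e p : ℝ × ℝ) :
    pd e (fun p => (starRingEnd ℂ) (φ p)) p = (starRingEnd ℂ) (pd e φ p) := by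
  have hd : HasFDerivAt φ (fderiv ℝ φ p) p := (hφ.smooth.differentiable (by simp) p).hasFDerivAt
  have := (Complex.conjCLE.toContinuousLinearMap.hasFDerivAt (x := φ p)).comp p hd
  have h2 : fderiv ℝ (fun p => (starRingEnd ℂ) (φ p)) p = _ := this.fderiv
  simp [pd, h2]

theorem integral_cyl (h₁ : 0 < L₁) (h₂ : 0 < L₂) {φ : ℝ × ℝ → ℂ} (h : Continuous φ) :
    ∫ p, φ p ∂(cyl L₁ L₂) = ∫ x in (0 : ℝ)..L₁, ∫ y in (0 : ℝ)..L₂, φ (x, y) := by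
  have hi : IntegrableOn φ (Ioo 0 L₁ ×ˢ Ioo 0 L₂) (volume.prod volume) :=
    (memLp_of_continuous (L₁ := L₁) (L₂ := L₂) h).integrable (by norm_num)
  have := setIntegral_prod φ hi
  rw [cyl, cell]
  refine this.trans ?_
  rw [intervalIntegral.integral_of_le h₁.le, integral_Ioc_eq_integral_Ioo]
  refine setIntegral_congr_fun measurableSet_Ioo fun x _ => ?_
  rw [intervalIntegral.integral_of_le h₂.le, integral_Ioc_eq_integral_Ioo]

theorem IsTest.integral_pd (h₁ : 0 < L₁) (h₂ : 0 < L₂) {φ : ℝ × ℝ → ℂ} (hφ : IsTest L₁ L₂ φ)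
    (a b : ℝ) : ∫ p, pd (a, b) φ p ∂(cyl L₁ L₂) = 0 := by
  have hd : ∀ p, HasFDerivAt φ (fderiv ℝ φ p) p :=
    fun p => (hφ.smooth.differentiable (by simp) p).hasFDerivAt
  have hc := hφ.smooth.continuous
  have hpd : ∀ p, pd (a, b) φ p = (a • fderiv ℝ φ p) (1, 0) + (b • fderiv ℝ φ p) (0, 1) := by
    intro p
    have : ((a, b) : ℝ × ℝ) = a • (1, 0) + b • (0, 1) := by simp
    rw [pd, this, map_add, map_smul, map_smul]
    rfl
  rw [integral_cyl h₁ h₂ (hφ.continuous_pd _)]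
  simp_rw [hpd]
  rw [integral2_divergence_prod_of_hasFDerivAt (fun p => a • φ p) (fun p => b • φ p)
    (fun p => a • fderiv ℝ φ p) (fun p => b • fderiv ℝ φ p) 0 0 L₁ L₂
    (by fun_prop) (by fun_prop) (fun p _ => (hd p).const_smul a) (fun p _ => (hd p).const_smul b)]
  · obtain ⟨c, d, hc0, hd0, hs⟩ := hφ.support
    have hz : ∀ y, φ (0, y) = 0 := fun y => by
      by_contra h
      exact absurd (hs 0 y h).1 (by linarith)
    have hz' : ∀ y, φ (L₁, y) = 0 := fun y => by
      by_contra h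
      exact absurd (hs L₁ y h).2 (by linarith)
    have hp : ∀ x, φ (x, L₂) = φ (x, 0) := fun x => by
      simpa using hφ.periodic x 0
    simp [hz, hz', hp]
  · simp_rw [← hpd]
    exact (hφ.continuous_pd _).continuousOn.integrableOn_compact
      (isCompact_uIcc.prod isCompact_uIcc)

theorem IsTest.pd_mul {φ ψ : ℝ × ℝ → ℂ} (hφ : IsTest L₁ L₂ φ) (hψ : IsTest L₁ L₂ ψ)
    (e p : ℝ × ℝ) : pd e (fun p => φ p * ψ p) p = φ p * pd e ψ p + pd e φ p * ψ p := by
  have h1 := (hφ.smooth.differentiable (by simp) p).hasFDerivAt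
  have h2 := (hψ.smooth.differentiable (by simp) p).hasFDerivAt
  have h3 := (h1.mul h2).fderiv
  change fderiv ℝ (φ * ψ) p e = _
  rw [h3]
  simp [pd, mul_comm]

theorem hasWeakDeriv_of_mem (h₁ : 0 < L₁) (h₂ : 0 < L₂) {v : Jet L₁ L₂}
    (hv : v ∈ HOneZero L₁ L₂) : HasWeakDeriv (1, 0) (v 0) (v 1) ∧ HasWeakDeriv (0, 1) (v 0) (v 2) := by
  have key : ∀ (e : ℝ × ℝ) (j : Fin 3), (∀ v ∈ testJets L₁ L₂, ∃ φ, IsTest L₁ L₂ φ ∧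
      v 0 =ᵐ[cyl L₁ L₂] φ ∧ v j =ᵐ[cyl L₁ L₂] pd e φ) →
      ∀ v ∈ HOneZero L₁ L₂, HasWeakDeriv e (v 0) (v j) := by
    intro e j hj v hv ψ hψ
    have hcl : IsClosed {v : Jet L₁ L₂ | ∫ p, v 0 p * pd e ψ p ∂(cyl L₁ L₂) =
        -∫ p, v j p * ψ p ∂(cyl L₁ L₂)} := by
      refine isClosed_eq ?_ ?_
      · exact (continuous_integral_mul (hψ.continuous_pd e)).comp (by fun_prop)
      · exact ((continuous_integral_mul hψ.smooth.continuous).comp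
          (by fun_prop : Continuous fun v : Jet L₁ L₂ => v j)).neg
    refine closure_minimal ?_ hcl hv
    intro w hw
    refine Submodule.span_induction (p := fun w _ => ∫ p, w 0 p * pd e ψ p ∂(cyl L₁ L₂) =
        -∫ p, w j p * ψ p ∂(cyl L₁ L₂)) ?_ ?_ ?_ ?_ hw
    · intro w hw
      obtain ⟨φ, hφ, e0, ej⟩ := hj w hw
      have i1 : ∫ p, w 0 p * pd e ψ p ∂(cyl L₁ L₂) = ∫ p, φ p * pd e ψ p ∂(cyl L₁ L₂) :=
        integral_congr_ae (by filter_upwards [e0] with p hp; rw [hp])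
      have i2 : ∫ p, w j p * ψ p ∂(cyl L₁ L₂) = ∫ p, pd e φ p * ψ p ∂(cyl L₁ L₂) :=
        integral_congr_ae (by filter_upwards [ej] with p hp; rw [hp])
      have h0 := (hφ.mul hψ).integral_pd h₁ h₂ e.1 e.2
      simp only [Prod.mk.eta, hφ.pd_mul hψ] at h0
      rw [integral_add] at h0
      · rw [i1, i2]
        exact eq_neg_of_add_eq_zero_left h0
      · exact (memLp_of_continuous (hφ.smooth.continuous.mul (hψ.continuous_pd e))).integrable
          (by norm_num)
      · exact (memLp_of_continuous ((hφ.continuous_pd e).mul hψ.smooth.continuous)).integrable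
          (by norm_num)
    · have z1 := integral_smul_mul 0 (0 : LTwo L₁ L₂) (pd e ψ)
      have z2 := integral_smul_mul 0 (0 : LTwo L₁ L₂) ψ
      rw [zero_smul, zero_mul] at z1 z2
      have e0 : ∀ j, ((0 : Jet L₁ L₂) j : LTwo L₁ L₂) = 0 := fun _ => rfl
      rw [e0, e0, z1, z2, neg_zero]
    · intro x y _ _ hx hy
      have e0 : ∀ j, ((x + y) j : LTwo L₁ L₂) = x j + y j := fun _ => rfl
      rw [e0, e0, integral_add_mul _ _ (hψ.continuous_pd e),
        integral_add_mul _ _ hψ.smooth.continuous, hx, hy, neg_add]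
    · intro c x _ hx
      have e0 : ∀ j, ((c • x) j : LTwo L₁ L₂) = c • x j := fun _ => rfl
      rw [e0, e0, integral_smul_mul, integral_smul_mul, hx, mul_neg]
  exact ⟨key _ _ (fun v ⟨φ, h, e0, e1, _⟩ => ⟨φ, h, e0, e1⟩) v hv,
    key _ _ (fun v ⟨φ, h, e0, _, e2⟩ => ⟨φ, h, e0, e2⟩) v hv⟩

/-- A square integrable function that is orthogonal to all test functions vanishes. -/
theorem eq_zero_of_test (h₂ : 0 < L₂) (f : LTwo L₁ L₂)
    (h : ∀ φ, IsTest L₁ L₂ φ → ∫ p, f p * φ p ∂(cyl L₁ L₂) = 0) : f = 0 := by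
  have hU : IsOpen (cell L₁ L₂) := isOpen_Ioo.prod isOpen_Ioo
  have hfi : IntegrableOn f (cell L₁ L₂) volume := (Lp.memLp f).integrable (by norm_num)
  rw [Lp.eq_zero_iff_ae_eq_zero]
  refine (ae_restrict_iff' hU.measurableSet).2 ?_
  refine hU.ae_eq_zero_of_integral_contDiff_smul_eq_zero hfi.locallyIntegrableOn ?_
  intro g hg hgc hgs
  have : Fact (0 < L₂) := ⟨h₂⟩
  rcases (tsupport g).eq_empty_or_nonempty with he | hne
  · have : g = 0 := tsupport_eq_empty_iff.1 he
    simp [this]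
  obtain ⟨pa, hpa, hpa'⟩ := hgc.isCompact.exists_isMinOn hne continuous_fst.continuousOn
  obtain ⟨pb, hpb, hpb'⟩ := hgc.isCompact.exists_isMaxOn hne continuous_fst.continuousOn
  obtain ⟨pd, hpd, hpd'⟩ := hgc.isCompact.exists_isMaxOn hne continuous_snd.continuousOn
  have hz : ∀ p, g p ≠ 0 → p ∈ tsupport g := fun p hp => subset_tsupport g hp
  have hin : ∀ p, g p ≠ 0 → p ∈ cell L₁ L₂ := fun p hp => hgs (hz p hp)
  let φ : ℝ × ℝ → ℂ := fun p => (g (p.1, toIcoMod h₂ 0 p.2) : ℂ)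
  have hper : ∀ x y, φ (x, y + L₂) = φ (x, y) := by
    intro x y
    simp [φ, toIcoMod_add_right]
  have heq : ∀ p : ℝ × ℝ, p.2 ∈ Ioo (pd.2 - L₂) L₂ → φ p = (g p : ℂ) := by
    rintro ⟨x, y⟩ ⟨hy1, hy2⟩
    simp only at hy1 hy2
    by_cases hy : 0 ≤ y
    · have : toIcoMod h₂ 0 y = y := (toIcoMod_eq_self h₂).2 ⟨hy, by simpa using hy2⟩
      simp [φ, this]
    · have hd : 0 < pd.2 := (hgs hpd).2.1
      have : toIcoMod h₂ 0 y = y + L₂ := by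
        rw [← toIcoMod_add_right]
        exact (toIcoMod_eq_self h₂).2 ⟨by linarith, by simpa using (by linarith : y < 0)⟩
      have g1 : g (x, y + L₂) = 0 := by
        by_contra hne'
        have := hpd' (hz _ hne')
        simp only [mem_ofPred_eq] at this
        linarith
      have g2 : g (x, y) = 0 := by
        by_contra hne'
        exact hy (hin _ hne').2.1.le
      simp [φ, this, g1, g2]
  have hsm0 : ∀ p : ℝ × ℝ, p.2 ∈ Ioo (pd.2 - L₂) L₂ → ContDiffAt ℝ ∞ φ p := by
    intro p hp
    have h1 : ContDiffAt ℝ ∞ (fun p => (g p : ℂ)) p :=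
      (Complex.ofRealCLM.contDiff.comp hg).contDiffAt
    refine h1.congr_of_eventuallyEq ?_
    have : ∀ᶠ q : ℝ × ℝ in 𝓝 p, q.2 ∈ Ioo (pd.2 - L₂) L₂ :=
      continuous_snd.continuousAt.eventually (isOpen_Ioo.mem_nhds hp)
    filter_upwards [this] with q hq using heq q hq
  have hper' : ∀ (n : ℤ) p, φ (p + (0, n • L₂)) = φ p := by
    intro n p
    simp only [φ, Prod.fst_add, Prod.snd_add, add_zero]
    rw [toIcoMod_add_zsmul]
  have hsm : ContDiff ℝ ∞ φ := by
    rw [contDiff_iff_contDiffAt]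
    intro p
    have hd : pd.2 < L₂ := (hgs hpd).2.2
    set n := toIcoDiv h₂ 0 p.2 with hn
    have hm := toIcoMod_mem_Ico h₂ 0 p.2
    have hq : ContDiffAt ℝ ∞ φ (p + (0, (-n) • L₂)) := by
      refine hsm0 _ ?_
      have : (p + (0, (-n) • L₂)).2 = toIcoMod h₂ 0 p.2 := by
        rw [toIcoMod, ← hn]
        simp [sub_eq_add_neg]
      rw [this]
      exact ⟨by linarith [hm.1], by simpa using hm.2⟩
    have hc := hq.comp p (f := fun q => q + (0, (-n) • L₂)) (by fun_prop)
    refine hc.congr_of_eventuallyEq (Eventually.of_forall fun q => ?_)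
    exact (hper' (-n) q).symm
  have hT : IsTest L₁ L₂ φ := by
    refine ⟨hsm, hper, pa.1, pb.1, (hgs hpa).1.1, (hgs hpb).1.2, fun x y hxy => ?_⟩
    have hne' : g (x, toIcoMod h₂ 0 y) ≠ 0 := by simpa [φ] using hxy
    exact ⟨hpa' (hz _ hne'), hpb' (hz _ hne')⟩
  have h0 := h φ hT
  have hsub : ∫ p, g p • f p = ∫ p in cell L₁ L₂, g p • f p := by
    rw [setIntegral_eq_integral_of_forall_compl_eq_zero]
    intro p hp
    have : g p = 0 := by
      by_contra hne'
      exact hp (hin p hne')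
    simp [this]
  rw [hsub, ← h0]
  change _ = ∫ p in cell L₁ L₂, f p * φ p
  refine setIntegral_congr_fun hU.measurableSet fun p hp => ?_
  have := heq p ⟨by linarith [hp.2.1, (hgs hpd).2.2], hp.2.2⟩
  simp [this, mul_comm]

/-- An element of `H¹₀` is determined by its underlying function. -/
theorem hOneZero_ext (h₁ : 0 < L₁) (h₂ : 0 < L₂) {v : HOneZero L₁ L₂} (h : v.1 0 = 0) :
    v = 0 := by
  obtain ⟨w1, w2⟩ := hasWeakDeriv_of_mem h₁ h₂ v.2
  have aux : ∀ (e : ℝ × ℝ) (g : LTwo L₁ L₂), HasWeakDeriv e (v.1 0) g → g = 0 := by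
    intro e g hg
    refine eq_zero_of_test h₂ g fun φ hφ => ?_
    have h1 := hg φ hφ
    have h2 := integral_smul_mul 0 (0 : LTwo L₁ L₂) (pd e φ)
    rw [zero_smul, zero_mul] at h2
    rw [h, h2] at h1
    exact neg_eq_zero.1 h1.symm
  refine Subtype.ext (PiLp.ext fun j => ?_)
  fin_cases j
  · exact h
  · exact aux _ _ w1
  · exact aux _ _ w2

/-- The homogeneous Dirichlet problem for the Laplacian has only solutions with `∂₂W = 0`. -/
theorem isATwo_zero {a : LTwo L₁ L₂} (h : IsATwo 0 a) : a = 0 := by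
  obtain ⟨W, hW, rfl⟩ := h
  rw [weakLaplacian_iff] at hW
  have hcl : IsClosed {v : Jet L₁ L₂ | inner ℂ (v 1) (W.1 1) + inner ℂ (v 2) (W.1 2) = 0} :=
    isClosed_eq (by fun_prop) continuous_const
  have hmem : W.1 ∈ {v : Jet L₁ L₂ | inner ℂ (v 1) (W.1 1) + inner ℂ (v 2) (W.1 2) = 0} := by
    refine closure_minimal ?_ hcl W.2
    intro w hw
    refine Submodule.span_induction
      (p := fun w _ => inner ℂ (w 1) (W.1 1) + inner ℂ (w 2) (W.1 2) = 0) ?_ ?_ ?_ ?_ hw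
    · rintro w ⟨φ, hφ, _, e1, e2⟩
      have h0 := hW _ hφ.conj
      have z := integral_smul_mul 0 (0 : LTwo L₁ L₂) fun p => (starRingEnd ℂ) (φ p)
      rw [zero_smul, zero_mul] at z
      rw [z, neg_zero] at h0
      rw [← h0, L2.inner_def, L2.inner_def]
      congr 1
      · refine integral_congr_ae ?_
        filter_upwards [e1] with p hp
        rw [hφ.pd_conj, hp]
        simp
      · refine integral_congr_ae ?_
        filter_upwards [e2] with p hp
        rw [hφ.pd_conj, hp]
        simp
    · simp
    · intro x y _ _ hx hy
      have e0 : ∀ j, ((x + y) j : LTwo L₁ L₂) = x j + y j := fun _ => rfl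
      rw [e0, e0, inner_add_left, inner_add_left, add_add_add_comm, hx, hy, add_zero]
    · intro c x _ hx
      have e0 : ∀ j, ((c • x) j : LTwo L₁ L₂) = c • x j := fun _ => rfl
      rw [e0, e0, inner_smul_left, inner_smul_left, ← mul_add, hx, mul_zero]
  simp only [mem_ofPred_eq, inner_self_eq_norm_sq_to_K] at hmem
  have h2 : ‖W.1 1‖ ^ 2 + ‖W.1 2‖ ^ 2 = 0 := Complex.ofReal_eq_zero.1 (by push_cast; exact hmem)
  have h3 : ‖W.1 2‖ ^ 2 = 0 := by nlinarith [sq_nonneg ‖W.1 1‖, sq_nonneg ‖W.1 2‖]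
  exact norm_eq_zero.1 (pow_eq_zero_iff (two_ne_zero) |>.1 h3)

theorem weakLaplacian_zero (h₂ : 0 < L₂) {g : LTwo L₁ L₂}
    (h : HasWeakLaplacian (0 : HOneZero L₁ L₂) g) : g = 0 := by
  rw [weakLaplacian_iff] at h
  refine eq_zero_of_test h₂ g fun φ hφ => ?_
  have h0 := h φ hφ
  have e0 : ∀ j, ((0 : HOneZero L₁ L₂).1 j : LTwo L₁ L₂) = 0 := fun _ => rfl
  have z1 := integral_smul_mul 0 (0 : LTwo L₁ L₂) (pd (1, 0) φ)
  have z2 := integral_smul_mul 0 (0 : LTwo L₁ L₂) (pd (0, 1) φ)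
  rw [zero_smul, zero_mul] at z1 z2
  rw [e0, e0, z1, z2, add_zero] at h0
  exact neg_eq_zero.1 h0.symm

theorem LinRel.eq_zero (h₁ : 0 < L₁) (h₂ : 0 < L₂) {ν ΔT : ℝ} {F : Phase L₁ L₂}
    (h : LinRel ν ΔT 0 F) : F = 0 := by
  obtain ⟨_, _, a, g, k, ha, hg, hk, e1, e2⟩ := h
  have e0 : ∀ j, ((0 : Phase L₁ L₂).1.1 j : LTwo L₁ L₂) = 0 := fun _ => rfl
  have e0' : ∀ j, ((0 : Phase L₁ L₂).2.1 j : LTwo L₁ L₂) = 0 := fun _ => rfl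
  rw [e0, e0', add_zero] at ha
  have ha0 := isATwo_zero ha
  have hg0 := weakLaplacian_zero h₂ hg
  have hk0 := weakLaplacian_zero h₂ hk
  rw [e0, ha0, hg0] at e1
  rw [ha0, hk0] at e2
  refine Prod.ext (hOneZero_ext h₁ h₂ ?_) (hOneZero_ext h₁ h₂ ?_)
  · rw [e1]
    simp
  · rw [e2]
    simp

end facts

/-- The graph of the linearization. -/
def linGraph (L₁ L₂ ν ΔT : ℝ) : Submodule ℂ (Phase L₁ L₂ × Phase L₁ L₂) where
  carrier := {q | LinRel ν ΔT q.1 q.2}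
  add_mem' := LinRel.add
  zero_mem' := LinRel.zero ν ΔT
  smul_mem' := fun c _ h => LinRel.smul c h

/-- The linearization as an unbounded operator in `X × X`; its domain consists of the `u ∈ Z × Z`
whose image lies in `X × X`. -/
noncomputable def linearization (L₁ L₂ ν ΔT : ℝ) : Phase L₁ L₂ →ₗ.[ℂ] Phase L₁ L₂ :=
  (linGraph L₁ L₂ ν ΔT).toLinearPMap

/-- The linearization is single-valued, and its graph is the relation `LinRel`. -/
theorem mem_graph_linearization {L₁ L₂ : ℝ} (h₁ : 0 < L₁) (h₂ : 0 < L₂) (ν ΔT : ℝ)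
    (u F : Phase L₁ L₂) : (u, F) ∈ (linearization L₁ L₂ ν ΔT).graph ↔ LinRel ν ΔT u F := by
  rw [linearization, Submodule.toLinearPMap_graph_eq]
  · rfl
  · rintro ⟨u, F⟩ h rfl
    exact LinRel.eq_zero h₁ h₂ h

/-- The resolvent set of an unbounded operator `T` in a complex normed space: those `z` for which
`z - T` maps the domain of `T` bijectively onto the space, with a bounded inverse. -/
def resolventSet {E : Type*} [NormedAddCommGroup E] [NormedSpace ℂ E] (T : E →ₗ.[ℂ] E) : Set ℂ :=
  {z | ∃ R : E →L[ℂ] E, (∀ f, ∃ h : R f ∈ T.domain, z • R f - T ⟨R f, h⟩ = f) ∧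
    ∀ u : T.domain, R (z • (u : E) - T u) = u}

/-- The spectrum of an unbounded operator. -/
def spec {E : Type*} [NormedAddCommGroup E] [NormedSpace ℂ E] (T : E →ₗ.[ℂ] E) : Set ℂ :=
  (resolventSet T)ᶜ

/-- The stable spectrum of an unbounded operator. -/
def stableSpec {E : Type*} [NormedAddCommGroup E] [NormedSpace ℂ E] (T : E →ₗ.[ℂ] E) : Set ℂ :=
  {z | z ∈ spec T ∧ z.re < 0}

/-- `z` is an eigenvalue of the unbounded operator `T`. -/
def IsEigenvalue {E : Type*} [NormedAddCommGroup E] [NormedSpace ℂ E] (T : E →ₗ.[ℂ] E)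
    (z : ℂ) : Prop :=
  ∃ u : T.domain, (u : E) ≠ 0 ∧ T u = z • (u : E)

/-- The discriminant `D_k`, with aspect ratio `l = L₂ / L₁`. -/
noncomputable def discr (L₁ l ΔT : ℝ) (k : ℕ+ × ℤ) : ℝ :=
  (k.2 : ℝ) ^ 2 * ΔT / (l ^ 2 * L₁) *
    (4 / ((k.1 : ℝ) ^ 2 + 4 * ((k.2 : ℝ) / l) ^ 2) - Real.pi ^ 2 * (ΔT / L₁))

/-- The part of `λ_k^±` without the square root. -/
noncomputable def lamMid (L₁ l ν ΔT : ℝ) (k : ℕ+ × ℤ) : ℂ :=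
  Complex.I * ((Real.pi * ((k.2 : ℝ) * ΔT / (l * L₁)) : ℝ) : ℂ) -
    ((Real.pi ^ 2 * (ν / L₁ ^ 2) * ((k.1 : ℝ) ^ 2 + 4 * (k.2 : ℝ) ^ 2 / l ^ 2) : ℝ) : ℂ)

/-- `λ_k^+`, with the principal square root. -/
noncomputable def lamPlus (L₁ l ν ΔT : ℝ) (k : ℕ+ × ℤ) : ℂ :=
  lamMid L₁ l ν ΔT k + Complex.sqrt (discr L₁ l ΔT k : ℂ)

/-- `λ_k^-`, with the principal square root. -/
noncomputable def lamMinus (L₁ l ν ΔT : ℝ) (k : ℕ+ × ℤ) : ℂ :=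
  lamMid L₁ l ν ΔT k - Complex.sqrt (discr L₁ l ΔT k : ℂ)

end TwoFluid

/-! The functions `e_k = sin(π k₁ x₁ / L₁) exp(2π i k₂ x₂ / L₂)`, `k₁ ≥ 1`, diagonalize every
ingredient at once. With `η = 2π k₂ / L₂` and `μ = (π k₁ / L₁)² + η²` one has `∇² e_k = -μ e_k` and
`A₂ e_k = -(iη / μ) e_k`. On the pairs `(x e_k, y e_k)` the operator is therefore the matrix with
rows `(iηΔT + α - νμ, α)` and `(-α, -α - νμ)`, where `α = -iη / (L₁ μ)`. Half its trace is `iηΔT/2 -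
νμ`, and a quarter of the discriminant of its characteristic polynomial is `D_k`, so its eigenvalues
are `λ_k^±` (`charDet_eq`).

It remains to see that the modes account for everything. They are complete in `L²` by
Stone-Weierstrass (`eq_zero_of_inner_sinMode`). They lie in `H¹₀` because they vanish linearly at
the boundary (`jet_mem`), and there the `H¹` product with `e_k` is `1 + μ` times the `L²` product,
so the normalized modes are also a Hilbert basis of `X` (`jetBasis`).

The equation `Lu = F` is then equivalent to one matrix equation per mode (`linRel_iff_coef`). The
domain condition needs no separate treatment: if these equations hold with `u, F` in `X × X`, the
viscous term gains two derivatives and `u` is in `H³` (`summable_of_elliptic`).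

If `z` differs from all `λ_k^±`, the determinants are bounded below by a multiple of `1 + μ` while
the matrix entries are `O(1 + μ)`. The inverse matrices are thus bounded uniformly in `k` and
assemble to a bounded resolvent (`mem_resolventSet`). If some determinant vanishes, a kernel vector
times `e_k` is an eigenvector (`isEigenvalue_of_charDet`).

For the signs, `Re λ_k^± = -νμ ± √(max(D_k, 0))`. Passing from `k₁ = 1` to a larger `k₁` strictly
increases `μ` and does not increase `max(D_k, 0)`. -/

namespace TwoFluid

variable {L₁ L₂ : ℝ}

/-! ### Smooth periodic functions, their jets, and integration by parts in `H¹₀` -/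

/-- The class in `L²` of a continuous function on the plane. -/
noncomputable def ofCont (L₁ L₂ : ℝ) (ψ : ℝ × ℝ → ℂ) (h : Continuous ψ) : LTwo L₁ L₂ :=
  (memLp_of_continuous h).toLp ψ

theorem coeFn_ofCont {ψ : ℝ × ℝ → ℂ} (h : Continuous ψ) :
    ofCont L₁ L₂ ψ h =ᵐ[cyl L₁ L₂] ψ :=
  (memLp_of_continuous h).coeFn_toLp

theorem inner_ofCont {ψ : ℝ × ℝ → ℂ} (h : Continuous ψ) (f : LTwo L₁ L₂) :
    inner ℂ (ofCont L₁ L₂ ψ h) f = ∫ p, f p * (starRingEnd ℂ) (ψ p) ∂(cyl L₁ L₂) := by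
  rw [L2.inner_def]
  refine integral_congr_ae ?_
  filter_upwards [coeFn_ofCont h] with p hp
  rw [hp]
  rfl

theorem inner_eq_integral_mul_conj {φ : ℝ × ℝ → ℂ} (f g : LTwo L₁ L₂) (h : f =ᵐ[cyl L₁ L₂] φ) :
    inner ℂ f g = ∫ p, g p * (starRingEnd ℂ) (φ p) ∂(cyl L₁ L₂) := by
  rw [L2.inner_def]
  refine integral_congr_ae ?_
  filter_upwards [h] with p hp
  rw [hp]
  rfl

theorem continuous_partial {ψ : ℝ × ℝ → ℂ} (h : ContDiff ℝ ∞ ψ) (e : ℝ × ℝ) : Continuous (pd e ψ) :=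
  (h.continuous_fderiv (by simp)).clm_apply continuous_const

theorem partial_mul {φ ψ : ℝ × ℝ → ℂ} (hφ : ContDiff ℝ ∞ φ) (hψ : ContDiff ℝ ∞ ψ) (e p : ℝ × ℝ) :
    pd e (fun p => φ p * ψ p) p = φ p * pd e ψ p + pd e φ p * ψ p := by
  have h1 := (hφ.differentiable (by simp) p).hasFDerivAt
  have h2 := (hψ.differentiable (by simp) p).hasFDerivAt
  have h3 := (h1.mul h2).fderiv
  change fderiv ℝ (φ * ψ) p e = _
  rw [h3]
  simp [pd, mul_comm]

theorem pd_conj {φ : ℝ × ℝ → ℂ} (hφ : ContDiff ℝ ∞ φ) (e p : ℝ × ℝ) :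
    pd e (fun p => (starRingEnd ℂ) (φ p)) p = (starRingEnd ℂ) (pd e φ p) := by
  have hd : HasFDerivAt φ (fderiv ℝ φ p) p := (hφ.differentiable (by simp) p).hasFDerivAt
  have := (Complex.conjCLE.toContinuousLinearMap.hasFDerivAt (x := φ p)).comp p hd
  have h2 : fderiv ℝ (fun p => (starRingEnd ℂ) (φ p)) p = _ := this.fderiv
  simp [pd, h2]

theorem contDiff_conj {φ : ℝ × ℝ → ℂ} (hφ : ContDiff ℝ ∞ φ) :
    ContDiff ℝ ∞ (fun p => (starRingEnd ℂ) (φ p)) :=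
  (Complex.conjCLE.contDiff).comp hφ

/-- Integration by parts against a smooth periodic function without boundary conditions. -/
theorem IsTest.integral_mul_pd (h₁ : 0 < L₁) (h₂ : 0 < L₂) {φ ψ : ℝ × ℝ → ℂ}
    (hφ : IsTest L₁ L₂ φ) (hψ : ContDiff ℝ ∞ ψ) (hp : ∀ x y, ψ (x, y + L₂) = ψ (x, y))
    (e : ℝ × ℝ) :
    ∫ p, ψ p * pd e φ p ∂(cyl L₁ L₂) = -∫ p, pd e ψ p * φ p ∂(cyl L₁ L₂) := by
  have hT : IsTest L₁ L₂ (fun p => ψ p * φ p) := by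
    refine ⟨hψ.mul hφ.smooth, fun x y => ?_, ?_⟩
    · rw [hφ.periodic, hp]
    · obtain ⟨a, b, ha, hb, h⟩ := hφ.support
      exact ⟨a, b, ha, hb, fun x y hxy => h x y (right_ne_zero_of_mul hxy)⟩
  have h0 := hT.integral_pd h₁ h₂ e.1 e.2
  simp only [Prod.mk.eta, partial_mul hψ hφ.smooth] at h0
  rw [integral_add] at h0
  · exact eq_neg_of_add_eq_zero_left h0
  · exact (memLp_of_continuous (hψ.continuous.mul (hφ.continuous_pd e))).integrable
      (by norm_num)
  · exact (memLp_of_continuous ((continuous_partial hψ e).mul hφ.smooth.continuous)).integrable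
      (by norm_num)

/-- The classical derivative of a smooth periodic function is its weak derivative. -/
theorem hasWeakDeriv_ofCont (h₁ : 0 < L₁) (h₂ : 0 < L₂) {ψ : ℝ × ℝ → ℂ}
    (hψ : ContDiff ℝ ∞ ψ) (hp : ∀ x y, ψ (x, y + L₂) = ψ (x, y)) (e : ℝ × ℝ) :
    HasWeakDeriv e (ofCont L₁ L₂ ψ hψ.continuous)
      (ofCont L₁ L₂ (pd e ψ) (continuous_partial hψ e)) := by
  intro φ hφ
  have i1 : ∫ p, ofCont L₁ L₂ ψ hψ.continuous p * pd e φ p ∂(cyl L₁ L₂) =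
      ∫ p, ψ p * pd e φ p ∂(cyl L₁ L₂) :=
    integral_congr_ae (by filter_upwards [coeFn_ofCont hψ.continuous] with p hp; rw [hp])
  have i2 : ∫ p, ofCont L₁ L₂ (pd e ψ) (continuous_partial hψ e) p * φ p ∂(cyl L₁ L₂) =
      ∫ p, pd e ψ p * φ p ∂(cyl L₁ L₂) :=
    integral_congr_ae (by
      filter_upwards [coeFn_ofCont (continuous_partial hψ e)] with p hp; rw [hp])
  rw [i1, i2, hφ.integral_mul_pd h₁ h₂ hψ hp]

/-- The triple `(ψ, ∂₁ψ, ∂₂ψ)` of a smooth function. -/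
noncomputable def jet (L₁ L₂ : ℝ) (ψ : ℝ × ℝ → ℂ) (h : ContDiff ℝ ∞ ψ) : Jet L₁ L₂ :=
  WithLp.toLp 2 ![ofCont L₁ L₂ ψ h.continuous, ofCont L₁ L₂ (pd (1, 0) ψ) (continuous_partial h _),
    ofCont L₁ L₂ (pd (0, 1) ψ) (continuous_partial h _)]

theorem IsTest.jet_mem_testJets {φ : ℝ × ℝ → ℂ} (h : IsTest L₁ L₂ φ) :
    jet L₁ L₂ φ h.smooth ∈ testJets L₁ L₂ :=
  ⟨φ, h, coeFn_ofCont h.smooth.continuous, coeFn_ofCont (continuous_partial h.smooth _),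
    coeFn_ofCont (continuous_partial h.smooth _)⟩

theorem testJets_subset : testJets L₁ L₂ ⊆ HOneZero L₁ L₂ :=
  fun _ hv => subset_closure (Submodule.subset_span hv)

theorem IsTest.jet_mem {φ : ℝ × ℝ → ℂ} (h : IsTest L₁ L₂ φ) :
    jet L₁ L₂ φ h.smooth ∈ HOneZero L₁ L₂ :=
  testJets_subset h.jet_mem_testJets

/-- A continuous functional that vanishes on the test functions vanishes on `H¹₀`. -/
theorem apply_eq_zero_of_testJets (T : Jet L₁ L₂ →L[ℂ] ℂ) (h : ∀ v ∈ testJets L₁ L₂, T v = 0)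
    {v : Jet L₁ L₂} (hv : v ∈ HOneZero L₁ L₂) : T v = 0 := by
  have hle : HOneZero L₁ L₂ ≤ LinearMap.ker (T : Jet L₁ L₂ →ₗ[ℂ] ℂ) :=
    Submodule.topologicalClosure_minimal _ (Submodule.span_le.2 h) T.isClosed_ker
  exact hle hv

/-- Elements of `H¹₀` vanish on the boundary circles, so no boundary term appears although `ψ` need
not vanish there; this is what allows cosines as test functions. Both sides are continuous in `v`,
so it is enough to check test functions. -/
theorem inner_mem (h₁ : 0 < L₁) (h₂ : 0 < L₂) {ψ : ℝ × ℝ → ℂ} (hψ : ContDiff ℝ ∞ ψ)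
    (hp : ∀ x y, ψ (x, y + L₂) = ψ (x, y)) {v : Jet L₁ L₂} (hv : v ∈ HOneZero L₁ L₂) :
    inner ℂ (ofCont L₁ L₂ ψ hψ.continuous) (v 1) =
      -inner ℂ (ofCont L₁ L₂ (pd (1, 0) ψ) (continuous_partial hψ _)) (v 0) ∧
    inner ℂ (ofCont L₁ L₂ ψ hψ.continuous) (v 2) =
      -inner ℂ (ofCont L₁ L₂ (pd (0, 1) ψ) (continuous_partial hψ _)) (v 0) := by
  have key : ∀ (e : ℝ × ℝ) (j : Fin 3), (∀ v ∈ testJets L₁ L₂, ∃ φ, IsTest L₁ L₂ φ ∧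
      v 0 =ᵐ[cyl L₁ L₂] φ ∧ v j =ᵐ[cyl L₁ L₂] pd e φ) →
      inner ℂ (ofCont L₁ L₂ ψ hψ.continuous) (v j) =
      -inner ℂ (ofCont L₁ L₂ (pd e ψ) (continuous_partial hψ _)) (v 0) := by
    intro e j hj
    rw [eq_neg_iff_add_eq_zero]
    refine apply_eq_zero_of_testJets
      ((innerSL ℂ (ofCont L₁ L₂ ψ hψ.continuous)).comp (PiLp.proj 2 _ j) +
        (innerSL ℂ (ofCont L₁ L₂ (pd e ψ) (continuous_partial hψ _))).comp (PiLp.proj 2 _ 0)) ?_ hv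
    intro w hw
    obtain ⟨φ, hφ, e0, ej⟩ := hj w hw
    change inner ℂ _ (w j) + inner ℂ _ (w 0) = 0
    rw [inner_ofCont, inner_ofCont]
    have i1 : ∫ p, w j p * (starRingEnd ℂ) (ψ p) ∂(cyl L₁ L₂) =
        ∫ p, (starRingEnd ℂ) (ψ p) * pd e φ p ∂(cyl L₁ L₂) :=
      integral_congr_ae (by filter_upwards [ej] with p hp; rw [hp, mul_comm])
    have i2 : ∫ p, w 0 p * (starRingEnd ℂ) (pd e ψ p) ∂(cyl L₁ L₂) =
        ∫ p, pd e (fun p => (starRingEnd ℂ) (ψ p)) p * φ p ∂(cyl L₁ L₂) :=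
      integral_congr_ae (by filter_upwards [e0] with p hp; rw [hp, mul_comm, pd_conj hψ])
    rw [i1, i2, hφ.integral_mul_pd h₁ h₂ (contDiff_conj hψ) (fun x y => by rw [hp])]
    exact neg_add_cancel _
  exact ⟨key _ _ fun v ⟨φ, h, e0, e1, _⟩ => ⟨φ, h, e0, e1⟩,
    key _ _ fun v ⟨φ, h, e0, _, e2⟩ => ⟨φ, h, e0, e2⟩⟩

instance : CompleteSpace (HOneZero L₁ L₂) :=
  (Submodule.isClosed_topologicalClosure _).completeSpace_coe

/-! ### Cutoffs, and a criterion for membership in `H¹₀` -/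

theorem deriv_smoothTransition_of_one_lt {s : ℝ} (hs : 1 < s) :
    deriv Real.smoothTransition s = 0 := by
  have : Real.smoothTransition =ᶠ[𝓝 s] fun _ => 1 := by
    filter_upwards [lt_mem_nhds hs] with t ht using
      Real.smoothTransition.one_of_one_le (le_of_lt ht)
  rw [this.deriv_eq]
  simp

/-- The derivative of the smooth transition function is bounded. -/
theorem exists_bound_deriv_smoothTransition :
    ∃ C, 0 ≤ C ∧ ∀ s, |deriv Real.smoothTransition s| ≤ C := by
  have hc : Continuous (deriv Real.smoothTransition) :=
    (Real.smoothTransition.contDiff (n := 1)).continuous_deriv (by simp)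
  obtain ⟨C, hC⟩ := (isCompact_Icc (a := (0 : ℝ)) (b := 1)).exists_bound_of_continuousOn
    hc.continuousOn
  refine ⟨C, (norm_nonneg _).trans (hC 0 (by simp)), fun s => ?_⟩
  have h0 : ∀ s, s < 0 ∨ 1 < s → deriv Real.smoothTransition s = 0 := by
    rintro s (hs | hs)
    · have : Real.smoothTransition =ᶠ[𝓝 s] fun _ => 0 := by
        filter_upwards [gt_mem_nhds hs] with t ht using
          Real.smoothTransition.zero_of_nonpos (le_of_lt ht)
      rw [this.deriv_eq]
      simp
    · exact deriv_smoothTransition_of_one_lt hs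
  by_cases hs : s ∈ Icc (0 : ℝ) 1
  · exact hC s hs
  · rw [h0 s (by by_contra h; push Not at h; exact hs h)]
    simpa using (norm_nonneg _).trans (hC 0 (by simp))

/-- A cutoff that vanishes near the boundary circles and tends to `1` inside as `n` grows. -/
noncomputable def cutoff (L₁ : ℝ) (n : ℕ) (x : ℝ) : ℝ :=
  Real.smoothTransition (n * (x * (L₁ - x)) - 1)

theorem contDiff_cutoff (L₁ : ℝ) (n : ℕ) : ContDiff ℝ ∞ (cutoff L₁ n) :=
  Real.smoothTransition.contDiff.comp (by fun_prop)

theorem abs_cutoff_le (L₁ : ℝ) (n : ℕ) (x : ℝ) : |cutoff L₁ n x| ≤ 1 := by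
  rw [cutoff, abs_of_nonneg (Real.smoothTransition.nonneg _)]
  exact Real.smoothTransition.le_one _

theorem deriv_cutoff (L₁ : ℝ) (n : ℕ) (x : ℝ) :
    deriv (cutoff L₁ n) x =
      deriv Real.smoothTransition (n * (x * (L₁ - x)) - 1) * (n * (L₁ - 2 * x)) := by
  have h1 : HasDerivAt Real.smoothTransition
      (deriv Real.smoothTransition (n * (x * (L₁ - x)) - 1)) (n * (x * (L₁ - x)) - 1) :=
    ((Real.smoothTransition.contDiff (n := 1)).differentiable (by simp) _).hasDerivAt
  have h2 : HasDerivAt (fun x : ℝ => n * (x * (L₁ - x)) - 1) (n * (L₁ - 2 * x)) x := by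
    have := ((((hasDerivAt_id x).mul ((hasDerivAt_id x).const_sub L₁)).const_mul
      (n : ℝ)).sub_const 1)
    exact this.congr_deriv (by simp only [id]; ring)
  exact (h1.comp x h2).deriv

theorem eventually_cutoff {x : ℝ} (hx : x ∈ Ioo 0 L₁) :
    ∀ᶠ n : ℕ in atTop, cutoff L₁ n x = 1 ∧ deriv (cutoff L₁ n) x = 0 := by
  have hpos : 0 < x * (L₁ - x) := mul_pos hx.1 (by linarith [hx.2])
  have ht : Tendsto (fun n : ℕ => (n : ℝ) * (x * (L₁ - x))) atTop atTop :=
    tendsto_natCast_atTop_atTop.atTop_mul_const hpos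
  filter_upwards [ht.eventually_gt_atTop 2] with n hn
  refine ⟨Real.smoothTransition.one_of_one_le (by linarith), ?_⟩
  rw [deriv_cutoff, deriv_smoothTransition_of_one_lt (by linarith), zero_mul]

theorem isTest_cutoff_mul (h₁ : 0 < L₁) {f : ℝ × ℝ → ℂ} (hf : ContDiff ℝ ∞ f)
    (hp : ∀ x y, f (x, y + L₂) = f (x, y)) (n : ℕ) :
    IsTest L₁ L₂ (fun p => (cutoff L₁ n p.1 : ℂ) * f p) := by
  refine ⟨?_, fun x y => by rw [hp], ?_⟩
  · exact (Complex.ofRealCLM.contDiff.comp ((contDiff_cutoff L₁ n).comp contDiff_fst)).mul hf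
  · have hn : (0 : ℝ) < (n + 1) * L₁ := by positivity
    -- A nonzero value forces `n x (L₁ - x) > 1`, so `x` and `L₁ - x` both exceed `1 / (n L₁)`.
    -- Taking `n + 1` keeps the endpoints meaningful for `n = 0`.
    refine ⟨1 / ((n + 1) * L₁), L₁ - 1 / ((n + 1) * L₁), by positivity, ?_, fun x y hxy => ?_⟩
    · have : 0 < 1 / ((n + 1) * L₁) := by positivity
      linarith
    · have h0 : cutoff L₁ n x ≠ 0 := by
        have := left_ne_zero_of_mul hxy
        exact_mod_cast this
      have h1 : 0 < n * (x * (L₁ - x)) - 1 := by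
        by_contra h
        exact h0 (Real.smoothTransition.zero_of_nonpos (not_lt.1 h))
      have hq : 0 < x * (L₁ - x) := by
        by_contra h
        have : (n : ℝ) * (x * (L₁ - x)) ≤ 0 :=
          mul_nonpos_of_nonneg_of_nonpos n.cast_nonneg (not_lt.1 h)
        linarith
      have hx0 : 0 < x := by
        by_contra h
        have : x * (L₁ - x) ≤ 0 := mul_nonpos_of_nonpos_of_nonneg (not_lt.1 h) (by linarith)
        linarith
      have hx1 : 0 < L₁ - x := pos_of_mul_pos_right hq hx0.le
      have h2 : 1 < (n + 1) * (x * (L₁ - x)) := by nlinarith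
      have ha : 1 / ((n + 1) * L₁) ≤ x := by
        rw [div_le_iff₀ hn]
        have : (n + 1 : ℝ) * (x * (L₁ - x)) ≤ (n + 1) * (x * L₁) := by gcongr; linarith
        linarith
      have hb : 1 / ((n + 1) * L₁) ≤ L₁ - x := by
        rw [div_le_iff₀ hn]
        have : (n + 1 : ℝ) * (x * (L₁ - x)) ≤ (n + 1) * (L₁ * (L₁ - x)) := by gcongr; linarith
        linarith
      exact ⟨ha, by linarith⟩

theorem pd_cutoff_mul {f : ℝ × ℝ → ℂ} (hf : ContDiff ℝ ∞ f) (n : ℕ) (e p : ℝ × ℝ) :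
    pd e (fun p => (cutoff L₁ n p.1 : ℂ) * f p) p =
      cutoff L₁ n p.1 * pd e f p + ((deriv (cutoff L₁ n) p.1 * e.1 : ℝ) : ℂ) * f p := by
  have hc : ContDiff ℝ ∞ (fun p : ℝ × ℝ => (cutoff L₁ n p.1 : ℂ)) :=
    Complex.ofRealCLM.contDiff.comp ((contDiff_cutoff L₁ n).comp contDiff_fst)
  rw [partial_mul hc hf]
  congr 2
  have h1 : HasDerivAt (cutoff L₁ n) (deriv (cutoff L₁ n) p.1) p.1 :=
    ((contDiff_cutoff L₁ n).differentiable (by simp) _).hasDerivAt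
  have h2 : HasFDerivAt (fun p : ℝ × ℝ => cutoff L₁ n p.1) _ p :=
    h1.hasFDerivAt.comp p hasFDerivAt_fst
  have h3 := (Complex.ofRealCLM.hasFDerivAt.comp p h2).fderiv
  change fderiv ℝ (Complex.ofRealCLM ∘ fun p : ℝ × ℝ => cutoff L₁ n p.1) p e = _
  rw [h3]
  simp [mul_comm]

/-- Pointwise and boundedly convergent continuous functions converge weakly in `L²`. -/
theorem tendsto_inner_ofCont (w : LTwo L₁ L₂) {ψ : ℕ → ℝ × ℝ → ℂ} (hψ : ∀ n, Continuous (ψ n))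
    {f : ℝ × ℝ → ℂ} (hf : Continuous f) (C : ℝ)
    (hb : ∀ n, ∀ p ∈ cell L₁ L₂, ‖ψ n p‖ ≤ C)
    (ht : ∀ p ∈ cell L₁ L₂, Tendsto (fun n => ψ n p) atTop (𝓝 (f p))) :
    Tendsto (fun n => inner ℂ (ofCont L₁ L₂ (ψ n) (hψ n)) w) atTop
      (𝓝 (inner ℂ (ofCont L₁ L₂ f hf) w)) := by
  simp_rw [inner_ofCont]
  have hm : MeasurableSet (cell L₁ L₂) := measurableSet_Ioo.prod measurableSet_Ioo
  have hw : Integrable w (cyl L₁ L₂) := (Lp.memLp w).integrable (by norm_num)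
  refine tendsto_integral_of_dominated_convergence (fun p => ‖w p‖ * C) (fun n => ?_)
    (hw.norm.mul_const C) (fun n => ?_) ?_
  · exact (Lp.aestronglyMeasurable w).mul
      (Complex.continuous_conj.comp (hψ n)).aestronglyMeasurable
  · refine (ae_restrict_iff' hm).2 (ae_of_all _ fun p hp => ?_)
    rw [norm_mul, RCLike.norm_conj]
    exact mul_le_mul_of_nonneg_left (hb n p hp) (norm_nonneg _)
  · refine (ae_restrict_iff' hm).2 (ae_of_all _ fun p hp => ?_)
    exact ((Complex.continuous_conj.tendsto _).comp (ht p hp)).const_mul _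

theorem inner_jet {ψ : ℝ × ℝ → ℂ} (hψ : ContDiff ℝ ∞ ψ) (w : Jet L₁ L₂) :
    inner ℂ (jet L₁ L₂ ψ hψ) w = inner ℂ (ofCont L₁ L₂ ψ hψ.continuous) (w 0) +
      inner ℂ (ofCont L₁ L₂ (pd (1, 0) ψ) (continuous_partial hψ _)) (w 1) +
      inner ℂ (ofCont L₁ L₂ (pd (0, 1) ψ) (continuous_partial hψ _)) (w 2) := by
  rw [PiLp.inner_apply, Fin.sum_univ_three]
  rfl

/-- A smooth periodic function that vanishes linearly at the boundary circles lies in `H¹₀`. -/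
theorem jet_mem (h₁ : 0 < L₁) {f : ℝ × ℝ → ℂ} (hf : ContDiff ℝ ∞ f)
    (hp : ∀ x y, f (x, y + L₂) = f (x, y)) (K : ℝ)
    (hK : ∀ p ∈ cell L₁ L₂, ‖f p‖ ≤ K * (p.1 * (L₁ - p.1))) :
    jet L₁ L₂ f hf ∈ HOneZero L₁ L₂ := by
  have hT := fun n => isTest_cutoff_mul (L₂ := L₂) h₁ hf hp n
  have hcl : IsClosed (HOneZero L₁ L₂ : Set (Jet L₁ L₂)) :=
    Submodule.isClosed_topologicalClosure _
  -- A closed subspace equals its double orthogonal complement, so weak convergence of the truncated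
  -- jets suffices. Their derivatives then need only be bounded and pointwise convergent.
  have horth : (HOneZero L₁ L₂)ᗮᗮ = HOneZero L₁ L₂ := Submodule.orthogonal_orthogonal _
  rw [← horth, Submodule.mem_orthogonal']
  intro w hw
  have h0 : ∀ n, inner ℂ (jet L₁ L₂ _ (hT n).smooth) w = 0 := fun n =>
    (Submodule.mem_orthogonal _ _).1 hw _ (hT n).jet_mem
  obtain ⟨M, hM0, hM⟩ := exists_bound_deriv_smoothTransition
  have hbd : ∀ {g : ℝ × ℝ → ℂ}, Continuous g → ∃ C, ∀ p ∈ cell L₁ L₂, ‖g p‖ ≤ C := by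
    intro g hg
    obtain ⟨C, hC⟩ := ((isCompact_Icc (a := (0 : ℝ)) (b := L₁)).prod
      (isCompact_Icc (a := (0 : ℝ)) (b := L₂))).exists_bound_of_continuousOn hg.continuousOn
    exact ⟨C, fun p hp => hC p ⟨Ioo_subset_Icc_self hp.1, Ioo_subset_Icc_self hp.2⟩⟩
  have hcut : ∀ (n : ℕ) (x : ℝ) (z : ℂ), ‖(cutoff L₁ n x : ℂ) * z‖ ≤ ‖z‖ := by
    intro n x z
    rw [norm_mul, Complex.norm_real]
    exact mul_le_of_le_one_left (norm_nonneg _) (abs_cutoff_le _ _ _)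
  -- The derivative of the cutoff is of size `n`, but it vanishes where `n x (L₁ - x) > 2`;
  -- elsewhere `‖f‖ ≤ 2 |K| / n`. The product stays bounded uniformly in `n`.
  have hder : ∀ (n : ℕ), ∀ p ∈ cell L₁ L₂, |deriv (cutoff L₁ n) p.1| * ‖f p‖ ≤
      M * (2 * L₁ * |K|) := by
    intro n p hp
    have hx : 0 < p.1 * (L₁ - p.1) := mul_pos hp.1.1 (by linarith [hp.1.2])
    by_cases h : 1 < n * (p.1 * (L₁ - p.1)) - 1
    · rw [deriv_cutoff, deriv_smoothTransition_of_one_lt h]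
      simp only [zero_mul, abs_zero]
      positivity
    · have hl : |L₁ - 2 * p.1| ≤ L₁ := abs_le.2 ⟨by linarith [hp.1.2], by linarith [hp.1.1]⟩
      rw [deriv_cutoff, abs_mul, abs_mul, Nat.abs_cast, mul_assoc]
      refine mul_le_mul (hM _) ?_ (by positivity) hM0
      calc (n * |L₁ - 2 * p.1|) * ‖f p‖ ≤ (n * L₁) * (|K| * (p.1 * (L₁ - p.1))) := by
            refine mul_le_mul (by gcongr) ((hK p hp).trans ?_) (norm_nonneg _) (by positivity)
            gcongr
            exact le_abs_self K
        _ = (n * (p.1 * (L₁ - p.1))) * (L₁ * |K|) := by ring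
        _ ≤ 2 * (L₁ * |K|) := by
            gcongr
            linarith
        _ = 2 * L₁ * |K| := by ring
  have hlim : ∀ (e : ℝ × ℝ), |e.1| ≤ 1 → ∀ w : LTwo L₁ L₂,
      Tendsto (fun n => inner ℂ (ofCont L₁ L₂ _ (continuous_partial (hT n).smooth e)) w) atTop
        (𝓝 (inner ℂ (ofCont L₁ L₂ (pd e f) (continuous_partial hf e)) w)) := by
    intro e he w
    obtain ⟨C, hC⟩ := hbd (continuous_partial hf e)
    refine tendsto_inner_ofCont w _ _ (C + M * (2 * L₁ * |K|)) (fun n p hp => ?_) fun p hp => ?_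
    · rw [pd_cutoff_mul hf]
      refine (norm_add_le _ _).trans (add_le_add ((hcut _ _ _).trans (hC p hp)) ?_)
      refine le_trans ?_ (hder n p hp)
      rw [norm_mul, Complex.norm_real, Real.norm_eq_abs, abs_mul]
      gcongr
      exact mul_le_of_le_one_right (abs_nonneg _) he
    · refine tendsto_const_nhds.congr' ?_
      filter_upwards [eventually_cutoff hp.1] with n hn
      rw [pd_cutoff_mul hf, hn.1, hn.2]
      simp
  have hlim0 : Tendsto (fun n => inner ℂ (ofCont L₁ L₂ _ (hT n).smooth.continuous) (w 0)) atTop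
        (𝓝 (inner ℂ (ofCont L₁ L₂ f hf.continuous) (w 0))) := by
    obtain ⟨C, hC⟩ := hbd hf.continuous
    refine tendsto_inner_ofCont _ _ _ C (fun n p hp => (hcut _ _ _).trans (hC p hp))
      fun p hp => ?_
    refine tendsto_const_nhds.congr' ?_
    filter_upwards [eventually_cutoff hp.1] with n hn
    rw [hn.1]
    simp
  have htot := (hlim0.add (hlim (1, 0) (by simp) (w 1))).add (hlim (0, 1) (by simp) (w 2))
  rw [← inner_jet hf w] at htot
  refine tendsto_nhds_unique htot (tendsto_const_nhds.congr fun n => ?_)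
  rw [← h0 n, inner_jet]

/-! ### The sine and cosine modes -/

/-- The function `sin (a x) exp (i b y)`. -/
noncomputable def sinWave (a b : ℝ) (p : ℝ × ℝ) : ℂ :=
  Complex.sin (a * p.1) * Complex.exp (Complex.I * b * p.2)

/-- The function `cos (a x) exp (i b y)`. -/
noncomputable def cosWave (a b : ℝ) (p : ℝ × ℝ) : ℂ :=
  Complex.cos (a * p.1) * Complex.exp (Complex.I * b * p.2)

theorem contDiff_ofReal_comp {f : ℝ × ℝ → ℝ} (hf : ContDiff ℝ ∞ f) :
    ContDiff ℝ ∞ fun p => (f p : ℂ) :=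
  Complex.ofRealCLM.contDiff.comp hf

theorem contDiff_sinWave (a b : ℝ) : ContDiff ℝ ∞ (sinWave a b) := by
  have h1 := contDiff_ofReal_comp contDiff_fst
  have h2 := contDiff_ofReal_comp contDiff_snd
  have h3 : ContDiff ℝ ∞ Complex.sin := (Complex.contDiff_sin (n := ∞)).restrict_scalars ℝ
  have h4 : ContDiff ℝ ∞ Complex.exp := (Complex.contDiff_exp (𝕜 := ℂ) (n := ∞)).restrict_scalars ℝ
  exact (h3.comp (contDiff_const.mul h1)).mul (h4.comp (contDiff_const.mul h2))

theorem contDiff_cosWave (a b : ℝ) : ContDiff ℝ ∞ (cosWave a b) := by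
  have h1 := contDiff_ofReal_comp contDiff_fst
  have h2 := contDiff_ofReal_comp contDiff_snd
  have h3 : ContDiff ℝ ∞ Complex.cos := (Complex.contDiff_cos (n := ∞)).restrict_scalars ℝ
  have h4 : ContDiff ℝ ∞ Complex.exp := (Complex.contDiff_exp (𝕜 := ℂ) (n := ∞)).restrict_scalars ℝ
  exact (h3.comp (contDiff_const.mul h1)).mul (h4.comp (contDiff_const.mul h2))

theorem pd_fst_eq {f : ℝ × ℝ → ℂ} (hf : ContDiff ℝ ∞ f) {p : ℝ × ℝ} {d : ℂ}
    (h : HasDerivAt (fun x : ℝ => f (x, p.2)) d p.1) : pd (1, 0) f p = d := by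
  have h1 := (hf.differentiable (by simp) p).hasFDerivAt
  have h2 : HasDerivAt (fun x : ℝ => (x, p.2)) ((1 : ℝ), (0 : ℝ)) p.1 :=
    (hasDerivAt_id p.1).prodMk (hasDerivAt_const p.1 p.2)
  exact (HasFDerivAt.comp_hasDerivAt p.1 (f := fun x : ℝ => (x, p.2)) h1 h2).unique h

theorem pd_snd_eq {f : ℝ × ℝ → ℂ} (hf : ContDiff ℝ ∞ f) {p : ℝ × ℝ} {d : ℂ}
    (h : HasDerivAt (fun y : ℝ => f (p.1, y)) d p.2) : pd (0, 1) f p = d := by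
  have h1 := (hf.differentiable (by simp) p).hasFDerivAt
  have h2 : HasDerivAt (fun y : ℝ => (p.1, y)) ((0 : ℝ), (1 : ℝ)) p.2 :=
    (hasDerivAt_const p.2 p.1).prodMk (hasDerivAt_id p.2)
  exact (HasFDerivAt.comp_hasDerivAt p.2 (f := fun y : ℝ => (p.1, y)) h1 h2).unique h

theorem hasDerivAt_const_mul_ofReal (c : ℂ) (x : ℝ) :
    HasDerivAt (fun x : ℝ => c * (x : ℂ)) c x := by
  simpa using (Complex.ofRealCLM.hasDerivAt (x := x)).const_mul c

theorem pd_fst_sinWave (a b : ℝ) (p : ℝ × ℝ) :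
    pd (1, 0) (sinWave a b) p = a * cosWave a b p := by
  refine pd_fst_eq (contDiff_sinWave a b) ?_
  have h := ((Complex.hasDerivAt_sin _).comp p.1 (hasDerivAt_const_mul_ofReal a p.1)).mul_const
    (Complex.exp (Complex.I * b * p.2))
  exact h.congr_deriv (by rw [cosWave]; ring)

theorem pd_fst_cosWave (a b : ℝ) (p : ℝ × ℝ) :
    pd (1, 0) (cosWave a b) p = -a * sinWave a b p := by
  refine pd_fst_eq (contDiff_cosWave a b) ?_
  have h := ((Complex.hasDerivAt_cos _).comp p.1 (hasDerivAt_const_mul_ofReal a p.1)).mul_const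
    (Complex.exp (Complex.I * b * p.2))
  exact h.congr_deriv (by rw [sinWave]; ring)

theorem pd_snd_sinWave (a b : ℝ) (p : ℝ × ℝ) :
    pd (0, 1) (sinWave a b) p = Complex.I * b * sinWave a b p := by
  refine pd_snd_eq (contDiff_sinWave a b) ?_
  have h := ((Complex.hasDerivAt_exp _).comp p.2
    (hasDerivAt_const_mul_ofReal (Complex.I * b) p.2)).const_mul (Complex.sin (a * p.1))
  exact h.congr_deriv (by rw [sinWave]; ring)

theorem pd_snd_cosWave (a b : ℝ) (p : ℝ × ℝ) :
    pd (0, 1) (cosWave a b) p = Complex.I * b * cosWave a b p := by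
  refine pd_snd_eq (contDiff_cosWave a b) ?_
  have h := ((Complex.hasDerivAt_exp _).comp p.2
    (hasDerivAt_const_mul_ofReal (Complex.I * b) p.2)).const_mul (Complex.cos (a * p.1))
  exact h.congr_deriv (by rw [cosWave]; ring)

/-- The wave number in the first variable. -/
noncomputable def freqX (L₁ : ℝ) (m : ℤ) : ℝ := Real.pi * m / L₁

/-- The wave number in the second variable. -/
noncomputable def freqY (L₂ : ℝ) (m : ℤ) : ℝ := 2 * Real.pi * m / L₂

theorem exp_freqY_periodic (h₂ : 0 < L₂) (m : ℤ) (y : ℝ) :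
    Complex.exp (Complex.I * freqY L₂ m * (y + L₂ : ℝ)) =
      Complex.exp (Complex.I * freqY L₂ m * y) := by
  rw [Complex.exp_eq_exp_iff_exists_int]
  refine ⟨m, ?_⟩
  have : (L₂ : ℂ) ≠ 0 := by exact_mod_cast h₂.ne'
  simp only [freqY]
  push_cast
  field_simp

theorem sinWave_periodic (h₂ : 0 < L₂) (a : ℝ) (m : ℤ) (x y : ℝ) :
    sinWave a (freqY L₂ m) (x, y + L₂) = sinWave a (freqY L₂ m) (x, y) := by
  simp only [sinWave]
  rw [exp_freqY_periodic h₂]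

theorem cosWave_periodic (h₂ : 0 < L₂) (a : ℝ) (m : ℤ) (x y : ℝ) :
    cosWave a (freqY L₂ m) (x, y + L₂) = cosWave a (freqY L₂ m) (x, y) := by
  simp only [cosWave]
  rw [exp_freqY_periodic h₂]

theorem norm_exp_I_mul (b y : ℝ) : ‖Complex.exp (Complex.I * b * y)‖ = 1 := by
  rw [mul_assoc, mul_comm, ← Complex.ofReal_mul, Complex.norm_exp_ofReal_mul_I]

theorem norm_sinWave (a b : ℝ) (p : ℝ × ℝ) : ‖sinWave a b p‖ = |Real.sin (a * p.1)| := by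
  rw [sinWave, norm_mul, norm_exp_I_mul, mul_one, ← Complex.ofReal_mul, ← Complex.ofReal_sin,
    Complex.norm_real, Real.norm_eq_abs]

/-- Since `|sin t| ≤ |t|`, the sine is controlled by the distance to the nearer endpoint, the right
one being reached by reflection. The distance to the farther endpoint is at least `L₁ / 2`, which
accounts for the factor `2 / L₁`. -/
theorem abs_sin_freqX_le (h₁ : 0 < L₁) (m : ℤ) {x : ℝ} (hx : x ∈ Ioo 0 L₁) :
    |Real.sin (freqX L₁ m * x)| ≤ (|freqX L₁ m| * 2 / L₁) * (x * (L₁ - x)) := by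
  have hab : ∀ z, |Real.sin (freqX L₁ m * z)| ≤ |freqX L₁ m| * |z| := fun z =>
    Real.abs_sin_le_abs.trans_eq (abs_mul _ _)
  have hr : |Real.sin (freqX L₁ m * (L₁ - x))| = |Real.sin (freqX L₁ m * x)| := by
    have : freqX L₁ m * (L₁ - x) = m * Real.pi - freqX L₁ m * x := by
      rw [freqX]
      field_simp
    rw [this, Real.sin_int_mul_pi_sub, abs_neg, abs_mul]
    simp
  have h1 := hab x
  have h2 := hab (L₁ - x)
  rw [hr] at h2
  have hxp := hx.1
  have hxq : 0 < L₁ - x := by linarith [hx.2]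
  rw [abs_of_pos hxp] at h1
  rw [abs_of_pos hxq] at h2
  have ha := abs_nonneg (freqX L₁ m)
  rcases le_total x (L₁ / 2) with h | h
  · refine h1.trans ?_
    rw [mul_div_assoc, mul_assoc]
    refine mul_le_mul_of_nonneg_left ?_ ha
    rw [div_mul_eq_mul_div, le_div_iff₀ h₁]
    nlinarith
  · refine h2.trans ?_
    rw [mul_div_assoc, mul_assoc]
    refine mul_le_mul_of_nonneg_left ?_ ha
    rw [div_mul_eq_mul_div, le_div_iff₀ h₁]
    nlinarith

/-- The sine mode as an element of `L²`. -/
noncomputable def sinMode (L₁ L₂ : ℝ) (k : ℕ+ × ℤ) : LTwo L₁ L₂ :=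
  ofCont L₁ L₂ (sinWave (freqX L₁ k.1) (freqY L₂ k.2)) (contDiff_sinWave _ _).continuous

/-- The cosine mode as an element of `L²`. -/
noncomputable def cosMode (L₁ L₂ : ℝ) (k : ℕ+ × ℤ) : LTwo L₁ L₂ :=
  ofCont L₁ L₂ (cosWave (freqX L₁ k.1) (freqY L₂ k.2)) (contDiff_cosWave _ _).continuous

theorem ofCont_eq_smul {f g : ℝ × ℝ → ℂ} (hf : Continuous f) (hg : Continuous g) (c : ℂ)
    (h : ∀ p, f p = c * g p) : ofCont L₁ L₂ f hf = c • ofCont L₁ L₂ g hg := by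
  refine Lp.ext ?_
  filter_upwards [coeFn_ofCont (L₁ := L₁) (L₂ := L₂) hf,
    Lp.coeFn_smul c (ofCont L₁ L₂ g hg), coeFn_ofCont (L₁ := L₁) (L₂ := L₂) hg] with p h1 h2 h3
  rw [h1, h2, Pi.smul_apply, h3, h, smul_eq_mul]

theorem sinMode_hasWeakDeriv (h₁ : 0 < L₁) (h₂ : 0 < L₂) (k : ℕ+ × ℤ) :
    HasWeakDeriv (1, 0) (sinMode L₁ L₂ k) ((freqX L₁ k.1 : ℂ) • cosMode L₁ L₂ k) ∧
    HasWeakDeriv (0, 1) (sinMode L₁ L₂ k)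
      ((Complex.I * freqY L₂ k.2) • sinMode L₁ L₂ k) := by
  have h := fun e => hasWeakDeriv_ofCont (L₁ := L₁) h₁ h₂
    (contDiff_sinWave (freqX L₁ k.1) (freqY L₂ k.2)) (sinWave_periodic h₂ _ _) e
  have ha := h (1, 0)
  have hb := h (0, 1)
  rw [ofCont_eq_smul _ (contDiff_cosWave _ _).continuous _ (pd_fst_sinWave _ _)] at ha
  rw [ofCont_eq_smul _ (contDiff_sinWave _ _).continuous _ (pd_snd_sinWave _ _)] at hb
  exact ⟨ha, hb⟩

theorem cosMode_hasWeakDeriv (h₁ : 0 < L₁) (h₂ : 0 < L₂) (k : ℕ+ × ℤ) :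
    HasWeakDeriv (1, 0) (cosMode L₁ L₂ k) ((-freqX L₁ k.1 : ℂ) • sinMode L₁ L₂ k) ∧
    HasWeakDeriv (0, 1) (cosMode L₁ L₂ k)
      ((Complex.I * freqY L₂ k.2) • cosMode L₁ L₂ k) := by
  have h := fun e => hasWeakDeriv_ofCont (L₁ := L₁) h₁ h₂
    (contDiff_cosWave (freqX L₁ k.1) (freqY L₂ k.2)) (cosWave_periodic h₂ _ _) e
  have ha := h (1, 0)
  have hb := h (0, 1)
  rw [ofCont_eq_smul _ (contDiff_sinWave _ _).continuous _ (pd_fst_cosWave _ _)] at ha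
  rw [ofCont_eq_smul _ (contDiff_cosWave _ _).continuous _ (pd_snd_cosWave _ _)] at hb
  exact ⟨ha, hb⟩

/-- The jet of a sine mode. -/
noncomputable def modeJet (L₁ L₂ : ℝ) (k : ℕ+ × ℤ) : Jet L₁ L₂ :=
  WithLp.toLp 2 ![sinMode L₁ L₂ k, (freqX L₁ k.1 : ℂ) • cosMode L₁ L₂ k,
    (Complex.I * freqY L₂ k.2) • sinMode L₁ L₂ k]

theorem modeJet_mem (h₁ : 0 < L₁) (h₂ : 0 < L₂) (k : ℕ+ × ℤ) :
    modeJet L₁ L₂ k ∈ HOneZero L₁ L₂ := by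
  have h := jet_mem (L₂ := L₂) h₁ (contDiff_sinWave (freqX L₁ k.1) (freqY L₂ k.2))
    (sinWave_periodic h₂ _ _) _ (fun p hp => by
      rw [norm_sinWave]; exact abs_sin_freqX_le h₁ k.1 hp.1)
  rw [jet, ofCont_eq_smul _ (contDiff_cosWave _ _).continuous _ (pd_fst_sinWave _ _),
    ofCont_eq_smul _ (contDiff_sinWave _ _).continuous _ (pd_snd_sinWave _ _)] at h
  exact h

theorem inner_sinMode_snd (h₁ : 0 < L₁) (h₂ : 0 < L₂) (k : ℕ+ × ℤ) {v : Jet L₁ L₂}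
    (hv : v ∈ HOneZero L₁ L₂) : inner ℂ (sinMode L₁ L₂ k) (v 2) =
      Complex.I * freqY L₂ k.2 * inner ℂ (sinMode L₁ L₂ k) (v 0) := by
  have h := (inner_mem h₁ h₂ (contDiff_sinWave (freqX L₁ k.1) (freqY L₂ k.2))
    (sinWave_periodic h₂ _ _) hv).2
  rw [ofCont_eq_smul (continuous_partial (contDiff_sinWave _ _) _)
    (contDiff_sinWave _ _).continuous _ (pd_snd_sinWave _ _), inner_smul_left] at h
  refine h.trans ?_
  simp [sinMode]

theorem inner_cosMode_fst (h₁ : 0 < L₁) (h₂ : 0 < L₂) (k : ℕ+ × ℤ) {v : Jet L₁ L₂}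
    (hv : v ∈ HOneZero L₁ L₂) : inner ℂ (cosMode L₁ L₂ k) (v 1) =
      freqX L₁ k.1 * inner ℂ (sinMode L₁ L₂ k) (v 0) := by
  have h := (inner_mem h₁ h₂ (contDiff_cosWave (freqX L₁ k.1) (freqY L₂ k.2))
    (cosWave_periodic h₂ _ _) hv).1
  rw [ofCont_eq_smul (continuous_partial (contDiff_cosWave _ _) _)
    (contDiff_sinWave _ _).continuous _ (pd_fst_cosWave _ _), inner_smul_left] at h
  refine h.trans ?_
  simp [sinMode]

theorem freqX_pos (h₁ : 0 < L₁) (m : ℕ+) : 0 < freqX L₁ m := by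
  have : (0 : ℝ) < ((m : ℕ) : ℝ) := by exact_mod_cast m.pos
  rw [freqX]
  push_cast
  positivity

theorem freqX_injective (h₁ : 0 < L₁) : Function.Injective (freqX L₁) := by
  intro m n h
  simp only [freqX] at h
  have := Real.pi_pos
  field_simp at h
  exact_mod_cast h

theorem freqY_injective (h₂ : 0 < L₂) : Function.Injective (freqY L₂) := by
  intro m n h
  simp only [freqY] at h
  have := Real.pi_pos
  field_simp at h
  exact_mod_cast h

/-- Integration by parts against a cosine, applied to the jet of a sine mode. It links the two Gram
matrices without evaluating any integral. -/
theorem freqX_mul_inner_cosMode (h₁ : 0 < L₁) (h₂ : 0 < L₂) (k j : ℕ+ × ℤ) :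
    (freqX L₁ j.1 : ℂ) * inner ℂ (cosMode L₁ L₂ k) (cosMode L₁ L₂ j) =
      freqX L₁ k.1 * inner ℂ (sinMode L₁ L₂ k) (sinMode L₁ L₂ j) := by
  have h : inner ℂ (cosMode L₁ L₂ k) ((freqX L₁ j.1 : ℂ) • cosMode L₁ L₂ j) = _ :=
    inner_cosMode_fst h₁ h₂ k (modeJet_mem h₁ h₂ j)
  rw [inner_smul_right] at h
  exact h

/-- Eigenvectors for distinct eigenvalues are orthogonal: of the skew-symmetric `∂₂` if the second
indices differ, and of `∂₁²` otherwise. In the latter case the cosine product is eliminated between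
the two orderings of `k` and `j`, and positivity of the frequencies separates their squares. -/
theorem inner_sinMode_of_ne (h₁ : 0 < L₁) (h₂ : 0 < L₂) {k j : ℕ+ × ℤ} (hkj : k ≠ j) :
    inner ℂ (sinMode L₁ L₂ k) (sinMode L₁ L₂ j) = 0 := by
  by_cases hy : k.2 = j.2
  · have hx : k.1 ≠ j.1 := fun hx => hkj (Prod.ext hx hy)
    have e1 := freqX_mul_inner_cosMode h₁ h₂ k j
    have e2 := congrArg (starRingEnd ℂ) (freqX_mul_inner_cosMode h₁ h₂ j k)
    simp only [map_mul, inner_conj_symm, Complex.conj_ofReal] at e2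
    have e3 : ((freqX L₁ k.1 : ℂ) ^ 2 - (freqX L₁ j.1 : ℂ) ^ 2) *
        inner ℂ (sinMode L₁ L₂ k) (sinMode L₁ L₂ j) = 0 := by
      linear_combination (-(freqX L₁ k.1 : ℂ)) * e1 + (freqX L₁ j.1 : ℂ) * e2
    refine (mul_eq_zero.1 e3).resolve_left fun h => hx ?_
    have h' : freqX L₁ k.1 ^ 2 = freqX L₁ j.1 ^ 2 := by
      exact_mod_cast sub_eq_zero.1 h
    have := freqX_injective h₁
      ((pow_left_inj₀ (freqX_pos h₁ k.1).le (freqX_pos h₁ j.1).le two_ne_zero).1 h')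
    exact_mod_cast this
  · have h : inner ℂ (sinMode L₁ L₂ k) ((Complex.I * freqY L₂ j.2) • sinMode L₁ L₂ j) = _ :=
      inner_sinMode_snd h₁ h₂ k (modeJet_mem h₁ h₂ j)
    rw [inner_smul_right] at h
    change _ = _ * inner ℂ (sinMode L₁ L₂ k) (sinMode L₁ L₂ j) at h
    have h' := sub_eq_zero.2 h
    rw [← sub_mul, ← mul_sub] at h'
    refine (mul_eq_zero.1 h').resolve_left fun h0 => hy ?_
    have h1 := sub_eq_zero.1 ((mul_eq_zero.1 h0).resolve_left Complex.I_ne_zero)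
    exact (freqY_injective h₂ (by exact_mod_cast h1)).symm

/-- Because the Gram matrices agree, cosine modes divided by the norms of the sine modes are
orthonormal; this gives convergence of cosine series. -/
theorem inner_cosMode (h₁ : 0 < L₁) (h₂ : 0 < L₂) (k j : ℕ+ × ℤ) :
    inner ℂ (cosMode L₁ L₂ k) (cosMode L₁ L₂ j) =
      inner ℂ (sinMode L₁ L₂ k) (sinMode L₁ L₂ j) := by
  have hj : (freqX L₁ j.1 : ℂ) ≠ 0 := by exact_mod_cast (freqX_pos h₁ j.1).ne'
  have e1 := freqX_mul_inner_cosMode h₁ h₂ k j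
  rcases eq_or_ne k j with rfl | hkj
  · exact mul_left_cancel₀ hj e1
  · rw [inner_sinMode_of_ne h₁ h₂ hkj, mul_zero] at e1
    rw [inner_sinMode_of_ne h₁ h₂ hkj]
    exact (mul_eq_zero.1 e1).resolve_left hj

theorem sinMode_ne_zero (h₁ : 0 < L₁) (h₂ : 0 < L₂) (k : ℕ+ × ℤ) : sinMode L₁ L₂ k ≠ 0 := by
  intro h
  have h0 : sinWave (freqX L₁ k.1) (freqY L₂ k.2) =ᵐ[volume.restrict (cell L₁ L₂)]
      fun _ => (0 : ℂ) := by
    have e1 := coeFn_ofCont (L₁ := L₁) (L₂ := L₂)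
      (contDiff_sinWave (freqX L₁ k.1) (freqY L₂ k.2)).continuous
    have e2 := (Lp.eq_zero_iff_ae_eq_zero).1 h
    exact e1.symm.trans e2
  have hon := Measure.eqOn_open_of_ae_eq h0 (isOpen_Ioo.prod isOpen_Ioo)
    (contDiff_sinWave _ _).continuous.continuousOn continuousOn_const
  have hk : (1 : ℝ) ≤ ((k.1 : ℕ) : ℝ) := by exact_mod_cast k.1.pos
  -- At `x = L₁ / (2 k₁)` the argument of the sine is `π / 2`, so the wave has modulus `1` there.
  have hmem : (L₁ / (2 * ((k.1 : ℕ) : ℝ)), L₂ / 2) ∈ Ioo 0 L₁ ×ˢ Ioo 0 L₂ := by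
    refine ⟨⟨by positivity, ?_⟩, by simp; linarith, by simp; linarith⟩
    rw [div_lt_iff₀ (by positivity)]
    nlinarith
  have h1 := congrArg norm (hon hmem)
  rw [norm_sinWave, norm_zero] at h1
  have h2 : freqX L₁ k.1 * (L₁ / (2 * ((k.1 : ℕ) : ℝ))) = Real.pi / 2 := by
    rw [freqX]
    push_cast
    field_simp
  simp only [h2, Real.sin_pi_div_two] at h1
  norm_num at h1

/-! ### Completeness of the sine modes by Stone-Weierstrass -/

/-- The closed cylinder as a compact space. -/
abbrev ClosedCyl (L₁ L₂ : ℝ) := Icc (0 : ℝ) L₁ × AddCircle L₂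

/-- The projection of the plane onto the closed cylinder. -/
noncomputable def toClosedCyl (h₁ : 0 < L₁) (p : ℝ × ℝ) : ClosedCyl L₁ L₂ :=
  (projIcc 0 L₁ h₁.le p.1, (p.2 : AddCircle L₂))

theorem continuous_toClosedCyl (h₁ : 0 < L₁) :
    Continuous (toClosedCyl h₁ : ℝ × ℝ → ClosedCyl L₁ L₂) :=
  (continuous_projIcc.comp continuous_fst).prodMk
    ((AddCircle.continuous_mk' L₂).comp continuous_snd)

/-- The function `cos (π x / L₁)` on the closed cylinder. -/
noncomputable def cosGen (L₁ L₂ : ℝ) : C(ClosedCyl L₁ L₂, ℂ) where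
  toFun q := Complex.cos (freqX L₁ 1 * (q.1 : ℝ))
  continuous_toFun := by fun_prop

/-- The function `exp (2 π i m y / L₂)` on the closed cylinder. -/
noncomputable def expGen (L₁ L₂ : ℝ) (m : ℤ) : C(ClosedCyl L₁ L₂, ℂ) where
  toFun q := fourier m q.2
  continuous_toFun := by fun_prop

theorem cosGen_toClosedCyl (h₁ : 0 < L₁) {p : ℝ × ℝ} (hp : p ∈ cell L₁ L₂) :
    cosGen L₁ L₂ (toClosedCyl h₁ p) = Complex.cos (freqX L₁ 1 * p.1) := by
  simp only [cosGen, toClosedCyl, ContinuousMap.coe_mk]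
  rw [projIcc_of_mem h₁.le (Ioo_subset_Icc_self hp.1)]

theorem expGen_toClosedCyl (h₁ : 0 < L₁) (m : ℤ) (p : ℝ × ℝ) :
    expGen L₁ L₂ m (toClosedCyl h₁ p) = Complex.exp (Complex.I * freqY L₂ m * p.2) := by
  simp only [expGen, toClosedCyl, ContinuousMap.coe_mk, fourier_coe_apply, freqY]
  push_cast
  congr 1
  ring

/-- The span of the sine waves is stable under multiplication by the generators of the trigonometric
algebra. The index `m - 1` may be zero or negative, which is why integer indices are used here. -/
theorem cos_mul_sinWave (m n : ℤ) (p : ℝ × ℝ) :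
    Complex.cos (freqX L₁ 1 * p.1) * sinWave (freqX L₁ m) (freqY L₂ n) p =
      (sinWave (freqX L₁ (m + 1)) (freqY L₂ n) p +
        sinWave (freqX L₁ (m - 1)) (freqY L₂ n) p) / 2 := by
  have e1 : ((freqX L₁ (m + 1) : ℝ) : ℂ) * p.1 =
      freqX L₁ m * p.1 + freqX L₁ 1 * p.1 := by
    simp only [freqX]; push_cast; ring
  have e2 : ((freqX L₁ (m - 1) : ℝ) : ℂ) * p.1 =
      freqX L₁ m * p.1 - freqX L₁ 1 * p.1 := by
    simp only [freqX]; push_cast; ring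
  simp only [sinWave]
  rw [e1, e2, Complex.sin_add, Complex.sin_sub]
  ring

theorem exp_mul_sinWave (m n j : ℤ) (p : ℝ × ℝ) :
    Complex.exp (Complex.I * freqY L₂ j * p.2) * sinWave (freqX L₁ m) (freqY L₂ n) p =
      sinWave (freqX L₁ m) (freqY L₂ (n + j)) p := by
  have e1 : Complex.I * (freqY L₂ (n + j) : ℝ) * p.2 =
      Complex.I * freqY L₂ n * p.2 + Complex.I * freqY L₂ j * p.2 := by
    simp only [freqY]; push_cast; ring
  simp only [sinWave]
  rw [e1, Complex.exp_add]
  ring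

/-- The generators of the trigonometric polynomials separate the points of the cylinder. -/
theorem separatesPoints_adjoin (h₁ : 0 < L₁) (h₂ : 0 < L₂) :
    (StarAlgebra.adjoin ℂ {cosGen L₁ L₂, expGen L₁ L₂ 1}).SeparatesPoints := by
  intro q r hqr
  have hsub := StarAlgebra.subset_adjoin ℂ {cosGen L₁ L₂, expGen L₁ L₂ 1}
  by_cases h : q.1 = r.1
  · have h' : q.2 ≠ r.2 := fun h' => hqr (Prod.ext h h')
    refine ⟨_, ⟨expGen L₁ L₂ 1, hsub (by simp), rfl⟩, fun he => h' ?_⟩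
    have : Fact (0 < L₂) := ⟨h₂⟩
    have he' : fourier 1 q.2 = fourier 1 r.2 := he
    rw [fourier_one, fourier_one] at he'
    exact AddCircle.injective_toCircle h₂.ne' (Subtype.ext he')
  · refine ⟨_, ⟨cosGen L₁ L₂, hsub (by simp), rfl⟩, fun he => h (Subtype.ext ?_)⟩
    have he' : Complex.cos (freqX L₁ 1 * ((q.1 : ℝ) : ℂ)) =
      Complex.cos (freqX L₁ 1 * ((r.1 : ℝ) : ℂ)) := he
    have he'' : Real.cos (freqX L₁ 1 * q.1) = Real.cos (freqX L₁ 1 * r.1) := by exact_mod_cast he'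
    have hf : 0 < freqX L₁ 1 := freqX_pos h₁ 1
    -- The argument `π x / L₁` stays in `[0, π]`, where the cosine is injective.
    have hb : ∀ z : Icc (0 : ℝ) L₁, freqX L₁ 1 * z ∈ Icc 0 Real.pi := by
      intro z
      refine ⟨mul_nonneg hf.le z.2.1, (mul_le_mul_of_nonneg_left z.2.2 hf.le).trans_eq ?_⟩
      rw [freqX]
      field_simp
      simp
    exact mul_left_cancel₀ hf.ne' (Real.injOn_cos (hb _) (hb _) he'')

theorem integrable_mul_comp (h₁ : 0 < L₁) (f : LTwo L₁ L₂) (ψ : C(ClosedCyl L₁ L₂, ℂ)) (a b : ℝ) :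
    Integrable (fun p => f p * (ψ (toClosedCyl h₁ p) * sinWave a b p)) (cyl L₁ L₂) :=
  integrable_mul_of_continuous f
    ((ψ.continuous.comp (continuous_toClosedCyl h₁)).mul (contDiff_sinWave _ _).continuous)

/-- The functional `ψ ↦ ∫ f ψ sin (a x) exp (i b y)` on continuous functions. -/
noncomputable def pairing (h₁ : 0 < L₁) (f : LTwo L₁ L₂) (a b : ℝ) :
    C(ClosedCyl L₁ L₂, ℂ) →ₗ[ℂ] ℂ where
  toFun ψ := ∫ p, f p * (ψ (toClosedCyl h₁ p) * sinWave a b p) ∂(cyl L₁ L₂)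
  map_add' ψ χ := by
    rw [← integral_add (integrable_mul_comp h₁ f ψ a b) (integrable_mul_comp h₁ f χ a b)]
    refine integral_congr_ae (ae_of_all _ fun p => ?_)
    simp only [ContinuousMap.add_apply]
    ring
  map_smul' c ψ := by
    rw [RingHom.id_apply, smul_eq_mul, ← integral_const_mul]
    refine integral_congr_ae (ae_of_all _ fun p => ?_)
    simp only [ContinuousMap.smul_apply, smul_eq_mul]
    ring

theorem pairing_apply (h₁ : 0 < L₁) (f : LTwo L₁ L₂) (a b : ℝ) (ψ : C(ClosedCyl L₁ L₂, ℂ)) :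
    pairing h₁ f a b ψ = ∫ p, f p * (ψ (toClosedCyl h₁ p) * sinWave a b p) ∂(cyl L₁ L₂) :=
  rfl

theorem continuous_pairing (h₁ : 0 < L₁) (h₂ : 0 < L₂) (f : LTwo L₁ L₂) (a b : ℝ) :
    Continuous (pairing h₁ f a b) := by
  have : Fact (0 < L₂) := ⟨h₂⟩
  refine AddMonoidHomClass.continuous_of_bound (pairing h₁ f a b)
    (∫ p, ‖f p‖ ∂(cyl L₁ L₂)) fun ψ => ?_
  have hf : Integrable f (cyl L₁ L₂) := (Lp.memLp f).integrable (by norm_num)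
  rw [pairing_apply, ← integral_mul_const]
  refine norm_integral_le_of_norm_le (hf.norm.mul_const _) (ae_of_all _ fun p => ?_)
  rw [norm_mul, norm_mul, norm_sinWave]
  refine mul_le_mul_of_nonneg_left ?_ (norm_nonneg _)
  exact (mul_le_of_le_one_right (norm_nonneg _) (Real.abs_sin_le_one _)).trans
    (ψ.norm_coe_le_norm _)

theorem pairing_cosGen_mul (h₁ : 0 < L₁) (f : LTwo L₁ L₂) (m n : ℤ) (ψ : C(ClosedCyl L₁ L₂, ℂ)) :
    pairing h₁ f (freqX L₁ m) (freqY L₂ n) (cosGen L₁ L₂ * ψ) =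
      (pairing h₁ f (freqX L₁ (m + 1)) (freqY L₂ n) ψ +
        pairing h₁ f (freqX L₁ (m - 1)) (freqY L₂ n) ψ) / 2 := by
  simp only [pairing_apply]
  rw [← integral_add (integrable_mul_comp h₁ f ψ _ _) (integrable_mul_comp h₁ f ψ _ _),
    ← integral_div]
  have hm : MeasurableSet (cell L₁ L₂) := measurableSet_Ioo.prod measurableSet_Ioo
  refine setIntegral_congr_fun hm fun p hp => ?_
  simp only [ContinuousMap.mul_apply]
  rw [cosGen_toClosedCyl h₁ hp]
  linear_combination f p * ψ (toClosedCyl h₁ p) * cos_mul_sinWave (L₁ := L₁) (L₂ := L₂) m n p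

theorem pairing_expGen_mul (h₁ : 0 < L₁) (f : LTwo L₁ L₂) (m n j : ℤ)
    (ψ : C(ClosedCyl L₁ L₂, ℂ)) :
    pairing h₁ f (freqX L₁ m) (freqY L₂ n) (expGen L₁ L₂ j * ψ) =
      pairing h₁ f (freqX L₁ m) (freqY L₂ (n + j)) ψ := by
  simp only [pairing_apply]
  refine integral_congr_ae (ae_of_all _ fun p => ?_)
  simp only [ContinuousMap.mul_apply]
  rw [expGen_toClosedCyl h₁]
  linear_combination f p * ψ (toClosedCyl h₁ p) * exp_mul_sinWave (L₁ := L₁) (L₂ := L₂) m n j p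

theorem star_cosGen : star (cosGen L₁ L₂) = cosGen L₁ L₂ := by
  ext q
  simp only [ContinuousMap.star_apply, cosGen, ContinuousMap.coe_mk, RCLike.star_def]
  rw [← Complex.cos_conj]
  simp

theorem star_expGen (m : ℤ) : star (expGen L₁ L₂ m) = expGen L₁ L₂ (-m) := by
  ext q
  simp only [ContinuousMap.star_apply, expGen, ContinuousMap.coe_mk, RCLike.star_def, fourier_neg]

/-- If a square integrable function is orthogonal to the sine modes, then all pairings with
continuous functions vanish. -/
theorem pairing_eq_zero (h₁ : 0 < L₁) (h₂ : 0 < L₂) (f : LTwo L₁ L₂)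
    (h : ∀ m n : ℤ, ∫ p, f p * sinWave (freqX L₁ m) (freqY L₂ n) p ∂(cyl L₁ L₂) = 0)
    (ψ : C(ClosedCyl L₁ L₂, ℂ)) (m n : ℤ) : pairing h₁ f (freqX L₁ m) (freqY L₂ n) ψ = 0 := by
  have : Fact (0 < L₂) := ⟨h₂⟩
  set s : Set C(ClosedCyl L₁ L₂, ℂ) := {cosGen L₁ L₂, expGen L₁ L₂ 1} with hs
  -- Induction over words in the generators and their conjugates. Removing a letter shifts the
  -- frequencies of the sine wave, so the claim has to be made for all `m` and `n` together.
  have hmon : ∀ χ ∈ Submonoid.closure (s ∪ star s), ∀ m n : ℤ,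
      pairing h₁ f (freqX L₁ m) (freqY L₂ n) χ = 0 := by
    intro χ hχ
    induction hχ using Submonoid.closure_induction_left with
    | one =>
      intro m n
      rw [pairing_apply, ← h m n]
      simp
    | mul_left x hx y _ ih =>
      intro m n
      have hx' : x = cosGen L₁ L₂ ∨ x = expGen L₁ L₂ 1 ∨ x = expGen L₁ L₂ (-1) := by
        rcases hx with hx | hx
        · rcases hx with hx | hx
          · exact Or.inl hx
          · exact Or.inr (Or.inl hx)
        · rw [Set.mem_star] at hx
          rcases hx with hx | hx
          · refine Or.inl ?_
            rw [← star_star x, hx, star_cosGen]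
          · refine Or.inr (Or.inr ?_)
            rw [← star_star x, mem_singleton_iff.1 hx, star_expGen]
      rcases hx' with rfl | rfl | rfl
      · rw [pairing_cosGen_mul, ih, ih]
        simp
      · rw [pairing_expGen_mul, ih]
      · rw [pairing_expGen_mul, ih]
  have hadj : ∀ χ ∈ StarAlgebra.adjoin ℂ s, pairing h₁ f (freqX L₁ m) (freqY L₂ n) χ = 0 := by
    intro χ hχ
    have hχ' : χ ∈ Submodule.span ℂ (Submonoid.closure (s ∪ star s) : 
        Set C(ClosedCyl L₁ L₂, ℂ)) := by
      rw [← Algebra.adjoin_eq_span]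
      exact hχ
    have hle : Submodule.span ℂ (Submonoid.closure (s ∪ star s) : Set C(ClosedCyl L₁ L₂, ℂ)) ≤
        LinearMap.ker (pairing h₁ f (freqX L₁ m) (freqY L₂ n)) :=
      Submodule.span_le.2 fun χ hχ => hmon χ hχ m n
    exact hle hχ'
  have htop := ContinuousMap.starSubalgebra_topologicalClosure_eq_top_of_separatesPoints
    _ (separatesPoints_adjoin (L₁ := L₁) (L₂ := L₂) h₁ h₂)
  have hψ : ψ ∈ (StarAlgebra.adjoin ℂ s).topologicalClosure := by
    rw [htop]
    trivial
  have hcl : IsClosed {χ | pairing h₁ f (freqX L₁ m) (freqY L₂ n) χ = 0} :=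
    isClosed_eq (continuous_pairing h₁ h₂ f _ _) continuous_const
  exact closure_minimal hadj hcl hψ

theorem sinWave_neg (a b : ℝ) (p : ℝ × ℝ) : sinWave (-a) b p = -sinWave a b p := by
  simp [sinWave]

theorem freqX_neg (m : ℤ) : freqX L₁ (-m) = -freqX L₁ m := by
  simp only [freqX]
  push_cast
  ring

theorem conj_sinWave (a b : ℝ) (p : ℝ × ℝ) :
    (starRingEnd ℂ) (sinWave a b p) = sinWave a (-b) p := by
  simp [sinWave, ← Complex.sin_conj, ← Complex.exp_conj]

theorem freqY_neg (m : ℤ) : freqY L₂ (-m) = -freqY L₂ m := by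
  simp only [freqY]
  push_cast
  ring

/-- The sine modes are complete in `L²`. -/
theorem eq_zero_of_inner_sinMode (h₁ : 0 < L₁) (h₂ : 0 < L₂) (f : LTwo L₁ L₂)
    (h : ∀ k, inner ℂ (sinMode L₁ L₂ k) f = 0) : f = 0 := by
  have hpos : ∀ (m : ℕ+) (n : ℤ),
      ∫ p, f p * sinWave (freqX L₁ m) (freqY L₂ n) p ∂(cyl L₁ L₂) = 0 := by
    intro m n
    -- The inner product conjugates the mode, which reverses the second frequency.
    rw [← h (m, -n), sinMode, inner_ofCont]
    simp only [conj_sinWave, freqY_neg, neg_neg]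
  have hall : ∀ m n : ℤ, ∫ p, f p * sinWave (freqX L₁ m) (freqY L₂ n) p ∂(cyl L₁ L₂) = 0 := by
    intro m n
    rcases lt_trichotomy m 0 with hm | rfl | hm
    · obtain ⟨j, hj⟩ : ∃ j : ℕ+, (j : ℤ) = -m :=
        ⟨⟨(-m).toNat, by omega⟩, by simp only [PNat.mk_coe]; omega⟩
      have hm' : m = -(j : ℤ) := by omega
      simp only [hm', freqX_neg, sinWave_neg, mul_neg, integral_neg, hpos, neg_zero]
    · simp [freqX, sinWave]
    · obtain ⟨j, hj⟩ : ∃ j : ℕ+, (j : ℤ) = m :=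
        ⟨⟨m.toNat, by omega⟩, by simp only [PNat.mk_coe]; omega⟩
      rw [← hj]
      exact hpos j n
  -- The product `sin(π x / L₁) f` is orthogonal to every test function, because its integral
  -- against one is a pairing that has just been shown to vanish. The sine has no zero inside the
  -- cell, so it can be divided out at the end.
  have hsm : MemLp (fun p => sinWave (freqX L₁ 1) (freqY L₂ 0) p * f p) 2 (cyl L₁ L₂) := by
    refine (Lp.memLp f).of_le ((contDiff_sinWave _ _).continuous.aestronglyMeasurable.mul
      (Lp.aestronglyMeasurable f)) (ae_of_all _ fun p => ?_)
    rw [norm_mul, norm_sinWave]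
    exact mul_le_of_le_one_left (norm_nonneg _) (Real.abs_sin_le_one _)
  have hg : hsm.toLp _ = 0 := by
    refine eq_zero_of_test h₂ _ fun φ hφ => ?_
    have hper : Function.Periodic (fun y => fun x : Icc (0 : ℝ) L₁ => φ (x, y)) L₂ := fun y => by
      funext x
      exact hφ.periodic _ _
    let ψ : C(ClosedCyl L₁ L₂, ℂ) :=
      ⟨fun q => hper.lift q.2 q.1, by
        have hq : IsOpenQuotientMap (Prod.map id ((↑) : ℝ → AddCircle L₂) :
            Icc (0 : ℝ) L₁ × ℝ → ClosedCyl L₁ L₂) :=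
          IsOpenQuotientMap.id.prodMap QuotientAddGroup.isOpenQuotientMap_mk
        rw [hq.isQuotientMap.continuous_iff]
        exact hφ.smooth.continuous.comp (by fun_prop)⟩
    have hψ : ∀ p ∈ cell L₁ L₂, ψ (toClosedCyl h₁ p) = φ p := by
      intro p hp
      change hper.lift (p.2 : AddCircle L₂) (projIcc 0 L₁ h₁.le p.1) = φ p
      rw [Function.Periodic.lift_coe, projIcc_of_mem h₁.le (Ioo_subset_Icc_self hp.1)]
    have h0 := pairing_eq_zero h₁ h₂ f hall ψ 1 0
    rw [pairing_apply] at h0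
    rw [← h0]
    have hm : MeasurableSet (cell L₁ L₂) := measurableSet_Ioo.prod measurableSet_Ioo
    refine integral_congr_ae ?_
    filter_upwards [hsm.coeFn_toLp, ae_restrict_mem hm] with p h1 h2
    rw [h1, hψ p h2]
    ring
  have hm : MeasurableSet (cell L₁ L₂) := measurableSet_Ioo.prod measurableSet_Ioo
  rw [Lp.eq_zero_iff_ae_eq_zero] at hg ⊢
  filter_upwards [hg, hsm.coeFn_toLp, ae_restrict_mem hm] with p e1 e2 hp
  rw [e2] at e1
  refine (mul_eq_zero.1 e1).resolve_left fun h0 => ?_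
  have h1 := congrArg norm h0
  rw [norm_sinWave, norm_zero, abs_eq_zero] at h1
  refine (Real.sin_pos_of_pos_of_lt_pi ?_ ?_).ne' h1
  · exact mul_pos (freqX_pos h₁ 1) hp.1.1
  · refine (mul_lt_mul_of_pos_left hp.1.2 (freqX_pos h₁ 1)).trans_eq ?_
    rw [freqX]
    field_simp
    simp

/-! ### Hilbert bases and diagonal operators -/

section hilbertBasis

variable {ι E : Type*} [NormedAddCommGroup E] [InnerProductSpace ℂ E]

theorem hasSum_sq_norm_repr (b : HilbertBasis ι ℂ E) (x : E) :
    HasSum (fun i => ‖b.repr x i‖ ^ 2) (‖x‖ ^ 2) := by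
  have h := lp.hasSum_norm (p := 2) (by norm_num) (b.repr x)
  simpa [b.repr.norm_map] using h

theorem exists_repr_eq (b : HilbertBasis ι ℂ E) {c : ι → ℂ} (hc : Summable fun i => ‖c i‖ ^ 2) :
    ∃ x, ∀ i, b.repr x i = c i := by
  have hm : Memℓp c 2 := memℓp_gen (by simpa using hc)
  exact ⟨b.repr.symm ⟨c, hm⟩, fun i => by rw [b.repr.apply_symm_apply]⟩

/-- The diagonal operator with a bounded symbol. -/
theorem exists_diagonal (b : HilbertBasis ι ℂ E) {m : ι → ℂ} {C : ℝ} (hm : ∀ i, ‖m i‖ ≤ C) :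
    ∃ T : E →L[ℂ] E, ∀ x i, b.repr (T x) i = m i * b.repr x i := by
  have hle : ∀ x i, ‖m i * b.repr x i‖ ^ 2 ≤ C ^ 2 * ‖b.repr x i‖ ^ 2 := by
    intro x i
    rw [norm_mul, mul_pow]
    gcongr
    exact hm i
  have hs : ∀ x, Summable fun i => ‖m i * b.repr x i‖ ^ 2 := fun x =>
    Summable.of_nonneg_of_le (fun i => by positivity) (hle x)
      ((hasSum_sq_norm_repr b x).summable.mul_left _)
  choose T hT using fun x => exists_repr_eq b (hs x)
  have hext : ∀ {x y : E}, (∀ i, b.repr x i = b.repr y i) → x = y := fun h =>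
    b.repr.injective (lp.ext (funext h))
  let T' : E →ₗ[ℂ] E :=
    { toFun := T
      map_add' := fun x y => hext fun i => by
        rw [map_add, lp.coeFn_add, Pi.add_apply, hT, hT, hT, map_add, lp.coeFn_add, Pi.add_apply,
          mul_add]
      map_smul' := fun c x => hext fun i => by
        rw [RingHom.id_apply, map_smul, lp.coeFn_smul, Pi.smul_apply, hT, hT, map_smul,
          lp.coeFn_smul, Pi.smul_apply, smul_eq_mul, smul_eq_mul]
        ring }
  -- The absolute value is needed because `C` may be negative when `ι` is empty.
  refine ⟨T'.mkContinuous |C| fun x => ?_, fun x i => hT x i⟩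
  refine abs_le_of_sq_le_sq' (a := ‖T x‖) (b := |C| * ‖x‖) ?_ (by positivity) |>.2
  rw [mul_pow, sq_abs]
  refine hasSum_le (fun i => ?_) (hasSum_sq_norm_repr b (T x))
    ((hasSum_sq_norm_repr b x).mul_left (C ^ 2))
  rw [hT]
  exact hle x i

end hilbertBasis

/-! ### Fourier coefficients in `L²` and in `H¹₀` -/

/-- The eigenvalue of `-∇²` on a mode. -/
noncomputable def mu (L₁ L₂ : ℝ) (k : ℕ+ × ℤ) : ℝ := freqX L₁ k.1 ^ 2 + freqY L₂ k.2 ^ 2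

theorem mu_pos (h₁ : 0 < L₁) (k : ℕ+ × ℤ) : 0 < mu L₁ L₂ k := by
  have := freqX_pos h₁ k.1
  rw [mu]
  positivity

/-- The normalized sine mode. -/
noncomputable def sinUnit (L₁ L₂ : ℝ) (k : ℕ+ × ℤ) : LTwo L₁ L₂ :=
  ((‖sinMode L₁ L₂ k‖ : ℂ)⁻¹) • sinMode L₁ L₂ k

/-- The normalized cosine mode. -/
noncomputable def cosUnit (L₁ L₂ : ℝ) (k : ℕ+ × ℤ) : LTwo L₁ L₂ :=
  ((‖sinMode L₁ L₂ k‖ : ℂ)⁻¹) • cosMode L₁ L₂ k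

theorem norm_sinMode_ne_zero (h₁ : 0 < L₁) (h₂ : 0 < L₂) (k : ℕ+ × ℤ) :
    (‖sinMode L₁ L₂ k‖ : ℂ) ≠ 0 := by
  exact_mod_cast (norm_ne_zero_iff.2 (sinMode_ne_zero h₁ h₂ k))

theorem orthonormal_sinUnit (h₁ : 0 < L₁) (h₂ : 0 < L₂) : Orthonormal ℂ (sinUnit L₁ L₂) := by
  classical
  rw [orthonormal_iff_ite]
  intro k j
  rw [sinUnit, sinUnit, inner_smul_left, inner_smul_right]
  split_ifs with h
  · subst h
    have := norm_sinMode_ne_zero h₁ h₂ k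
    rw [inner_self_eq_norm_sq_to_K]
    simp only [map_inv₀, Complex.conj_ofReal, Complex.coe_algebraMap]
    field_simp
  · rw [inner_sinMode_of_ne h₁ h₂ h, mul_zero, mul_zero]

theorem orthonormal_cosUnit (h₁ : 0 < L₁) (h₂ : 0 < L₂) : Orthonormal ℂ (cosUnit L₁ L₂) := by
  classical
  have h := orthonormal_sinUnit h₁ h₂
  rw [orthonormal_iff_ite] at h ⊢
  intro k j
  rw [← h k j, cosUnit, cosUnit, sinUnit, sinUnit, inner_smul_left, inner_smul_right,
    inner_smul_left, inner_smul_right, inner_cosMode h₁ h₂]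

/-- The Hilbert basis of normalized sine modes of `L²`. -/
noncomputable def sinBasis (h₁ : 0 < L₁) (h₂ : 0 < L₂) :
    HilbertBasis (ℕ+ × ℤ) ℂ (LTwo L₁ L₂) :=
  HilbertBasis.mkOfOrthogonalEqBot (orthonormal_sinUnit h₁ h₂) (by
    rw [Submodule.eq_bot_iff]
    intro f hf
    rw [Submodule.mem_orthogonal] at hf
    refine eq_zero_of_inner_sinMode h₁ h₂ f fun k => ?_
    have h := hf _ (Submodule.subset_span (mem_range_self k))
    rw [sinUnit, inner_smul_left] at h
    refine (mul_eq_zero.1 h).resolve_left ?_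
    simpa using sinMode_ne_zero h₁ h₂ k)

/-- The Fourier coefficients of a square integrable function. -/
noncomputable def coef (f : LTwo L₁ L₂) (k : ℕ+ × ℤ) : ℂ := inner ℂ (sinUnit L₁ L₂ k) f

theorem sinBasis_repr (h₁ : 0 < L₁) (h₂ : 0 < L₂) (f : LTwo L₁ L₂) (k : ℕ+ × ℤ) :
    (sinBasis h₁ h₂).repr f k = coef f k := by
  rw [HilbertBasis.repr_apply_apply, coef, sinBasis, HilbertBasis.coe_mkOfOrthogonalEqBot]

theorem coef_add (f g : LTwo L₁ L₂) (k : ℕ+ × ℤ) : coef (f + g) k = coef f k + coef g k :=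
  inner_add_right _ _ _

theorem coef_smul (c : ℂ) (f : LTwo L₁ L₂) (k : ℕ+ × ℤ) : coef (c • f) k = c * coef f k :=
  inner_smul_right _ _ _

theorem coef_neg (f : LTwo L₁ L₂) (k : ℕ+ × ℤ) : coef (-f) k = -coef f k :=
  inner_neg_right _ _

theorem coef_eq (f : LTwo L₁ L₂) (k : ℕ+ × ℤ) :
    coef f k = (‖sinMode L₁ L₂ k‖ : ℂ)⁻¹ * inner ℂ (sinMode L₁ L₂ k) f := by
  rw [coef, sinUnit, inner_smul_left]
  simp

theorem coef_ext (h₁ : 0 < L₁) (h₂ : 0 < L₂) {f g : LTwo L₁ L₂} (h : ∀ k, coef f k = coef g k) :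
    f = g := by
  refine (sinBasis h₁ h₂).repr.injective (lp.ext (funext fun k => ?_))
  rw [sinBasis_repr, sinBasis_repr, h]

theorem exists_coef_eq (h₁ : 0 < L₁) (h₂ : 0 < L₂) {c : ℕ+ × ℤ → ℂ}
    (hc : Summable fun k => ‖c k‖ ^ 2) : ∃ f : LTwo L₁ L₂, ∀ k, coef f k = c k := by
  obtain ⟨f, hf⟩ := exists_repr_eq (sinBasis h₁ h₂) hc
  exact ⟨f, fun k => by rw [← sinBasis_repr h₁ h₂, hf]⟩

theorem coef_snd (h₁ : 0 < L₁) (h₂ : 0 < L₂) (v : HOneZero L₁ L₂) (k : ℕ+ × ℤ) :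
    coef (v.1 2) k = Complex.I * freqY L₂ k.2 * coef (v.1 0) k := by
  rw [coef_eq, coef_eq, inner_sinMode_snd h₁ h₂ k v.2]
  ring

theorem inner_modeJet_gradient (h₁ : 0 < L₁) (h₂ : 0 < L₂) (v : HOneZero L₁ L₂) (k : ℕ+ × ℤ) :
    inner ℂ (modeJet L₁ L₂ k 1) (v.1 1) + inner ℂ (modeJet L₁ L₂ k 2) (v.1 2) =
      mu L₁ L₂ k * inner ℂ (sinMode L₁ L₂ k) (v.1 0) := by
  change inner ℂ ((freqX L₁ k.1 : ℂ) • cosMode L₁ L₂ k) _ +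
    inner ℂ ((Complex.I * freqY L₂ k.2) • sinMode L₁ L₂ k) _ = _
  rw [inner_smul_left, inner_smul_left, inner_sinMode_snd h₁ h₂ k v.2,
    inner_cosMode_fst h₁ h₂ k v.2]
  simp only [map_mul, Complex.conj_ofReal, Complex.conj_I, mu]
  push_cast
  linear_combination (-(freqY L₂ k.2 : ℂ) ^ 2 * inner ℂ (sinMode L₁ L₂ k) (v.1 0)) *
    Complex.I_mul_I

/-- This carries orthogonality and completeness from `L²` to `H¹₀`: the `H¹` product with a mode
sees only the `L²` coefficient, with weight `1 + μ`. -/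
theorem inner_modeJet (h₁ : 0 < L₁) (h₂ : 0 < L₂) (v : HOneZero L₁ L₂) (k : ℕ+ × ℤ) :
    inner ℂ (modeJet L₁ L₂ k) v.1 =
      (1 + mu L₁ L₂ k) * inner ℂ (sinMode L₁ L₂ k) (v.1 0) := by
  rw [PiLp.inner_apply, Fin.sum_univ_three, add_assoc, inner_modeJet_gradient h₁ h₂]
  change inner ℂ (sinMode L₁ L₂ k) _ + _ = _
  ring

/-- The normalized sine mode in `H¹₀`. -/
noncomputable def unitJet (h₁ : 0 < L₁) (h₂ : 0 < L₂) (k : ℕ+ × ℤ) : HOneZero L₁ L₂ :=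
  ((Real.sqrt (1 + mu L₁ L₂ k) : ℂ)⁻¹ * (‖sinMode L₁ L₂ k‖ : ℂ)⁻¹) •
    ⟨modeJet L₁ L₂ k, modeJet_mem h₁ h₂ k⟩

theorem sqrt_mul_sqrt_mu (h₁ : 0 < L₁) (k : ℕ+ × ℤ) :
    (Real.sqrt (1 + mu L₁ L₂ k) : ℂ) * Real.sqrt (1 + mu L₁ L₂ k) = 1 + mu L₁ L₂ k := by
  have := mu_pos (L₂ := L₂) h₁ k
  rw [← Complex.ofReal_mul, Real.mul_self_sqrt (by positivity)]
  push_cast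
  rfl

theorem sqrt_mu_ne_zero (h₁ : 0 < L₁) (k : ℕ+ × ℤ) :
    (Real.sqrt (1 + mu L₁ L₂ k) : ℂ) ≠ 0 := by
  have := mu_pos (L₂ := L₂) h₁ k
  exact_mod_cast (Real.sqrt_pos.2 (by positivity)).ne'

theorem inner_unitJet (h₁ : 0 < L₁) (h₂ : 0 < L₂) (v : HOneZero L₁ L₂) (k : ℕ+ × ℤ) :
    inner ℂ (unitJet h₁ h₂ k) v = Real.sqrt (1 + mu L₁ L₂ k) * coef (v.1 0) k := by
  rw [Submodule.coe_inner, unitJet, Submodule.coe_smul, inner_smul_left, inner_modeJet h₁ h₂,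
    coef_eq, ← sqrt_mul_sqrt_mu h₁]
  simp only [map_mul, map_inv₀, Complex.conj_ofReal]
  have := sqrt_mu_ne_zero (L₂ := L₂) h₁ k
  field_simp

theorem coef_unitJet (h₁ : 0 < L₁) (h₂ : 0 < L₂) (k j : ℕ+ × ℤ) :
    coef ((unitJet h₁ h₂ j).1 0) k =
      if k = j then (Real.sqrt (1 + mu L₁ L₂ j) : ℂ)⁻¹ else 0 := by
  classical
  have h : (unitJet h₁ h₂ j).1 0 =
      (Real.sqrt (1 + mu L₁ L₂ j) : ℂ)⁻¹ • sinUnit L₁ L₂ j := by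
    rw [sinUnit, smul_smul]
    rfl
  rw [h, coef_smul, coef, (orthonormal_iff_ite.1 (orthonormal_sinUnit h₁ h₂)) k j]
  split_ifs <;> simp

theorem orthonormal_unitJet (h₁ : 0 < L₁) (h₂ : 0 < L₂) : Orthonormal ℂ (unitJet h₁ h₂) := by
  classical
  rw [orthonormal_iff_ite]
  intro k j
  rw [inner_unitJet h₁ h₂, coef_unitJet h₁ h₂]
  split_ifs with h
  · subst h
    exact mul_inv_cancel₀ (sqrt_mu_ne_zero h₁ k)
  · simp

/-- The Hilbert basis of normalized sine modes of `H¹₀`. -/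
noncomputable def jetBasis (h₁ : 0 < L₁) (h₂ : 0 < L₂) :
    HilbertBasis (ℕ+ × ℤ) ℂ (HOneZero L₁ L₂) :=
  HilbertBasis.mkOfOrthogonalEqBot (orthonormal_unitJet h₁ h₂) (by
    rw [Submodule.eq_bot_iff]
    intro v hv
    rw [Submodule.mem_orthogonal] at hv
    refine hOneZero_ext h₁ h₂ (coef_ext h₁ h₂ fun k => ?_)
    have h := hv _ (Submodule.subset_span (mem_range_self k))
    rw [inner_unitJet] at h
    rw [(mul_eq_zero.1 h).resolve_left (sqrt_mu_ne_zero h₁ k), coef, inner_zero_right])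

theorem jetBasis_repr (h₁ : 0 < L₁) (h₂ : 0 < L₂) (v : HOneZero L₁ L₂) (k : ℕ+ × ℤ) :
    (jetBasis h₁ h₂).repr v k = Real.sqrt (1 + mu L₁ L₂ k) * coef (v.1 0) k := by
  rw [HilbertBasis.repr_apply_apply, jetBasis, HilbertBasis.coe_mkOfOrthogonalEqBot,
    inner_unitJet]

theorem hOneZero_coef_ext (h₁ : 0 < L₁) (h₂ : 0 < L₂) {v w : HOneZero L₁ L₂}
    (h : ∀ k, coef (v.1 0) k = coef (w.1 0) k) : v = w := by
  refine (jetBasis h₁ h₂).repr.injective (lp.ext (funext fun k => ?_))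
  rw [jetBasis_repr, jetBasis_repr, h]

theorem norm_sqrt_mu_mul_sq (h₁ : 0 < L₁) (k : ℕ+ × ℤ) (z : ℂ) :
    ‖(Real.sqrt (1 + mu L₁ L₂ k) : ℂ) * z‖ ^ 2 = (1 + mu L₁ L₂ k) * ‖z‖ ^ 2 := by
  have := mu_pos (L₂ := L₂) h₁ k
  rw [norm_mul, mul_pow, Complex.norm_real, Real.norm_eq_abs, sq_abs, Real.sq_sqrt (by positivity)]

/-- Parseval's identity in `H¹₀`. Together with `exists_hOneZero_coef_eq` it characterizes the
coefficient sequences of elements of `H¹₀`. -/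
theorem summable_mu_coef (h₁ : 0 < L₁) (h₂ : 0 < L₂) (v : HOneZero L₁ L₂) :
    Summable fun k => (1 + mu L₁ L₂ k) * ‖coef (v.1 0) k‖ ^ 2 := by
  have h := (hasSum_sq_norm_repr (jetBasis h₁ h₂) v).summable
  simpa only [jetBasis_repr, norm_sqrt_mu_mul_sq h₁] using h

theorem exists_hOneZero_coef_eq (h₁ : 0 < L₁) (h₂ : 0 < L₂) {c : ℕ+ × ℤ → ℂ}
    (hc : Summable fun k => (1 + mu L₁ L₂ k) * ‖c k‖ ^ 2) :
    ∃ v : HOneZero L₁ L₂, ∀ k, coef (v.1 0) k = c k := by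
  simp_rw [← norm_sqrt_mu_mul_sq (L₂ := L₂) h₁] at hc
  obtain ⟨v, hv⟩ := exists_repr_eq (jetBasis h₁ h₂) hc
  refine ⟨v, fun k => mul_left_cancel₀ (sqrt_mu_ne_zero (L₂ := L₂) h₁ k) ?_⟩
  rw [← jetBasis_repr h₁ h₂, hv]

/-! ### The Laplacian and Sobolev regularity in terms of coefficients -/

/-- Weak solutions of `∇²f = g` in terms of Fourier coefficients. -/
theorem hasWeakLaplacian_iff_coef (h₁ : 0 < L₁) (h₂ : 0 < L₂) (v : HOneZero L₁ L₂)
    (g : LTwo L₁ L₂) :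
    HasWeakLaplacian v g ↔ ∀ k, coef g k = -mu L₁ L₂ k * coef (v.1 0) k := by
  -- With `g` in the first slot and the gradient of `v` in the others, the weak equation says that
  -- `z` is orthogonal to the test jets. By density this is orthogonality to `H¹₀`, and by density
  -- again to the modes alone.
  let z : Jet L₁ L₂ := WithLp.toLp 2 ![g, v.1 1, v.1 2]
  have hz : ∀ w : Jet L₁ L₂, inner ℂ w z =
      inner ℂ (w 0) g + (inner ℂ (w 1) (v.1 1) + inner ℂ (w 2) (v.1 2)) := by
    intro w
    rw [PiLp.inner_apply, Fin.sum_univ_three, add_assoc]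
    rfl
  have hmode : ∀ k, inner ℂ (modeJet L₁ L₂ k) z = 0 ↔
      coef g k = -mu L₁ L₂ k * coef (v.1 0) k := by
    intro k
    rw [hz, inner_modeJet_gradient h₁ h₂, coef_eq, coef_eq, ← mul_right_inj'
      (inv_ne_zero (norm_sinMode_ne_zero h₁ h₂ k)), mul_zero]
    change _ * (inner ℂ (sinMode L₁ L₂ k) g + _) = 0 ↔ _
    rw [← sub_eq_zero (b := -(mu L₁ L₂ k : ℂ) * _)]
    ring_nf
  have htest : HasWeakLaplacian v g ↔ ∀ w ∈ testJets L₁ L₂, inner ℂ w z = 0 := by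
    rw [weakLaplacian_iff]
    have key : ∀ (w : Jet L₁ L₂) (φ : ℝ × ℝ → ℂ), IsTest L₁ L₂ φ → w 0 =ᵐ[cyl L₁ L₂] φ →
        w 1 =ᵐ[cyl L₁ L₂] pd (1, 0) φ → w 2 =ᵐ[cyl L₁ L₂] pd (0, 1) φ →
        inner ℂ w z = ∫ p, g p * (starRingEnd ℂ) (φ p) ∂(cyl L₁ L₂) +
          (∫ p, v.1 1 p * pd (1, 0) (fun p => (starRingEnd ℂ) (φ p)) p ∂(cyl L₁ L₂) +
          ∫ p, v.1 2 p * pd (0, 1) (fun p => (starRingEnd ℂ) (φ p)) p ∂(cyl L₁ L₂)) := by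
      intro w φ hφ e0 e1 e2
      rw [hz, inner_eq_integral_mul_conj _ _ e0, inner_eq_integral_mul_conj _ _ e1,
        inner_eq_integral_mul_conj _ _ e2]
      simp only [hφ.pd_conj]
    constructor
    · rintro h w ⟨φ, hφ, e0, e1, e2⟩
      rw [key w φ hφ e0 e1 e2, h _ hφ.conj, add_neg_cancel]
    · intro h φ hφ
      have e := h _ hφ.conj.jet_mem_testJets
      rw [key _ _ hφ.conj (coeFn_ofCont hφ.conj.smooth.continuous)
        (coeFn_ofCont (continuous_partial hφ.conj.smooth _))
        (coeFn_ofCont (continuous_partial hφ.conj.smooth _))] at e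
      simp only [Complex.conj_conj] at e
      exact eq_neg_of_add_eq_zero_right e
  have hall : (∀ w ∈ testJets L₁ L₂, inner ℂ w z = 0) ↔
      ∀ w ∈ HOneZero L₁ L₂, inner ℂ w z = 0 := by
    refine ⟨fun h w hw => ?_, fun h w hw => h w (testJets_subset hw)⟩
    have h0 : inner ℂ z w = 0 := apply_eq_zero_of_testJets (innerSL ℂ z) (fun w hw => by
      rw [innerSL_apply_apply, ← inner_conj_symm, h w hw, map_zero]) hw
    rw [← inner_conj_symm, h0, map_zero]
  rw [htest, hall]
  constructor
  · exact fun h k => (hmode k).1 (h _ (modeJet_mem h₁ h₂ k))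
  · intro h w hw
    have hdense := (jetBasis h₁ h₂).dense_span
    have hle : Submodule.span ℂ (range (jetBasis h₁ h₂)) ≤
        LinearMap.ker ((innerSL ℂ z).comp (HOneZero L₁ L₂).subtypeL : HOneZero L₁ L₂ →ₗ[ℂ] ℂ) := by
      rw [Submodule.span_le]
      rintro _ ⟨k, rfl⟩
      change inner ℂ z ((jetBasis h₁ h₂ k).1) = 0
      rw [jetBasis, HilbertBasis.coe_mkOfOrthogonalEqBot, unitJet, Submodule.coe_smul,
        inner_smul_right, ← inner_conj_symm, (hmode k).2 (h k), map_zero, mul_zero]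
    have hle' := Submodule.topologicalClosure_minimal _ hle
      ((innerSL ℂ z).comp (HOneZero L₁ L₂).subtypeL).isClosed_ker
    rw [hdense] at hle'
    have h0 : inner ℂ z w = 0 := hle' (x := ⟨w, hw⟩) trivial
    rw [← inner_conj_symm, h0, map_zero]

theorem summable_smul_of_orthonormal {ι E : Type*} [NormedAddCommGroup E] [InnerProductSpace ℂ E]
    [CompleteSpace E] {e : ι → E} (he : Orthonormal ℂ e) {c : ι → ℂ}
    (hc : Summable fun i => ‖c i‖ ^ 2) : Summable fun i => c i • e i := by
  have h := (he.orthogonalFamily.summable_iff_norm_sq_summable c).2 hc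
  simpa using h

/-- For a fixed test function both integrals are continuous in the `L²` argument, so weak
differentiation is a closed operation. A series may be differentiated termwise once both series
converge. -/
theorem HasWeakDeriv.of_hasSum {ι : Type*} {e : ℝ × ℝ} {f g : ι → LTwo L₁ L₂} {a b : LTwo L₁ L₂}
    (hf : HasSum f a) (hg : HasSum g b) (h : ∀ i, HasWeakDeriv e (f i) (g i)) :
    HasWeakDeriv e a b := by
  intro φ hφ
  rw [integral_mul_eq_inner _ (hφ.continuous_pd e), integral_mul_eq_inner _ hφ.smooth.continuous]
  have h1 := hf.mapL (innerSL ℂ ((memLp_of_continuous (L₁ := L₁) (L₂ := L₂)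
        (Complex.continuous_conj.comp (hφ.continuous_pd e))).toLp _ : LTwo L₁ L₂))
  have h2 := (hg.mapL (innerSL ℂ ((memLp_of_continuous (L₁ := L₁) (L₂ := L₂)
        (Complex.continuous_conj.comp hφ.smooth.continuous)).toLp _ : LTwo L₁ L₂))).neg
  refine h1.unique (h2.congr_fun fun i => ?_)
  have := h i φ hφ
  rwa [integral_mul_eq_inner _ (hφ.continuous_pd e),
    integral_mul_eq_inner _ hφ.smooth.continuous] at this

theorem sinUnit_hasWeakDeriv (h₁ : 0 < L₁) (h₂ : 0 < L₂) (k : ℕ+ × ℤ) :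
    HasWeakDeriv (1, 0) (sinUnit L₁ L₂ k) ((freqX L₁ k.1 : ℂ) • cosUnit L₁ L₂ k) ∧
    HasWeakDeriv (0, 1) (sinUnit L₁ L₂ k)
      ((Complex.I * freqY L₂ k.2) • sinUnit L₁ L₂ k) := by
  obtain ⟨ha, hb⟩ := sinMode_hasWeakDeriv h₁ h₂ k
  rw [sinUnit, cosUnit, smul_comm _ (_ : ℂ)⁻¹, smul_comm _ (_ : ℂ)⁻¹]
  exact ⟨ha.smul _, hb.smul _⟩

theorem cosUnit_hasWeakDeriv (h₁ : 0 < L₁) (h₂ : 0 < L₂) (k : ℕ+ × ℤ) :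
    HasWeakDeriv (1, 0) (cosUnit L₁ L₂ k) ((-freqX L₁ k.1 : ℂ) • sinUnit L₁ L₂ k) ∧
    HasWeakDeriv (0, 1) (cosUnit L₁ L₂ k)
      ((Complex.I * freqY L₂ k.2) • cosUnit L₁ L₂ k) := by
  obtain ⟨ha, hb⟩ := cosMode_hasWeakDeriv h₁ h₂ k
  rw [sinUnit, cosUnit, smul_comm _ (_ : ℂ)⁻¹, smul_comm _ (_ : ℂ)⁻¹]
  exact ⟨ha.smul _, hb.smul _⟩

theorem sq_freqX_le (k : ℕ+ × ℤ) : freqX L₁ k.1 ^ 2 ≤ 1 + mu L₁ L₂ k := by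
  rw [mu]
  nlinarith [sq_nonneg (freqY L₂ k.2)]

theorem sq_freqY_le (k : ℕ+ × ℤ) : freqY L₂ k.2 ^ 2 ≤ mu L₁ L₂ k := by
  rw [mu]
  nlinarith [sq_nonneg (freqX L₁ k.1)]

/-- Sine and cosine series with rapidly decaying coefficients belong to `H^m`. -/
theorem memH_tsum (h₁ : 0 < L₁) (h₂ : 0 < L₂) (m : ℕ) {c : ℕ+ × ℤ → ℂ}
    (hc : Summable fun k => (1 + mu L₁ L₂ k) ^ m * ‖c k‖ ^ 2) :
    MemH m (∑' k, c k • sinUnit L₁ L₂ k) ∧ MemH m (∑' k, c k • cosUnit L₁ L₂ k) := by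
  -- Since `∂₁` exchanges sines and cosines, both series pass through the induction together. Each
  -- derivative multiplies the coefficients by a factor whose squared modulus is at most `1 + μ`.
  induction m generalizing c with
  | zero => exact ⟨trivial, trivial⟩
  | succ m ih =>
    have hmu : ∀ k, 0 < mu L₁ L₂ k := mu_pos h₁
    have hmul : ∀ d : ℕ+ × ℤ → ℂ, (∀ k, ‖d k‖ ^ 2 ≤ 1 + mu L₁ L₂ k) →
        Summable fun k => (1 + mu L₁ L₂ k) ^ m * ‖c k * d k‖ ^ 2 := by
      intro d hd
      refine Summable.of_nonneg_of_le (fun k => ?_) (fun k => ?_) hc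
      · have := hmu k
        positivity
      · have := hmu k
        rw [norm_mul, mul_pow, pow_succ (1 + mu L₁ L₂ k), mul_assoc, mul_comm (‖c k‖ ^ 2)]
        gcongr
        exact hd k
    have hbase : ∀ {n : ℕ} {d : ℕ+ × ℤ → ℂ},
        (Summable fun k => (1 + mu L₁ L₂ k) ^ n * ‖d k‖ ^ 2) → Summable fun k => ‖d k‖ ^ 2 := by
      intro n d hd
      refine Summable.of_nonneg_of_le (fun k => by positivity) (fun k => ?_) hd
      exact le_mul_of_one_le_left (by positivity) (one_le_pow₀ (by linarith [hmu k]))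
    have hx := hmul (fun k => freqX L₁ k.1) fun k => by
      rw [Complex.norm_real, Real.norm_eq_abs, sq_abs]
      exact sq_freqX_le k
    have hx' := hmul (fun k => -freqX L₁ k.1) fun k => by
      rw [norm_neg, Complex.norm_real, Real.norm_eq_abs, sq_abs]
      exact sq_freqX_le k
    have hy := hmul (fun k => Complex.I * freqY L₂ k.2) fun k => by
      rw [norm_mul, Complex.norm_I, one_mul, Complex.norm_real, Real.norm_eq_abs, sq_abs]
      linarith [sq_freqY_le (L₁ := L₁) (L₂ := L₂) k]
    have hS : ∀ {n : ℕ} {d : ℕ+ × ℤ → ℂ},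
        (Summable fun k => (1 + mu L₁ L₂ k) ^ n * ‖d k‖ ^ 2) →
        HasSum (fun k => d k • sinUnit L₁ L₂ k) (∑' k, d k • sinUnit L₁ L₂ k) := fun hd =>
      (summable_smul_of_orthonormal (orthonormal_sinUnit h₁ h₂) (hbase hd)).hasSum
    have hC : ∀ {n : ℕ} {d : ℕ+ × ℤ → ℂ},
        (Summable fun k => (1 + mu L₁ L₂ k) ^ n * ‖d k‖ ^ 2) →
        HasSum (fun k => d k • cosUnit L₁ L₂ k) (∑' k, d k • cosUnit L₁ L₂ k) := fun hd =>
      (summable_smul_of_orthonormal (orthonormal_cosUnit h₁ h₂) (hbase hd)).hasSum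
    constructor
    · refine ⟨_, _, HasWeakDeriv.of_hasSum (hS hc) (hC hx) fun k => ?_,
        HasWeakDeriv.of_hasSum (hS hc) (hS hy) fun k => ?_, (ih hx).2, (ih hy).1⟩
      · rw [← smul_smul]
        exact (sinUnit_hasWeakDeriv h₁ h₂ k).1.smul _
      · rw [← smul_smul]
        exact (sinUnit_hasWeakDeriv h₁ h₂ k).2.smul _
    · refine ⟨_, _, HasWeakDeriv.of_hasSum (hC hc) (hS hx') fun k => ?_,
        HasWeakDeriv.of_hasSum (hC hc) (hC hy) fun k => ?_, (ih hx').1, (ih hy).2⟩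
      · rw [← smul_smul]
        exact (cosUnit_hasWeakDeriv h₁ h₂ k).1.smul _
      · rw [← smul_smul]
        exact (cosUnit_hasWeakDeriv h₁ h₂ k).2.smul _

theorem memZ_of_summable (h₁ : 0 < L₁) (h₂ : 0 < L₂) (v : HOneZero L₁ L₂)
    (hv : Summable fun k => (1 + mu L₁ L₂ k) ^ 3 * ‖coef (v.1 0) k‖ ^ 2) : MemZ v := by
  have h := (sinBasis h₁ h₂).hasSum_repr (v.1 0)
  simp only [sinBasis_repr] at h
  rw [sinBasis, HilbertBasis.coe_mkOfOrthogonalEqBot] at h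
  rw [MemZ, ← h.tsum_eq]
  exact (memH_tsum h₁ h₂ 3 hv).1

/-! ### The linearization as a family of `2 × 2` matrices -/

/-- The symbol of `A₂ / L₁`. -/
noncomputable def alpha (L₁ L₂ : ℝ) (k : ℕ+ × ℤ) : ℂ :=
  -(Complex.I * freqY L₂ k.2) / (L₁ * mu L₁ L₂ k)

/-- The least eigenvalue of `-∇²` bounds all of them from below. -/
theorem sq_freqX_one_le_mu (h₁ : 0 < L₁) (k : ℕ+ × ℤ) : freqX L₁ 1 ^ 2 ≤ mu L₁ L₂ k := by
  have hk : (1 : ℝ) ≤ ((k.1 : ℕ) : ℝ) := by exact_mod_cast k.1.pos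
  have h : freqX L₁ 1 ≤ freqX L₁ k.1 := by
    simp only [freqX]
    push_cast
    have := Real.pi_pos
    gcongr
  have h0 : 0 ≤ freqX L₁ 1 := (freqX_pos h₁ 1).le
  rw [mu]
  nlinarith [sq_nonneg (freqY L₂ k.2)]

/-- From `|η| ≤ 1 + η²`, `η² ≤ μ` and `μ ≥ (π / L₁)²` it follows that `|η| / μ ≤ (L₁ / π)² + 1`. -/
theorem exists_norm_alpha_le (h₁ : 0 < L₁) (L₂ : ℝ) :
    ∃ A, 0 ≤ A ∧ ∀ k, ‖alpha L₁ L₂ k‖ ≤ A := by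
  have hx : 0 < freqX L₁ 1 := freqX_pos h₁ 1
  refine ⟨(1 / freqX L₁ 1 ^ 2 + 1) / L₁, by positivity, fun k => ?_⟩
  have hm := mu_pos (L₂ := L₂) h₁ k
  have hm1 := sq_freqX_one_le_mu (L₂ := L₂) h₁ k
  have hy := sq_freqY_le (L₁ := L₁) (L₂ := L₂) k
  rw [alpha, norm_div, norm_neg, norm_mul, norm_mul, Complex.norm_I, one_mul, Complex.norm_real,
    Complex.norm_real, Complex.norm_real, Real.norm_eq_abs, Real.norm_eq_abs, Real.norm_eq_abs,
    abs_of_pos h₁, abs_of_pos hm, mul_comm L₁, ← div_div]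
  gcongr
  rw [div_le_iff₀ hm]
  have h1 : |freqY L₂ k.2| ≤ 1 + freqY L₂ k.2 ^ 2 := by
    nlinarith [sq_nonneg (|freqY L₂ k.2| - 1), sq_abs (freqY L₂ k.2),
      abs_nonneg (freqY L₂ k.2)]
  have h2 : 1 ≤ 1 / freqX L₁ 1 ^ 2 * mu L₁ L₂ k := by
    rw [div_mul_eq_mul_div, one_mul, le_div_iff₀ (by positivity), one_mul]
    exact hm1
  linarith

/-- The elliptic estimate on the level of Fourier coefficients. -/
theorem exists_elliptic_bound (h₁ : 0 < L₁) (L₂ t : ℝ) {ν : ℝ} (hν : 0 < ν) :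
    ∃ C, ∀ (k : ℕ+ × ℤ) (x y F : ℂ),
      F = t * (Complex.I * freqY L₂ k.2 * x) + alpha L₁ L₂ k * y - ν * mu L₁ L₂ k * x →
      (1 + mu L₁ L₂ k) * ‖x‖ ≤ C * (‖F‖ + ‖x‖ + ‖y‖) := by
  obtain ⟨A, hA0, hA⟩ := exists_norm_alpha_le h₁ L₂
  refine ⟨1 + 2 / ν * (1 + t ^ 2 / (2 * ν) + A), fun k x y F hF => ?_⟩
  have hm := mu_pos (L₂ := L₂) h₁ k
  have hy := sq_freqY_le (L₁ := L₁) (L₂ := L₂) k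
  set η := freqY L₂ k.2 with hη
  set μ := mu L₁ L₂ k with hμ
  have e1 : (ν : ℂ) * μ * x = t * (Complex.I * η * x) + alpha L₁ L₂ k * y - F := by
    rw [hF]; ring
  have e2 : ν * μ * ‖x‖ ≤ |t| * (|η| * ‖x‖) + A * ‖y‖ + ‖F‖ := by
    have h0 := congrArg norm e1
    rw [norm_mul, norm_mul, Complex.norm_real, Complex.norm_real, Real.norm_of_nonneg hν.le,
      Real.norm_of_nonneg hm.le] at h0
    rw [h0]
    refine (norm_sub_le _ _).trans (add_le_add_left ((norm_add_le _ _).trans (add_le_add ?_ ?_)) _)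
    · simp
    · rw [norm_mul]
      gcongr
      exact hA k
  -- Young's inequality: half of the dissipation absorbs the transport term, which is of first order
  -- only.
  have e3 : |t| * |η| ≤ ν * μ / 2 + t ^ 2 / (2 * ν) := by
    have h0 : |t| * |η| ≤ ν * η ^ 2 / 2 + t ^ 2 / (2 * ν) := by
      rw [← sub_nonneg]
      have : ν * η ^ 2 / 2 + t ^ 2 / (2 * ν) - |t| * |η| = (ν * |η| - |t|) ^ 2 / (2 * ν) := by
        field_simp
        rw [← sq_abs η, ← sq_abs t]
        ring
      rw [this]
      positivity
    have : ν * η ^ 2 / 2 ≤ ν * μ / 2 := by gcongr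
    linarith
  have e4 : ν * μ * ‖x‖ ≤ (ν * μ / 2 + t ^ 2 / (2 * ν)) * ‖x‖ + A * ‖y‖ + ‖F‖ := by
    have := mul_le_mul_of_nonneg_right e3 (norm_nonneg x)
    linarith
  have e5 : μ * ‖x‖ ≤ 2 / ν * (t ^ 2 / (2 * ν) * ‖x‖ + A * ‖y‖ + ‖F‖) := by
    rw [div_mul_eq_mul_div, le_div_iff₀ hν]
    linarith
  have hT : 0 ≤ t ^ 2 / (2 * ν) := by positivity
  have e6 : t ^ 2 / (2 * ν) * ‖x‖ + A * ‖y‖ + ‖F‖ ≤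
      (1 + t ^ 2 / (2 * ν) + A) * (‖F‖ + ‖x‖ + ‖y‖) := by
    have := norm_nonneg x
    have := norm_nonneg y
    have := norm_nonneg F
    have hp : 0 ≤ t ^ 2 / (2 * ν) * (‖F‖ + ‖y‖) := by positivity
    have hq : 0 ≤ A * (‖F‖ + ‖x‖) := by positivity
    nlinarith
  have e7 : 2 / ν * (t ^ 2 / (2 * ν) * ‖x‖ + A * ‖y‖ + ‖F‖) ≤
      2 / ν * ((1 + t ^ 2 / (2 * ν) + A) * (‖F‖ + ‖x‖ + ‖y‖)) := by gcongr
  have := norm_nonneg y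
  have := norm_nonneg F
  linarith

/-- The estimate bounds `(1 + μ) ‖v̂‖` by the coefficients of three elements of `H¹₀`, which are
square summable with weight `1 + μ`. Squaring yields the weight `(1 + μ)³`, that is, `H³`
regularity. -/
theorem summable_of_elliptic (h₁ : 0 < L₁) (h₂ : 0 < L₂) (t : ℝ) {ν : ℝ} (hν : 0 < ν)
    (v w F : HOneZero L₁ L₂) (h : ∀ k, coef (F.1 0) k =
      t * (Complex.I * freqY L₂ k.2 * coef (v.1 0) k) + alpha L₁ L₂ k * coef (w.1 0) k -
        ν * mu L₁ L₂ k * coef (v.1 0) k) :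
    Summable fun k => (1 + mu L₁ L₂ k) ^ 3 * ‖coef (v.1 0) k‖ ^ 2 := by
  obtain ⟨C, hC⟩ := exists_elliptic_bound h₁ L₂ t hν
  have hsum := (((summable_mu_coef h₁ h₂ F).add (summable_mu_coef h₁ h₂ v)).add
    (summable_mu_coef h₁ h₂ w)).mul_left (3 * C ^ 2)
  refine Summable.of_nonneg_of_le (fun k => ?_) (fun k => ?_) hsum
  · have := mu_pos (L₂ := L₂) h₁ k
    positivity
  · have hm := mu_pos (L₂ := L₂) h₁ k
    have hb := hC k _ _ _ (h k)
    set a := ‖coef (F.1 0) k‖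
    set b := ‖coef (v.1 0) k‖
    set c := ‖coef (w.1 0) k‖
    have hb2 : ((1 + mu L₁ L₂ k) * b) ^ 2 ≤ (C * (a + b + c)) ^ 2 :=
      pow_le_pow_left₀ (by positivity) hb 2
    have h3 : (a + b + c) ^ 2 ≤ 3 * (a ^ 2 + b ^ 2 + c ^ 2) := by
      nlinarith [sq_nonneg (a - b), sq_nonneg (b - c), sq_nonneg (a - c)]
    calc (1 + mu L₁ L₂ k) ^ 3 * b ^ 2 = (1 + mu L₁ L₂ k) * ((1 + mu L₁ L₂ k) * b) ^ 2 := by ring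
      _ ≤ (1 + mu L₁ L₂ k) * (C * (a + b + c)) ^ 2 := by gcongr
      _ = (1 + mu L₁ L₂ k) * C ^ 2 * (a + b + c) ^ 2 := by ring
      _ ≤ (1 + mu L₁ L₂ k) * C ^ 2 * (3 * (a ^ 2 + b ^ 2 + c ^ 2)) := by gcongr
      _ = _ := by ring

theorem exists_hasWeakLaplacian (h₁ : 0 < L₁) (h₂ : 0 < L₂) (v : HOneZero L₁ L₂)
    (hv : Summable fun k => (1 + mu L₁ L₂ k) ^ 3 * ‖coef (v.1 0) k‖ ^ 2) :
    ∃ g, HasWeakLaplacian v g := by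
  have hs : Summable fun k => ‖-(mu L₁ L₂ k : ℂ) * coef (v.1 0) k‖ ^ 2 := by
    refine Summable.of_nonneg_of_le (fun k => by positivity) (fun k => ?_) hv
    have hm := mu_pos (L₂ := L₂) h₁ k
    rw [norm_mul, norm_neg, Complex.norm_real, Real.norm_of_nonneg hm.le, mul_pow]
    gcongr
    nlinarith [pow_pos hm 3]
  obtain ⟨g, hg⟩ := exists_coef_eq h₁ h₂ hs
  exact ⟨g, (hasWeakLaplacian_iff_coef h₁ h₂ v g).2 hg⟩

/-- The Poisson equation is solvable for right-hand sides in `H¹₀`. -/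
theorem exists_poisson (h₁ : 0 < L₁) (h₂ : 0 < L₂) (f : HOneZero L₁ L₂) :
    ∃ W : HOneZero L₁ L₂, HasWeakLaplacian W (f.1 0) := by
  have hs : Summable fun k => (1 + mu L₁ L₂ k) * ‖-coef (f.1 0) k / mu L₁ L₂ k‖ ^ 2 := by
    refine Summable.of_nonneg_of_le (fun k => ?_) (fun k => ?_)
      ((summable_mu_coef h₁ h₂ f).mul_left ((1 / freqX L₁ 1 ^ 2) ^ 2))
    · have := mu_pos (L₂ := L₂) h₁ k
      positivity
    · have hm := mu_pos (L₂ := L₂) h₁ k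
      have hx : 0 < freqX L₁ 1 := freqX_pos h₁ 1
      have hm1 := sq_freqX_one_le_mu (L₂ := L₂) h₁ k
      rw [norm_div, norm_neg, Complex.norm_real, Real.norm_of_nonneg hm.le, div_pow,
        mul_left_comm, div_eq_mul_one_div, mul_comm (‖_‖ ^ 2), ← one_div_pow]
      gcongr
  obtain ⟨W, hW⟩ := exists_hOneZero_coef_eq h₁ h₂ hs
  refine ⟨W, (hasWeakLaplacian_iff_coef h₁ h₂ _ _).2 fun k => ?_⟩
  have hm : (mu L₁ L₂ k : ℂ) ≠ 0 := by exact_mod_cast (mu_pos h₁ k).ne'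
  rw [hW]
  field_simp

theorem coef_isATwo (h₁ : 0 < L₁) (h₂ : 0 < L₂) {f a : LTwo L₁ L₂} (h : IsATwo f a)
    (k : ℕ+ × ℤ) : ((1 / L₁ : ℝ) : ℂ) * coef a k = alpha L₁ L₂ k * coef f k := by
  obtain ⟨W, hW, rfl⟩ := h
  have hm : (mu L₁ L₂ k : ℂ) ≠ 0 := by exact_mod_cast (mu_pos h₁ k).ne'
  have hl : (L₁ : ℂ) ≠ 0 := by exact_mod_cast h₁.ne'
  rw [(hasWeakLaplacian_iff_coef h₁ h₂ _ _).1 hW k, coef_snd h₁ h₂, alpha]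
  push_cast
  field_simp

/-- The linearization acts on each mode by a `2 × 2` matrix. -/
theorem linRel_iff_coef (h₁ : 0 < L₁) (h₂ : 0 < L₂) {ν : ℝ} (hν : 0 < ν) (ΔT : ℝ)
    (u F : Phase L₁ L₂) : LinRel ν ΔT u F ↔ ∀ k,
      coef (F.1.1 0) k = ΔT * (Complex.I * freqY L₂ k.2 * coef (u.1.1 0) k) +
        alpha L₁ L₂ k * (coef (u.1.1 0) k + coef (u.2.1 0) k) -
        ν * mu L₁ L₂ k * coef (u.1.1 0) k ∧
      coef (F.2.1 0) k = -(alpha L₁ L₂ k * (coef (u.1.1 0) k + coef (u.2.1 0) k)) -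
        ν * mu L₁ L₂ k * coef (u.2.1 0) k := by
  have hcoef : ∀ {a g₁ g₂ : LTwo L₁ L₂}, IsATwo (u.1.1 0 + u.2.1 0) a →
      HasWeakLaplacian u.1 g₁ → HasWeakLaplacian u.2 g₂ → ∀ k,
      coef ((ΔT : ℂ) • u.1.1 2 + ((1 / L₁ : ℝ) : ℂ) • a + (ν : ℂ) • g₁) k =
        ΔT * (Complex.I * freqY L₂ k.2 * coef (u.1.1 0) k) +
        alpha L₁ L₂ k * (coef (u.1.1 0) k + coef (u.2.1 0) k) -
        ν * mu L₁ L₂ k * coef (u.1.1 0) k ∧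
      coef (-(((1 / L₁ : ℝ) : ℂ) • a) + (ν : ℂ) • g₂) k =
        -(alpha L₁ L₂ k * (coef (u.1.1 0) k + coef (u.2.1 0) k)) -
        ν * mu L₁ L₂ k * coef (u.2.1 0) k := by
    intro a g₁ g₂ ha hg₁ hg₂ k
    have e := coef_isATwo h₁ h₂ ha k
    rw [coef_add] at e
    rw [coef_add, coef_add, coef_add, coef_neg, coef_smul, coef_smul, coef_smul, coef_smul, e,
      coef_snd h₁ h₂, (hasWeakLaplacian_iff_coef h₁ h₂ _ _).1 hg₁ k,
      (hasWeakLaplacian_iff_coef h₁ h₂ _ _).1 hg₂ k]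
    constructor <;> ring
  constructor
  · rintro ⟨_, _, a, g₁, g₂, ha, hg₁, hg₂, e1, e2⟩ k
    rw [e1, e2]
    exact hcoef ha hg₁ hg₂ k
  · intro h
    have hadd : ∀ k, coef ((u.1 + u.2).1 0) k = coef (u.1.1 0) k + coef (u.2.1 0) k := fun k =>
      coef_add _ _ k
    have hneg : ∀ k, coef ((-(u.1 + u.2)).1 0) k = -(coef (u.1.1 0) k + coef (u.2.1 0) k) :=
      fun k => by rw [← hadd]; exact coef_neg _ k
    -- Both rows are instances of the scalar estimate once the coupling is treated as data: `u₁ +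
    -- u₂` in the first row, and `-(u₁ + u₂)` without transport in the second.
    have s1 := summable_of_elliptic h₁ h₂ ΔT hν u.1 (u.1 + u.2) F.1 fun k => by
      rw [hadd]
      exact (h k).1
    have s2 := summable_of_elliptic h₁ h₂ 0 hν u.2 (-(u.1 + u.2)) F.2 fun k => by
      rw [hneg, (h k).2]
      push_cast
      ring
    obtain ⟨g₁, hg₁⟩ := exists_hasWeakLaplacian h₁ h₂ u.1 s1
    obtain ⟨g₂, hg₂⟩ := exists_hasWeakLaplacian h₁ h₂ u.2 s2
    obtain ⟨W, hW⟩ := exists_poisson h₁ h₂ (u.1 + u.2)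
    have ha : IsATwo (u.1.1 0 + u.2.1 0) (W.1 2) := ⟨W, hW, rfl⟩
    refine ⟨memZ_of_summable h₁ h₂ _ s1, memZ_of_summable h₁ h₂ _ s2, W.1 2, g₁, g₂, ha, hg₁, hg₂,
      coef_ext h₁ h₂ fun k => ?_, coef_ext h₁ h₂ fun k => ?_⟩
    · rw [(h k).1, (hcoef ha hg₁ hg₂ k).1]
    · rw [(h k).2, (hcoef ha hg₁ hg₂ k).2]

/-! ### The characteristic polynomial and its roots -/

theorem sqrt_sq_eq (z : ℂ) : Complex.sqrt z ^ 2 = z := by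
  rw [Complex.sqrt, ← Nat.cast_ofNat (R := ℂ), Complex.cpow_nat_inv_pow z two_ne_zero]

/-- The quantity `(|D| + D) / 2` is the positive part of `D`, so a nonpositive discriminant does not
move the real part. -/
theorem sqrt_ofReal_re (D : ℝ) : (Complex.sqrt (D : ℂ)).re = Real.sqrt ((|D| + D) / 2) := by
  rw [Complex.sqrt, Complex.cpow_inv_two_re, Complex.norm_real, Complex.ofReal_re,
    Real.norm_eq_abs]

/-- The characteristic polynomial of the action of the linearization on a mode. -/
noncomputable def charDet (L₁ L₂ ν ΔT : ℝ) (k : ℕ+ × ℤ) (z : ℂ) : ℂ :=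
  (z - (ΔT * (Complex.I * freqY L₂ k.2) + alpha L₁ L₂ k - ν * mu L₁ L₂ k)) *
    (z - (-alpha L₁ L₂ k - ν * mu L₁ L₂ k)) + alpha L₁ L₂ k * alpha L₁ L₂ k

theorem mu_eq (h₁ : 0 < L₁) (h₂ : 0 < L₂) (k : ℕ+ × ℤ) :
    mu L₁ L₂ k = Real.pi ^ 2 / L₁ ^ 2 * ((k.1 : ℝ) ^ 2 + 4 * ((k.2 : ℝ) / (L₂ / L₁)) ^ 2) := by
  simp only [mu, freqX, freqY]
  push_cast
  field_simp
  ring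

theorem lamMid_eq (h₁ : 0 < L₁) (h₂ : 0 < L₂) (ν ΔT : ℝ) (k : ℕ+ × ℤ) :
    lamMid L₁ (L₂ / L₁) ν ΔT k =
      Complex.I * ((ΔT * freqY L₂ k.2 / 2 : ℝ) : ℂ) - ((ν * mu L₁ L₂ k : ℝ) : ℂ) := by
  have e1 : Real.pi * ((k.2 : ℝ) * ΔT / (L₂ / L₁ * L₁)) = ΔT * freqY L₂ k.2 / 2 := by
    rw [freqY]
    field_simp
  have e2 : Real.pi ^ 2 * (ν / L₁ ^ 2) * ((k.1 : ℝ) ^ 2 + 4 * (k.2 : ℝ) ^ 2 / (L₂ / L₁) ^ 2) =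
      ν * mu L₁ L₂ k := by
    rw [mu_eq h₁ h₂]
    field_simp
  rw [lamMid, e1, e2]

theorem discr_eq (h₁ : 0 < L₁) (h₂ : 0 < L₂) (ΔT : ℝ) (k : ℕ+ × ℤ) :
    discr L₁ (L₂ / L₁) ΔT k =
      -(freqY L₂ k.2 ^ 2 * ΔT ^ 2 / 4) + freqY L₂ k.2 ^ 2 * ΔT / (L₁ * mu L₁ L₂ k) := by
  have hk : (0 : ℝ) < ((k.1 : ℕ) : ℝ) := by exact_mod_cast k.1.pos
  have hpos : 0 < ((k.1 : ℝ) ^ 2 + 4 * ((k.2 : ℝ) / (L₂ / L₁)) ^ 2) := by positivity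
  rw [discr, mu_eq h₁ h₂, freqY]
  set κ := (k.1 : ℝ) ^ 2 + 4 * ((k.2 : ℝ) / (L₂ / L₁)) ^ 2
  have := Real.pi_pos
  field_simp
  ring

/-- Completing the square. The entries `α` and `-α` cancel in the trace, which leaves `lamMid` as
half the trace; what remains is `(iηΔT/2 + α)² - α² = -η²ΔT²/4 + iηΔT α`, and the last term equals
`η²ΔT / (L₁ μ)`. -/
theorem charDet_eq_sub_discr (h₁ : 0 < L₁) (h₂ : 0 < L₂) (ν ΔT : ℝ) (k : ℕ+ × ℤ) (z : ℂ) :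
    charDet L₁ L₂ ν ΔT k z =
      (z - lamMid L₁ (L₂ / L₁) ν ΔT k) ^ 2 - discr L₁ (L₂ / L₁) ΔT k := by
  have hm : (mu L₁ L₂ k : ℂ) ≠ 0 := by exact_mod_cast (mu_pos h₁ k).ne'
  have hl : (L₁ : ℂ) ≠ 0 := by exact_mod_cast h₁.ne'
  have hα : (freqY L₂ k.2 : ℂ) ^ 2 * ΔT / (L₁ * mu L₁ L₂ k) =
      ΔT * (Complex.I * freqY L₂ k.2) * alpha L₁ L₂ k := by
    rw [alpha]
    field_simp
    linear_combination ((freqY L₂ k.2 : ℂ) ^ 2 * ΔT) * Complex.I_sq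
  rw [charDet, lamMid_eq h₁ h₂, discr_eq h₁ h₂]
  push_cast
  rw [hα]
  linear_combination (-(freqY L₂ k.2 : ℂ) ^ 2 * ΔT ^ 2 / 4) * Complex.I_sq

theorem charDet_eq (h₁ : 0 < L₁) (h₂ : 0 < L₂) (ν ΔT : ℝ) (k : ℕ+ × ℤ) (z : ℂ) :
    charDet L₁ L₂ ν ΔT k z =
      (z - lamPlus L₁ (L₂ / L₁) ν ΔT k) * (z - lamMinus L₁ (L₂ / L₁) ν ΔT k) := by
  rw [charDet_eq_sub_discr h₁ h₂, lamPlus, lamMinus]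
  linear_combination sqrt_sq_eq (discr L₁ (L₂ / L₁) ΔT k)

theorem charDet_eq_zero_iff (h₁ : 0 < L₁) (h₂ : 0 < L₂) (ν ΔT : ℝ) (k : ℕ+ × ℤ) (z : ℂ) :
    charDet L₁ L₂ ν ΔT k z = 0 ↔
      z = lamPlus L₁ (L₂ / L₁) ν ΔT k ∨ z = lamMinus L₁ (L₂ / L₁) ν ΔT k := by
  rw [charDet_eq h₁ h₂, mul_eq_zero, sub_eq_zero, sub_eq_zero]

/-! ### Uniform bounds and the resolvent -/

/-- Leaves only finitely many modes outside the asymptotic regime of the determinant bound. By `|x|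
≤ 1 + x²` both frequencies are at most `1 + K`. -/
theorem finite_mu_le (h₁ : 0 < L₁) (h₂ : 0 < L₂) (K : ℝ) : {k | mu L₁ L₂ k ≤ K}.Finite := by
  have habs : ∀ x : ℝ, |x| ≤ 1 + x ^ 2 := fun x => by
    nlinarith [sq_nonneg (|x| - 1), sq_abs x, abs_nonneg x]
  have hpi := Real.pi_pos
  obtain ⟨n, hn⟩ := exists_nat_gt ((1 + K) * L₁ / Real.pi)
  obtain ⟨m, hm⟩ := exists_nat_gt ((1 + K) * L₂ / (2 * Real.pi))
  refine ((finite_Iic (n.succPNat)).prod (finite_Icc (-(m : ℤ)) m)).subset fun k hk => ?_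
  have hk' : freqX L₁ k.1 ^ 2 + freqY L₂ k.2 ^ 2 ≤ K := hk
  have hx := habs (freqX L₁ k.1)
  have hy := habs (freqY L₂ k.2)
  have hx' : freqX L₁ k.1 ≤ 1 + K := by
    nlinarith [le_abs_self (freqX L₁ k.1), sq_nonneg (freqY L₂ k.2)]
  have hy' : |freqY L₂ k.2| ≤ 1 + K := by nlinarith [sq_nonneg (freqX L₁ k.1)]
  constructor
  · have h : ((k.1 : ℕ) : ℝ) < n := by
      refine lt_of_le_of_lt ?_ hn
      rw [le_div_iff₀ hpi]
      rw [freqX, div_le_iff₀ h₁] at hx'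
      push_cast at hx'
      linarith
    have h' : (k.1 : ℕ) < n := by exact_mod_cast h
    rw [mem_Iic, ← PNat.coe_le_coe, Nat.succPNat_coe]
    omega
  · have h : |(k.2 : ℝ)| < m := by
      refine lt_of_le_of_lt ?_ hm
      rw [le_div_iff₀ (by positivity)]
      rw [freqY, abs_div, abs_of_pos h₂, div_le_iff₀ h₂, abs_mul, abs_of_pos (by positivity)] at hy'
      linarith
    have h' : |k.2| < (m : ℤ) := by exact_mod_cast h
    rw [abs_lt] at h'
    exact ⟨h'.1.le, h'.2.le⟩

/-- The discriminant grows at most linearly in `μ`, hence is dominated by the square of the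
dissipation `νμ`. -/
theorem abs_discr_le (h₁ : 0 < L₁) (h₂ : 0 < L₂) (ΔT : ℝ) (k : ℕ+ × ℤ) :
    |discr L₁ (L₂ / L₁) ΔT k| ≤ mu L₁ L₂ k * ΔT ^ 2 / 4 + |ΔT| / L₁ := by
  have hm := mu_pos (L₂ := L₂) h₁ k
  have hy := sq_freqY_le (L₁ := L₁) (L₂ := L₂) k
  rw [discr_eq h₁ h₂]
  refine (abs_add_le _ _).trans (add_le_add ?_ ?_)
  · rw [abs_neg, abs_of_nonneg (by positivity)]
    gcongr
  · rw [abs_div, abs_mul, abs_of_pos (mul_pos h₁ hm), abs_of_nonneg (sq_nonneg (freqY L₂ k.2)),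
      div_le_div_iff₀ (mul_pos h₁ hm) h₁]
    calc freqY L₂ k.2 ^ 2 * |ΔT| * L₁ ≤ mu L₁ L₂ k * |ΔT| * L₁ := by gcongr
      _ = |ΔT| * (L₁ * mu L₁ L₂ k) := by ring

/-- Away from the eigenvalues the characteristic polynomial grows at least like `μ`. -/
theorem exists_charDet_bound (h₁ : 0 < L₁) (h₂ : 0 < L₂) {ν : ℝ} (hν : 0 < ν) (ΔT : ℝ) (z : ℂ)
    (hz : ∀ k, charDet L₁ L₂ ν ΔT k z ≠ 0) :
    ∃ C, 0 ≤ C ∧ ∀ k, 1 + mu L₁ L₂ k ≤ C * ‖charDet L₁ L₂ ν ΔT k z‖ := by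
  -- For `μ ≥ 1`, `B μ` dominates `1 + μ + |D_k|`. Beyond `K` one has `|z - lamMid| ≥ νμ/2`, because
  -- `2|z| ≤ νμ`, and `(νμ/2)² ≥ B μ`, because `ν² μ ≥ 4B`.
  set B := 2 + ΔT ^ 2 / 4 + |ΔT| / L₁ with hB
  set K := max 1 (max (2 * ‖z‖ / ν) (4 * B / ν ^ 2)) with hK
  have hlarge : ∀ k, K < mu L₁ L₂ k → 1 + mu L₁ L₂ k ≤ ‖charDet L₁ L₂ ν ΔT k z‖ := by
    intro k hk
    set μ := mu L₁ L₂ k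
    have k1 : 1 ≤ μ := (le_max_left _ _).trans hk.le
    have k2 : 2 * ‖z‖ ≤ ν * μ := by
      have := ((le_max_left _ _).trans (le_max_right _ _)).trans hk.le
      rwa [div_le_iff₀ hν, mul_comm μ] at this
    have k3 : 4 * B ≤ ν ^ 2 * μ := by
      have := ((le_max_right _ _).trans (le_max_right _ _)).trans hk.le
      rwa [div_le_iff₀ (by positivity), mul_comm μ] at this
    have e1 : ν * μ / 2 ≤ ‖z - lamMid L₁ (L₂ / L₁) ν ΔT k‖ := by
      have h1 := Complex.re_le_norm (z - lamMid L₁ (L₂ / L₁) ν ΔT k)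
      have h2 : (lamMid L₁ (L₂ / L₁) ν ΔT k).re = -(ν * μ) := by
        rw [lamMid_eq h₁ h₂]
        simp [μ]
      rw [Complex.sub_re, h2] at h1
      have h3 := Complex.abs_re_le_norm z
      linarith [neg_abs_le z.re]
    have e2 := abs_discr_le h₁ h₂ ΔT k
    have e3 : ‖z - lamMid L₁ (L₂ / L₁) ν ΔT k‖ ^ 2 - |discr L₁ (L₂ / L₁) ΔT k| ≤
        ‖charDet L₁ L₂ ν ΔT k z‖ := by
      rw [charDet_eq_sub_discr h₁ h₂, ← norm_pow, ← Real.norm_eq_abs, ← Complex.norm_real]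
      exact norm_sub_norm_le _ _
    have e4 : (ν * μ / 2) ^ 2 ≤ ‖z - lamMid L₁ (L₂ / L₁) ν ΔT k‖ ^ 2 :=
      pow_le_pow_left₀ (by positivity) e1 2
    have e5 : B * μ ≤ (ν * μ / 2) ^ 2 := by nlinarith
    have e6 : 0 ≤ |ΔT| / L₁ := by positivity
    have e7 : 1 + μ + (μ * ΔT ^ 2 / 4 + |ΔT| / L₁) ≤ B * μ := by
      rw [hB]
      nlinarith
    linarith
  -- On the finitely many modes with `μ ≤ K` the determinants are nonzero, so the ratio has a
  -- maximum.
  obtain ⟨C, hC⟩ := ((finite_mu_le h₁ h₂ K).image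
    fun k => (1 + mu L₁ L₂ k) / ‖charDet L₁ L₂ ν ΔT k z‖).bddAbove
  refine ⟨max 1 C, by positivity, fun k => ?_⟩
  by_cases hk : mu L₁ L₂ k ≤ K
  · have h0 := hC (mem_image_of_mem _ hk)
    rw [div_le_iff₀ (norm_pos_iff.2 (hz k))] at h0
    exact h0.trans (mul_le_mul_of_nonneg_right (le_max_right _ _) (norm_nonneg _))
  · exact (hlarge k (not_le.1 hk)).trans
      (le_mul_of_one_le_left (norm_nonneg _) (le_max_left _ _))

theorem exists_multiplier (h₁ : 0 < L₁) (h₂ : 0 < L₂) {m : ℕ+ × ℤ → ℂ} {C : ℝ}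
    (hm : ∀ k, ‖m k‖ ≤ C) : ∃ T : HOneZero L₁ L₂ →L[ℂ] HOneZero L₁ L₂,
      ∀ v k, coef ((T v).1 0) k = m k * coef (v.1 0) k := by
  obtain ⟨T, hT⟩ := exists_diagonal (jetBasis h₁ h₂) hm
  refine ⟨T, fun v k => mul_left_cancel₀ (sqrt_mu_ne_zero (L₂ := L₂) h₁ k) ?_⟩
  have := hT v k
  rw [jetBasis_repr, jetBasis_repr] at this
  rw [this]
  ring

/-- The inverse matrix is the adjugate divided by the determinant. These bounds on the adjugate are
balanced by the lower bound on the determinant in `exists_charDet_bound`. -/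
theorem exists_entry_bound (h₁ : 0 < L₁) (L₂ ν ΔT : ℝ) (hν : 0 < ν) (z : ℂ) :
    ∃ B, 0 ≤ B ∧ ∀ k,
      ‖alpha L₁ L₂ k‖ ≤ B * (1 + mu L₁ L₂ k) ∧
      ‖z - (ΔT * (Complex.I * freqY L₂ k.2) + alpha L₁ L₂ k - ν * mu L₁ L₂ k)‖ ≤
        B * (1 + mu L₁ L₂ k) ∧
      ‖z - (-alpha L₁ L₂ k - ν * mu L₁ L₂ k)‖ ≤ B * (1 + mu L₁ L₂ k) := by
  obtain ⟨A, hA0, hA⟩ := exists_norm_alpha_le h₁ L₂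
  refine ⟨‖z‖ + |ΔT| + A + ν, by positivity, fun k => ?_⟩
  have hm := mu_pos (L₂ := L₂) h₁ k
  have hy := sq_freqY_le (L₁ := L₁) (L₂ := L₂) k
  have hα := hA k
  set μ := mu L₁ L₂ k
  have hη : |freqY L₂ k.2| ≤ 1 + μ := by
    nlinarith [sq_nonneg (|freqY L₂ k.2| - 1), sq_abs (freqY L₂ k.2), abs_nonneg (freqY L₂ k.2)]
  have hνμ : ‖(ν : ℂ) * μ‖ = ν * μ := by
    rw [norm_mul, Complex.norm_real, Complex.norm_real, Real.norm_of_nonneg hν.le,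
      Real.norm_of_nonneg hm.le]
  have hT : ‖(ΔT : ℂ) * (Complex.I * freqY L₂ k.2)‖ ≤ |ΔT| * (1 + μ) := by
    rw [norm_mul, norm_mul, Complex.norm_I, one_mul, Complex.norm_real, Complex.norm_real,
      Real.norm_eq_abs, Real.norm_eq_abs]
    gcongr
  have p1 : 0 ≤ ‖z‖ * μ := by positivity
  have p2 : 0 ≤ A * μ := by positivity
  have p3 : 0 ≤ |ΔT| * (1 + μ) := by positivity
  have p4 := norm_nonneg z
  have p5 : 0 ≤ ν * μ := by positivity
  refine ⟨by nlinarith, ?_, ?_⟩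
  · refine (norm_sub_le _ _).trans ?_
    have q1 := norm_sub_le ((ΔT : ℂ) * (Complex.I * freqY L₂ k.2) + alpha L₁ L₂ k) (ν * μ)
    have q2 := norm_add_le ((ΔT : ℂ) * (Complex.I * freqY L₂ k.2)) (alpha L₁ L₂ k)
    nlinarith
  · refine (norm_sub_le _ _).trans ?_
    have q1 := norm_sub_le (-alpha L₁ L₂ k) (ν * μ)
    rw [norm_neg] at q1
    nlinarith

theorem coef_sub (f g : LTwo L₁ L₂) (k : ℕ+ × ℤ) : coef (f - g) k = coef f k - coef g k :=
  inner_sub_right _ _ _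

theorem phase_ext (h₁ : 0 < L₁) (h₂ : 0 < L₂) {u w : Phase L₁ L₂}
    (h : ∀ k, coef (u.1.1 0) k = coef (w.1.1 0) k ∧ coef (u.2.1 0) k = coef (w.2.1 0) k) :
    u = w :=
  Prod.ext (hOneZero_coef_ext h₁ h₂ fun k => (h k).1) (hOneZero_coef_ext h₁ h₂ fun k => (h k).2)

/-- Cramer's rule for the matrix with rows `(a, α)` and `(-α, d)`. -/
theorem cramer_solution {a d α z D f g : ℂ} (hD : D = (z - a) * (z - d) + α * α) (h0 : D ≠ 0) :
    z * ((z - d) / D * f + α / D * g) - f =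
        a * ((z - d) / D * f + α / D * g) + α * ((z - a) / D * g - α / D * f) ∧
      z * ((z - a) / D * g - α / D * f) - g =
        -α * ((z - d) / D * f + α / D * g) + d * ((z - a) / D * g - α / D * f) := by
  constructor
  · field_simp
    linear_combination -f * hD
  · field_simp
    linear_combination -g * hD

theorem cramer_unique {a d α z D x y : ℂ} (hD : D = (z - a) * (z - d) + α * α) (h0 : D ≠ 0) :
    (z - d) / D * (z * x - (a * x + α * y)) + α / D * (z * y - (-α * x + d * y)) = x ∧
      (z - a) / D * (z * y - (-α * x + d * y)) - α / D * (z * x - (a * x + α * y)) = y := by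
  constructor
  · field_simp
    linear_combination -x * hD
  · field_simp
    linear_combination -y * hD

/-- Where no characteristic polynomial vanishes, the resolvent exists. -/
theorem mem_resolventSet (h₁ : 0 < L₁) (h₂ : 0 < L₂) {ν : ℝ} (hν : 0 < ν) (ΔT : ℝ) {z : ℂ}
    (hz : ∀ k, charDet L₁ L₂ ν ΔT k z ≠ 0) : z ∈ resolventSet (linearization L₁ L₂ ν ΔT) := by
  obtain ⟨C, hC0, hC⟩ := exists_charDet_bound h₁ h₂ hν ΔT z hz
  obtain ⟨B, hB0, hB⟩ := exists_entry_bound h₁ L₂ ν ΔT hν z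
  have hdiv : ∀ (k : ℕ+ × ℤ) (w : ℂ), ‖w‖ ≤ B * (1 + mu L₁ L₂ k) →
      ‖w / charDet L₁ L₂ ν ΔT k z‖ ≤ B * C := by
    intro k w hw
    rw [norm_div, div_le_iff₀ (norm_pos_iff.2 (hz k)), mul_assoc]
    exact hw.trans (mul_le_mul_of_nonneg_left (hC k) hB0)
  -- The entries of the inverse matrix as bounded operators on `H¹₀`. `Q` serves both off-diagonal
  -- places, with opposite signs.
  obtain ⟨P, hP⟩ := exists_multiplier h₁ h₂ fun k => hdiv k _ (hB k).2.2
  obtain ⟨Q, hQ⟩ := exists_multiplier h₁ h₂ fun k => hdiv k _ (hB k).1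
  obtain ⟨S, hS⟩ := exists_multiplier h₁ h₂ fun k => hdiv k _ (hB k).2.1
  obtain ⟨R, hR1, hR2⟩ : ∃ R : Phase L₁ L₂ →L[ℂ] Phase L₁ L₂,
      (∀ f k, coef ((R f).1.1 0) k =
        (z - (-alpha L₁ L₂ k - ν * mu L₁ L₂ k)) / charDet L₁ L₂ ν ΔT k z * coef (f.1.1 0) k +
          alpha L₁ L₂ k / charDet L₁ L₂ ν ΔT k z * coef (f.2.1 0) k) ∧
      ∀ f k, coef ((R f).2.1 0) k =
        (z - (ΔT * (Complex.I * freqY L₂ k.2) + alpha L₁ L₂ k - ν * mu L₁ L₂ k)) /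
          charDet L₁ L₂ ν ΔT k z * coef (f.2.1 0) k -
          alpha L₁ L₂ k / charDet L₁ L₂ ν ΔT k z * coef (f.1.1 0) k := by
    refine ⟨(P.comp (ContinuousLinearMap.fst ℂ _ _) + Q.comp (ContinuousLinearMap.snd ℂ _ _)).prod
      (S.comp (ContinuousLinearMap.snd ℂ _ _) - Q.comp (ContinuousLinearMap.fst ℂ _ _)),
      fun f k => ?_, fun f k => ?_⟩
    · change coef ((P f.1).1 0 + (Q f.2).1 0) k = _
      rw [coef_add, hP, hQ]
    · change coef ((S f.2).1 0 - (Q f.1).1 0) k = _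
      rw [coef_sub, hS, hQ]
  have hsub1 : ∀ (u F : Phase L₁ L₂) k, coef ((z • u - F).1.1 0) k =
      z * coef (u.1.1 0) k - coef (F.1.1 0) k := by
    intro u F k
    change coef (z • u.1.1 0 - F.1.1 0) k = _
    rw [coef_sub, coef_smul]
  have hsub2 : ∀ (u F : Phase L₁ L₂) k, coef ((z • u - F).2.1 0) k =
      z * coef (u.2.1 0) k - coef (F.2.1 0) k := by
    intro u F k
    change coef (z • u.2.1 0 - F.2.1 0) k = _
    rw [coef_sub, coef_smul]
  refine ⟨R, fun f => ?_, fun u => ?_⟩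
  · have hrel : LinRel ν ΔT (R f) (z • R f - f) := by
      refine (linRel_iff_coef h₁ h₂ hν ΔT _ _).2 fun k => ?_
      obtain ⟨c1, c2⟩ := cramer_solution (f := coef (f.1.1 0) k) (g := coef (f.2.1 0) k)
        (charDet.eq_1 L₁ L₂ ν ΔT k z) (hz k)
      rw [← hR1, ← hR2] at c1 c2
      rw [hsub1, hsub2, c1, c2]
      constructor <;> ring
    obtain ⟨y, hy1, hy2⟩ := (LinearPMap.mem_graph_iff _).1
      ((mem_graph_linearization h₁ h₂ ν ΔT _ _).2 hrel)
    simp only at hy1 hy2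
    have hy3 : R f ∈ (linearization L₁ L₂ ν ΔT).domain := hy1 ▸ y.2
    refine ⟨hy3, ?_⟩
    have hy4 : y = ⟨R f, hy3⟩ := Subtype.ext hy1
    rw [← hy4, hy2, sub_sub_cancel]
  · have hrel := (mem_graph_linearization h₁ h₂ ν ΔT _ _).1
      ((linearization L₁ L₂ ν ΔT).mem_graph u)
    rw [linRel_iff_coef h₁ h₂ hν] at hrel
    refine phase_ext h₁ h₂ fun k => ?_
    obtain ⟨c1, c2⟩ := cramer_unique (x := coef ((u : Phase L₁ L₂).1.1 0) k)
      (y := coef ((u : Phase L₁ L₂).2.1 0) k) (charDet.eq_1 L₁ L₂ ν ΔT k z) (hz k)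
    have e1 := (hsub1 u (linearization L₁ L₂ ν ΔT u) k).trans
      (congrArg (z * coef ((u : Phase L₁ L₂).1.1 0) k - ·) (hrel k).1)
    have e2 := (hsub2 u (linearization L₁ L₂ ν ΔT u) k).trans
      (congrArg (z * coef ((u : Phase L₁ L₂).2.1 0) k - ·) (hrel k).2)
    refine ⟨(hR1 _ k).trans (Eq.trans ?_ c1), (hR2 _ k).trans (Eq.trans ?_ c2)⟩
    · congr 2
      · exact e1.trans (by ring)
      · exact e2.trans (by ring)
    · congr 2
      · exact e2.trans (by ring)
      · exact e1.trans (by ring)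

/-! ### Eigenvectors and the spectrum -/

theorem exists_eigenvector (L₁ L₂ ν ΔT : ℝ) {k : ℕ+ × ℤ} {z : ℂ}
    (hz : charDet L₁ L₂ ν ΔT k z = 0) : ∃ x y : ℂ, (x ≠ 0 ∨ y ≠ 0) ∧
      z * x = ΔT * (Complex.I * freqY L₂ k.2 * x) + alpha L₁ L₂ k * (x + y) -
        ν * mu L₁ L₂ k * x ∧
      z * y = -(alpha L₁ L₂ k * (x + y)) - ν * mu L₁ L₂ k * y := by
  rw [charDet] at hz
  -- If `α = 0` the matrix is diagonal and a coordinate vector works; the general kernel vector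
  -- could vanish in this case.
  by_cases hα : alpha L₁ L₂ k = 0
  · rw [hα, mul_zero, add_zero] at hz
    rcases mul_eq_zero.1 hz with h | h
    · refine ⟨1, 0, Or.inl one_ne_zero, ?_, ?_⟩
      · rw [hα]
        linear_combination h
      · rw [hα]
        ring
    · refine ⟨0, 1, Or.inr one_ne_zero, ?_, ?_⟩
      · rw [hα]
        ring
      · rw [hα]
        linear_combination h
  -- The vector `(α, z - a)`, with `a` the upper left entry, solves the first row identically; the
  -- second row is then the vanishing of the determinant.
  · refine ⟨alpha L₁ L₂ k,
      z - (ΔT * (Complex.I * freqY L₂ k.2) + alpha L₁ L₂ k - ν * mu L₁ L₂ k), Or.inl hα, ?_, ?_⟩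
    · ring
    · linear_combination hz

theorem isEigenvalue_of_charDet (h₁ : 0 < L₁) (h₂ : 0 < L₂) {ν : ℝ} (hν : 0 < ν) (ΔT : ℝ)
    {k : ℕ+ × ℤ} {z : ℂ} (hz : charDet L₁ L₂ ν ΔT k z = 0) :
    IsEigenvalue (linearization L₁ L₂ ν ΔT) z := by
  obtain ⟨x, y, hxy, e1, e2⟩ := exists_eigenvector L₁ L₂ ν ΔT hz
  let u : Phase L₁ L₂ := (x • unitJet h₁ h₂ k, y • unitJet h₁ h₂ k)
  have hu1 : ∀ j, coef (u.1.1 0) j = x * coef ((unitJet h₁ h₂ k).1 0) j := fun j =>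
    coef_smul _ _ _
  have hu2 : ∀ j, coef (u.2.1 0) j = y * coef ((unitJet h₁ h₂ k).1 0) j := fun j =>
    coef_smul _ _ _
  have hrel : LinRel ν ΔT u (z • u) := by
    refine (linRel_iff_coef h₁ h₂ hν ΔT _ _).2 fun j => ?_
    have hz1 : coef ((z • u).1.1 0) j = z * coef (u.1.1 0) j := coef_smul _ _ _
    have hz2 : coef ((z • u).2.1 0) j = z * coef (u.2.1 0) j := coef_smul _ _ _
    rw [hz1, hz2, hu1, hu2, coef_unitJet]
    split_ifs with h
    · subst h
      set c := (Real.sqrt (1 + mu L₁ L₂ j) : ℂ)⁻¹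
      exact ⟨by linear_combination c * e1, by linear_combination c * e2⟩
    · simp
  obtain ⟨w, hw1, hw2⟩ := (LinearPMap.mem_graph_iff _).1
    ((mem_graph_linearization h₁ h₂ ν ΔT _ _).2 hrel)
  simp only at hw1 hw2
  refine ⟨w, fun h0 => ?_, by rw [hw1, hw2]⟩
  have hunit : unitJet h₁ h₂ k ≠ 0 := (orthonormal_unitJet h₁ h₂).ne_zero k
  rw [hw1] at h0
  rcases hxy with h | h
  · exact smul_ne_zero h hunit (congrArg Prod.fst h0)
  · exact smul_ne_zero h hunit (congrArg Prod.snd h0)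

theorem IsEigenvalue.mem_spec {E : Type*} [NormedAddCommGroup E] [NormedSpace ℂ E]
    {T : E →ₗ.[ℂ] E} {z : ℂ} (h : IsEigenvalue T z) : z ∈ spec T := by
  rintro ⟨R, _, hR⟩
  obtain ⟨u, hu, hT⟩ := h
  have h0 := hR u
  rw [hT, sub_self, map_zero] at h0
  exact hu h0.symm

theorem mem_spec_linearization_iff (h₁ : 0 < L₁) (h₂ : 0 < L₂) {ν : ℝ} (hν : 0 < ν) (ΔT : ℝ)
    (z : ℂ) : z ∈ spec (linearization L₁ L₂ ν ΔT) ↔ ∃ k, charDet L₁ L₂ ν ΔT k z = 0 := by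
  constructor
  · intro h
    by_contra hne
    push Not at hne
    exact h (mem_resolventSet h₁ h₂ hν ΔT hne)
  · rintro ⟨k, hk⟩
    exact (isEigenvalue_of_charDet h₁ h₂ hν ΔT hk).mem_spec

/-! ### Real parts of the eigenvalues -/

theorem lamMid_re (h₁ : 0 < L₁) (h₂ : 0 < L₂) (ν ΔT : ℝ) (k : ℕ+ × ℤ) :
    (lamMid L₁ (L₂ / L₁) ν ΔT k).re = -(ν * mu L₁ L₂ k) := by
  rw [lamMid_eq h₁ h₂]
  simp

theorem discr_nonpos {l ΔT : ℝ} (h₁ : 0 < L₁) (h : ΔT ≤ 0) (k : ℕ+ × ℤ) :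
    discr L₁ l ΔT k ≤ 0 := by
  refine mul_nonpos_of_nonpos_of_nonneg ?_ ?_
  · exact div_nonpos_of_nonpos_of_nonneg (mul_nonpos_of_nonneg_of_nonpos (sq_nonneg _) h)
      (by positivity)
  · have : Real.pi ^ 2 * (ΔT / L₁) ≤ 0 :=
      mul_nonpos_of_nonneg_of_nonpos (sq_nonneg _) (div_nonpos_of_nonpos_of_nonneg h h₁.le)
    have : 0 ≤ 4 / ((k.1 : ℝ) ^ 2 + 4 * ((k.2 : ℝ) / l) ^ 2) := by positivity
    linarith

/-- The index `k₁` enters only through a denominator, and for `ΔT ≥ 0` the prefactor is nonnegative.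
-/
theorem discr_le {l ΔT : ℝ} (h₁ : 0 < L₁) (h : 0 ≤ ΔT) (k₁ : ℕ+) (k₂ : ℤ) :
    discr L₁ l ΔT (k₁, k₂) ≤ discr L₁ l ΔT (1, k₂) := by
  have hk : (1 : ℝ) ≤ ((k₁ : ℕ) : ℝ) := by exact_mod_cast k₁.pos
  simp only [discr]
  refine mul_le_mul_of_nonneg_left ?_ (by positivity)
  gcongr
  simpa using hk

/-- Only the positive part of the discriminant counts. For `ΔT ≤ 0` it vanishes for every mode; for
`ΔT ≥ 0` taking positive parts preserves the inequality of `discr_le`. -/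
theorem sqrt_ofReal_re_le {l ΔT : ℝ} (h₁ : 0 < L₁) (k₁ : ℕ+) (k₂ : ℤ) :
    (Complex.sqrt (discr L₁ l ΔT (k₁, k₂) : ℂ)).re ≤
      (Complex.sqrt (discr L₁ l ΔT (1, k₂) : ℂ)).re := by
  rw [sqrt_ofReal_re, sqrt_ofReal_re]
  rcases le_total ΔT 0 with h | h
  · rw [abs_of_nonpos (discr_nonpos h₁ h _), neg_add_cancel, zero_div, Real.sqrt_zero]
    exact Real.sqrt_nonneg _
  · have := discr_le (l := l) h₁ h k₁ k₂
    refine Real.sqrt_le_sqrt (div_le_div_of_nonneg_right ?_ zero_le_two)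
    rcases abs_cases (discr L₁ l ΔT (k₁, k₂)) with ⟨e, _⟩ | ⟨e, _⟩ <;>
      rcases abs_cases (discr L₁ l ΔT (1, k₂)) with ⟨e', _⟩ | ⟨e', _⟩ <;> linarith

theorem mu_one_lt (h₁ : 0 < L₁) {k₁ : ℕ+} (hk : k₁ ≠ 1) (k₂ : ℤ) :
    mu L₁ L₂ (1, k₂) < mu L₁ L₂ (k₁, k₂) := by
  have h1 : (1 : ℝ) < ((k₁ : ℕ) : ℝ) := by
    have : 1 < k₁ := lt_of_le_of_ne k₁.pos hk.symm
    exact_mod_cast this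
  have hx : freqX L₁ ((1 : ℕ+) : ℕ) < freqX L₁ k₁ := by
    simp only [freqX]
    push_cast
    have := Real.pi_pos
    gcongr
  have h0 := freqX_pos h₁ 1
  simp only [mu]
  gcongr

end TwoFluid

theorem lemma4p1 (L₁ L₂ ν ΔT : ℝ) (hL₁ : 0 < L₁) (hL₂ : 0 < L₂) (hν : 0 < ν) :
    TwoFluid.spec (TwoFluid.linearization L₁ L₂ ν ΔT) =
        {z | ∃ k : ℕ+ × ℤ, z = TwoFluid.lamPlus L₁ (L₂ / L₁) ν ΔT k ∨
          z = TwoFluid.lamMinus L₁ (L₂ / L₁) ν ΔT k} ∧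
      (∀ z ∈ TwoFluid.spec (TwoFluid.linearization L₁ L₂ ν ΔT),
        TwoFluid.IsEigenvalue (TwoFluid.linearization L₁ L₂ ν ΔT) z) ∧
      (∀ k : ℕ+ × ℤ, TwoFluid.lamMinus L₁ (L₂ / L₁) ν ΔT k ∈
        TwoFluid.stableSpec (TwoFluid.linearization L₁ L₂ ν ΔT)) ∧
      (∀ k : ℕ+ × ℤ, TwoFluid.discr L₁ (L₂ / L₁) ΔT k ≤ 0 →
        TwoFluid.lamPlus L₁ (L₂ / L₁) ν ΔT k ∈
          TwoFluid.stableSpec (TwoFluid.linearization L₁ L₂ ν ΔT)) ∧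
      (∀ (k₁ : ℕ+) (k₂ : ℤ), k₁ ≠ 1 →
        (TwoFluid.lamPlus L₁ (L₂ / L₁) ν ΔT (k₁, k₂)).re <
          (TwoFluid.lamPlus L₁ (L₂ / L₁) ν ΔT (1, k₂)).re) := by
  have hspec := TwoFluid.mem_spec_linearization_iff hL₁ hL₂ hν ΔT
  have hdet := TwoFluid.charDet_eq_zero_iff hL₁ hL₂ ν ΔT
  have hneg : ∀ k, -(ν * TwoFluid.mu L₁ L₂ k) < 0 := fun k =>
    neg_neg_of_pos (mul_pos hν (TwoFluid.mu_pos hL₁ k))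
  refine ⟨?_, fun z hz => ?_, fun k => ⟨?_, ?_⟩, fun k hk => ⟨?_, ?_⟩, fun k₁ k₂ hk => ?_⟩
  · ext z
    rw [hspec]
    exact exists_congr fun k => hdet k z
  · obtain ⟨k, hk⟩ := (hspec z).1 hz
    exact TwoFluid.isEigenvalue_of_charDet hL₁ hL₂ hν ΔT hk
  · exact (hspec _).2 ⟨k, (hdet k _).2 (Or.inr rfl)⟩
  · rw [TwoFluid.lamMinus, Complex.sub_re, TwoFluid.lamMid_re hL₁ hL₂, TwoFluid.sqrt_ofReal_re]
    have := hneg k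
    have := Real.sqrt_nonneg
      ((|TwoFluid.discr L₁ (L₂ / L₁) ΔT k| + TwoFluid.discr L₁ (L₂ / L₁) ΔT k) / 2)
    linarith
  · exact (hspec _).2 ⟨k, (hdet k _).2 (Or.inl rfl)⟩
  · rw [TwoFluid.lamPlus, Complex.add_re, TwoFluid.lamMid_re hL₁ hL₂, TwoFluid.sqrt_ofReal_re,
      abs_of_nonpos hk]
    simpa using mul_pos hν (TwoFluid.mu_pos hL₁ k)
  · rw [TwoFluid.lamPlus, TwoFluid.lamPlus, Complex.add_re, Complex.add_re,
      TwoFluid.lamMid_re hL₁ hL₂, TwoFluid.lamMid_re hL₁ hL₂]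
    -- The square roots are ordered only weakly; strictness comes from the dissipation `νμ`.
    have h1 := TwoFluid.sqrt_ofReal_re_le (l := L₂ / L₁) (ΔT := ΔT) hL₁ k₁ k₂
    have h2 := mul_lt_mul_of_pos_left (TwoFluid.mu_one_lt (L₂ := L₂) hL₁ hk k₂) hν
    linarith
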